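/- **Setting.** Let $\mathrm{Heis}$ be the complex Heisenberg Lie algebra with basis $(a_n)_{n\in\mathbb Z}$ and a central element $K$, with $[a_n,a_m]=n\,\delta_{n,-m}K$. Write $\mathrm{Heis}\oplus\overline{\mathrm{Heis}}$ for the direct sum of two copies (generators $a_n,\bar a_n$). For $(\alpha,\bar\alpha)\in\mathbb R^2$ let $V_{(\alpha,\bar\alpha)}$ be the Verma module of $\mathrm{Heis}\oplus\overline{\mathrm{Heis}}$ with highest weight $(\alpha,\bar\alpha)$: it is generated by a vector killed by $a_n,\bar a_n$ ($n>0$), on which $a_0,\bar a_0$ act by $\alpha,\bar\alpha$, and both central elements act by $1$. On a direct sum of such modules the Virasoro operators are $L_n=\frac12\sum_k :a_{n-k}a_k:$ and $\bar L_n=\frac12\sum_k:\bar a_{n-k}\bar a_k:$. The space of states of the free boson with values in the circle of radius $r$ is $\mathcal H^{(r)}=\bigoplus_{(e,m)\in\mathbb Z^2}V_{(e/r+mr/2,\;e/r-mr/2)}$. For $s\in\{A,P\}$ put $\mathbb Z_A=\mathbb Z+\frac12$, $\mathbb Z_P=\mathbb Z$. Let $\mathcal H_s$ be the space of states of the Majorana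 fermion: the Fock module, generated by an even vacuum vector killed by $b_n,\bar b_n$ for $n>0$, of the modes $b_n,\bar b_n$ ($n\in\mathbb Z_s$), which satisfy $b_nb_m+b_mb_n=\delta_{n,-m}$, $\bar b_n\bar b_m+\bar b_m\bar b_n=\delta_{n,-m}$, $b_n\bar b_m+\bar b_mb_n=0$. In the sector $P$ the two chiralities share a single fermionic zero mode: $\bar b_0|\mathrm{vac}\rangle=i\,b_0|\mathrm{vac}\rangle$. Let $\mathcal H^{\mathrm{Dirac}}=\mathcal H_A\otimes\mathcal H_A\oplus\mathcal H_P\otimes\mathcal H_P$, with modes $b^{(1)}_n,b^{(2)}_n,\bar b^{(1)}_n,\bar b^{(2)}_n$ of the two Majorana fermions (modes of different fermions anticommute), and let "even" denote the subspace of even total fermion parity. Each summand is a $\mathrm{Heis}\oplus\overline{\mathrm{Heis}}$-module in which the central elements act by $1$ and $$a_n=-i\sum_{k\in\mathbb Z_s}b^{(1)}_{n-k}b^{(2)}_k,\qquad \bar a_n=i\sum_{k\in\mathbb Z_s}\bar b^{(1)}_{n-k}\bar b^{(2)}_k$$ (the modes of the $U(1)$-currents $j=-i\psi_1\psi_2$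 and $\bar j=i\bar\psi_1\bar\psi_2$). It also carries the Virasoro operators of the two fermions, $$L_n=\sum_{c=1,2}\Big(\sum_{k\in\mathbb Z_s}\big(\tfrac k2+\tfrac14\big):b^{(c)}_{n-k}b^{(c)}_k:+\,\delta_{n,0}h_s\Big),\qquad h_A=0,\ h_P=\tfrac1{16},$$ and $\bar L_n$ given by the same formula in the $\bar b^{(c)}_k$; here the normal ordering is antisymmetric and puts the mode of larger number to the right, with $:b_0b_0:=0$. Both actions preserve the even part. **Theorem (Bosonization correspondence).** Let $$\Lambda_1=\{(\tfrac e2+m,\tfrac e2-m): e,m\in\mathbb Z,\ e\text{ even}\},\qquad \Lambda_2=\{(\tfrac e2+m,\tfrac e2-m): e,m\in\mathbb Z,\ e\text{ odd}\}.$$ There are isomorphisms of $\mathrm{Heis}\oplus\overline{\mathrm{Heis}}$-modules $$(\mathcal H^{\mathrm{Dirac}})^{\mathrm{even}}\simeq\mathcal H^{(2)},\qquad (\mathcal H_A\otimes\mathcal H_A)^{\mathrm{even}}\simeq\bigoplus_{(\alpha,\bar\alpha)\in\Lambda_1}V_{(\alpha,\bar\alpha)},\qquad (\mathcal H_P\otimes\mathcal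 H_P)^{\mathrm{even}}\simeq\bigoplus_{(\alpha,\bar\alpha)\in\Lambda_2}V_{(\alpha,\bar\alpha)},$$ and each of them is also an isomorphism of $\mathrm{Vir}\oplus\overline{\mathrm{Vir}}$-modules: it intertwines all the operators $L_n,\bar L_n$, $n\in\mathbb Z$. -/

import Mathlib

open scoped DirectSum TensorProduct

noncomputable section

namespace Bosonization

/-! ## The Heisenberg Lie algebra and its Verma modules -/

/-- The 2-cocycle `ω(x, y) = ∑ n, n * x n * y (-n)`. -/
def heisCocycle : (ℤ →₀ ℂ) →ₗ[ℂ] (ℤ →₀ ℂ) →ₗ[ℂ] ℂ :=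
  Finsupp.linearCombination ℂ fun n : ℤ => (n : ℂ) • Finsupp.lapply (-n)

lemma heisCocycle_swap (x y : ℤ →₀ ℂ) : heisCocycle x y = -heisCocycle y x := by
  have h : heisCocycle = -heisCocycle.flip := by
    ext n m
    by_cases hnm : m = -n
    · subst hnm
      simp [heisCocycle]
    · simp [heisCocycle, hnm, show n ≠ -m from fun h => hnm (by omega)]
  exact LinearMap.congr_fun (LinearMap.congr_fun h x) y

/-- The Heisenberg Lie algebra `Heis`: it has the basis `(a n)_{n ∈ ℤ}` together with a central
element `K`, and `[a n, a m] = n δ_{n,-m} K`.  The pair `(x, c)` stands for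
`∑ n, x n • a n + c • K`. -/
def Heis : Type := (ℤ →₀ ℂ) × ℂ

namespace Heis

instance : AddCommGroup Heis := inferInstanceAs (AddCommGroup ((ℤ →₀ ℂ) × ℂ))

instance : Module ℂ Heis := inferInstanceAs (Module ℂ ((ℤ →₀ ℂ) × ℂ))

/-- The coefficients on the generators `a n`. -/
def coeff : Heis →ₗ[ℂ] (ℤ →₀ ℂ) := LinearMap.fst ℂ (ℤ →₀ ℂ) ℂ

/-- The coefficient on the central element. -/
def central : Heis →ₗ[ℂ] ℂ := LinearMap.snd ℂ (ℤ →₀ ℂ) ℂ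

/-- The generator `a n`. -/
def a (n : ℤ) : Heis := (Finsupp.single n 1, 0)

/-- The central generator. -/
def K : Heis := (0, 1)

instance : LieRing Heis where
  bracket x y := (0, heisCocycle x.coeff y.coeff)
  add_lie x y z := Prod.ext (by exact (add_zero 0).symm) (by
    change heisCocycle (coeff (x + y)) (coeff z) = _ + _
    simp)
  lie_add x y z := Prod.ext (by exact (add_zero 0).symm) (by
    change heisCocycle (coeff x) (coeff (y + z)) = _ + _
    simp)
  lie_self x := Prod.ext rfl (by
    have h := heisCocycle_swap (coeff x) (coeff x)
    change heisCocycle (coeff x) (coeff x) = 0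
    linear_combination h / 2)
  leibniz_lie x y z := Prod.ext (by exact (add_zero 0).symm) (by
    change heisCocycle (coeff x) 0 = heisCocycle 0 (coeff z) + heisCocycle (coeff y) 0
    simp)

instance : LieAlgebra ℂ Heis where
  lie_smul t x y := Prod.ext (by exact (smul_zero t).symm) (by
    change heisCocycle (coeff x) (coeff (t • y)) = t • heisCocycle (coeff x) (coeff y)
    simp)

@[simp] lemma coeff_lie (x y : Heis) : coeff ⁅x, y⁆ = 0 := rfl

@[simp] lemma central_lie (x y : Heis) : central ⁅x, y⁆ = heisCocycle x.coeff y.coeff := rfl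

end Heis

/-- Left movers (holomorphic) and right movers (antiholomorphic). -/
inductive Chirality
  | left
  | right
  deriving DecidableEq

/-- The inclusion of the summand of chirality `χ` into `Heis ⊕ Heis`. -/
def heisIncl : Chirality → Heis → Heis × Heis
  | .left, x => (x, 0)
  | .right, x => (0, x)

/-- The left ideal of `U(Heis ⊕ Heis)` generated by `a n`, `ā n` (`n > 0`), `a 0 - α`, `ā 0 - ᾱ`,
`K - 1` and `K̄ - 1`. -/
def vermaIdeal (w : Chirality → ℂ) :
    Submodule (UniversalEnvelopingAlgebra ℂ (Heis × Heis))
      (UniversalEnvelopingAlgebra ℂ (Heis × Heis)) :=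
  Submodule.span _
    ({u | ∃ χ : Chirality, ∃ n : ℤ, 0 < n ∧
        u = UniversalEnvelopingAlgebra.ι ℂ (heisIncl χ (Heis.a n))} ∪
     {u | ∃ χ : Chirality, u = UniversalEnvelopingAlgebra.ι ℂ (heisIncl χ (Heis.a 0)) -
        algebraMap ℂ _ (w χ)} ∪
     {u | ∃ χ : Chirality, u = UniversalEnvelopingAlgebra.ι ℂ (heisIncl χ Heis.K) - 1})

/-- The Verma module of `Heis ⊕ Heis` in which the highest weight vector is an eigenvector of `a 0`
and of `ā 0` with eigenvalues `α = w left` and `ᾱ = w right`, and both central elements act as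
the identity. -/
def Verma (w : Chirality → ℂ) : Type :=
  UniversalEnvelopingAlgebra ℂ (Heis × Heis) ⧸ vermaIdeal w

namespace Verma

variable (w : Chirality → ℂ)

instance : AddCommGroup (Verma w) :=
  inferInstanceAs (AddCommGroup (UniversalEnvelopingAlgebra ℂ (Heis × Heis) ⧸ vermaIdeal w))

instance : Module (UniversalEnvelopingAlgebra ℂ (Heis × Heis)) (Verma w) :=
  inferInstanceAs (Module (UniversalEnvelopingAlgebra ℂ (Heis × Heis))
    (UniversalEnvelopingAlgebra ℂ (Heis × Heis) ⧸ vermaIdeal w))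

instance : Module ℂ (Verma w) :=
  inferInstanceAs (Module ℂ (UniversalEnvelopingAlgebra ℂ (Heis × Heis) ⧸ vermaIdeal w))

instance : IsScalarTower ℂ (UniversalEnvelopingAlgebra ℂ (Heis × Heis)) (Verma w) :=
  inferInstanceAs (IsScalarTower ℂ (UniversalEnvelopingAlgebra ℂ (Heis × Heis))
    (UniversalEnvelopingAlgebra ℂ (Heis × Heis) ⧸ vermaIdeal w))

attribute [local instance 100] LieRing.ofAssociativeRing in
lemma ι_lie (x y : Heis × Heis) :
    UniversalEnvelopingAlgebra.ι ℂ ⁅x, y⁆ =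
      UniversalEnvelopingAlgebra.ι ℂ x * UniversalEnvelopingAlgebra.ι ℂ y -
        UniversalEnvelopingAlgebra.ι ℂ y * UniversalEnvelopingAlgebra.ι ℂ x := by
  rw [LieHom.map_lie, LieRing.of_associative_ring_bracket]

instance : LieRingModule (Heis × Heis) (Verma w) where
  bracket x v := UniversalEnvelopingAlgebra.ι ℂ x • v
  add_lie x y v := by
    change UniversalEnvelopingAlgebra.ι ℂ (x + y) • v = _ + _
    rw [map_add, add_smul]
  lie_add x v v' := smul_add _ _ _
  leibniz_lie x y v := by
    change UniversalEnvelopingAlgebra.ι ℂ x • UniversalEnvelopingAlgebra.ι ℂ y • v =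
      UniversalEnvelopingAlgebra.ι ℂ ⁅x, y⁆ • v +
        UniversalEnvelopingAlgebra.ι ℂ y • UniversalEnvelopingAlgebra.ι ℂ x • v
    rw [ι_lie, sub_smul, mul_smul, mul_smul, sub_add_cancel]

instance : LieModule ℂ (Heis × Heis) (Verma w) where
  smul_lie t x v := by
    change UniversalEnvelopingAlgebra.ι ℂ (t • x) • v = t • UniversalEnvelopingAlgebra.ι ℂ x • v
    rw [map_smul, smul_assoc]
  lie_smul t x v := by
    change UniversalEnvelopingAlgebra.ι ℂ x • t • v = t • UniversalEnvelopingAlgebra.ι ℂ x • v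
    rw [← algebraMap_smul (UniversalEnvelopingAlgebra ℂ (Heis × Heis)) t v,
      ← algebraMap_smul (UniversalEnvelopingAlgebra ℂ (Heis × Heis)) t
        (UniversalEnvelopingAlgebra.ι ℂ x • v), ← mul_smul, ← mul_smul, Algebra.commutes]

end Verma

/-- The weight `(α, ᾱ)`. -/
def weight (α α' : ℝ) : Chirality → ℂ
  | .left => (α : ℂ)
  | .right => (α' : ℂ)

/-! ## Locally finite sums of operators -/

section LocallyFinite

variable {W : Type*} [AddCommGroup W] [Module ℂ W]

/-- Each vector is killed by all but finitely many members of the family. -/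
def LocallyFinite (f : ℤ → Module.End ℂ W) : Prop :=
  ∀ v, (Function.support fun k => f k v).Finite

open Classical in
/-- The sum of a locally finite family of operators, computed vector by vector (zero by convention
if the family is not locally finite). -/
def sumEnd (f : ℤ → Module.End ℂ W) : Module.End ℂ W :=
  if h : LocallyFinite f then
    { toFun := fun v => ∑ᶠ k, f k v
      map_add' := fun v w => by
        simp only [map_add]
        exact finsum_add_distrib (h v) (h w)
      map_smul' := fun t v => by
        simp only [map_smul, RingHom.id_apply]
        exact (smul_finsum' t (h v)).symm }
  else 0

lemma sumEnd_apply {f : ℤ → Module.End ℂ W} (h : LocallyFinite f) (v : W) :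
    sumEnd f v = ∑ᶠ k, f k v := by
  rw [sumEnd, dif_pos h]
  rfl

/-- An operator that commutes with every member of a family commutes with its sum. -/
lemma commute_sumEnd {f : ℤ → Module.End ℂ W} {g : Module.End ℂ W} (hg : ∀ k, Commute g (f k)) :
    Commute g (sumEnd f) := by
  by_cases h : LocallyFinite f
  · ext v
    simp only [Module.End.mul_apply, sumEnd_apply h]
    rw [map_finsum g (h v)]
    exact finsum_congr fun k => LinearMap.congr_fun (hg k) v
  · rw [sumEnd, dif_neg h]
    exact Commute.zero_right g

end LocallyFinite

/-- The Virasoro operator `L n` (`χ = left`) or `L̄ n` (`χ = right`) of a `Heis ⊕ Heis`-module,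
`L n = ½ ∑ k, :a (n - k) a k:`, where the normal ordering puts the factor with the larger index
to the right. -/
def sugawara (M : Type*) [AddCommGroup M] [Module ℂ M] [LieRingModule (Heis × Heis) M]
    [LieModule ℂ (Heis × Heis) M] (χ : Chirality) (n : ℤ) : Module.End ℂ M :=
  (1 / 2 : ℂ) • sumEnd fun k =>
    if n - k ≤ k then
      LieModule.toEnd ℂ (Heis × Heis) M (heisIncl χ (Heis.a (n - k))) *
        LieModule.toEnd ℂ (Heis × Heis) M (heisIncl χ (Heis.a k))
    else
      LieModule.toEnd ℂ (Heis × Heis) M (heisIncl χ (Heis.a k)) *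
        LieModule.toEnd ℂ (Heis × Heis) M (heisIncl χ (Heis.a (n - k)))

/-! ## The compactified free boson -/

/-- The weight `(e / r + m r / 2, e / r - m r / 2)` of the pseudovacuum `|e, m⟩`. -/
def bosonWeight (r : ℝ) (em : ℤ × ℤ) : Chirality → ℂ :=
  weight (em.1 / r + em.2 * r / 2) (em.1 / r - em.2 * r / 2)

/-- The space of states of the free boson with values in the circle of radius `r`. -/
abbrev FreeBoson (r : ℝ) : Type := ⨁ em : ℤ × ℤ, Verma (bosonWeight r em)

/-- The lattice points `(e / 2 + m, e / 2 - m)` with `e` even. -/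
def Λ₁ : Set (ℝ × ℝ) :=
  {p | ∃ e m : ℤ, Even e ∧ p = ((e : ℝ) / 2 + m, (e : ℝ) / 2 - m)}

/-- The lattice points `(e / 2 + m, e / 2 - m)` with `e` odd. -/
def Λ₂ : Set (ℝ × ℝ) :=
  {p | ∃ e m : ℤ, Odd e ∧ p = ((e : ℝ) / 2 + m, (e : ℝ) / 2 - m)}

/-- The direct sum of the Verma modules whose highest weights are the points of `Λ`. -/
abbrev VermaSum (Λ : Set (ℝ × ℝ)) : Type := ⨁ p : Λ, Verma (weight p.1.1 p.1.2)

/-! ## The Majorana fermion -/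

/-- Antiperiodic (`A`) and periodic (`P`) boundary conditions. -/
inductive Sector
  | A
  | P
  deriving DecidableEq

/-- The fermion modes of a sector are indexed by integers: `k` stands for the mode number
`k + shift / 2`, that is for `k + 1/2` in the sector `A` and for `k` in the sector `P`. -/
def Sector.shift : Sector → ℤ
  | .A => 1
  | .P => 0

/-- The mode number, in `ℤ + 1/2` for `A` and in `ℤ` for `P`. -/
def Sector.modeNumber (s : Sector) (k : ℤ) : ℚ := k + s.shift / 2

/-- The creation modes.  `osc χ j` is the mode of chirality `χ` and of number `-(j + 1/2)` in the
sector `A`, `-(j + 1)` in the sector `P`.  The sector `P` has in addition a zero mode, shared by the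
two chiralities. -/
inductive CreationMode : Sector → Type
  | osc {s : Sector} (χ : Chirality) (j : ℕ) : CreationMode s
  | zero : CreationMode .P

/-- The space of states of the Majorana fermion in a sector, a highest weight module over the
Clifford algebra of the modes: its basis consists of the ordered products of distinct creation
operators applied to the vacuum `1`. -/
abbrev Majorana (s : Sector) : Type := ExteriorAlgebra ℂ (CreationMode s →₀ ℂ)

section Modes

variable {I : Type}

/-- Creation of a fermion in the mode `i`: left exterior multiplication. -/
def create (i : I) : Module.End ℂ (ExteriorAlgebra ℂ (I →₀ ℂ)) :=
  LinearMap.mulLeft ℂ (ExteriorAlgebra.ι ℂ (Finsupp.single i 1))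

/-- Annihilation of a fermion in the mode `i`: contraction with the dual basis vector. -/
def annihilate (i : I) : Module.End ℂ (ExteriorAlgebra ℂ (I →₀ ℂ)) :=
  CliffordAlgebra.contractLeft (Finsupp.lapply i)

/-- The parity operator `(-1) ^ F`, for which the vacuum is even. -/
def fermionParity : Module.End ℂ (ExteriorAlgebra ℂ (I →₀ ℂ)) :=
  (CliffordAlgebra.involute (Q := (0 : QuadraticForm ℂ (I →₀ ℂ)))).toLinearMap

end Modes

/-- The zero modes `b₀` (`left`) and `b̄₀` (`right`) of the sector `P`.  They satisfy
`b₀² = b̄₀² = 1/2`, anticommute, and agree on the vacuum up to a phase: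
`b̄₀ |vac⟩ = i b₀ |vac⟩`. -/
def zeroMode : Chirality → Module.End ℂ (Majorana .P)
  | .left => create .zero + (1 / 2 : ℂ) • annihilate .zero
  | .right => Complex.I • (create .zero - (1 / 2 : ℂ) • annihilate .zero)

/-- The mode operators `b` (`χ = left`) and `b̄` (`χ = right`) of the Majorana fermion.
Modes of positive number annihilate and modes of negative number create. -/
def majoranaMode : (s : Sector) → Chirality → ℤ → Module.End ℂ (Majorana s)
  | .A, χ, Int.ofNat j => annihilate (.osc χ j)
  | .A, χ, Int.negSucc j => create (.osc χ j)
  | .P, χ, Int.ofNat 0 => zeroMode χ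
  | .P, χ, Int.ofNat (j + 1) => annihilate (.osc χ j)
  | .P, χ, Int.negSucc j => create (.osc χ j)

/-! ## Families of fermion modes and their bilinears -/

section Fermions

variable {W : Type*} [AddCommGroup W] [Module ℂ W] {κ : Type*} [DecidableEq κ]

/-- Canonical anticommutation relations between the modes of the fermions labelled by `κ`, and
annihilation of each vector by the modes of large number. -/
structure IsFermionFamily (δ : ℤ) (B : κ → ℤ → Module.End ℂ W) : Prop where
  car : ∀ i j k l, B i k * B j l + B j l * B i k = if i = j ∧ k + l + δ = 0 then 1 else 0
  smooth : ∀ v, ∃ N : ℤ, ∀ i k, N ≤ k → B i k v = 0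

/-- The modes of number `n` of the product `b_i(z) b_j(z)` of two distinct fermion fields; the
index of the first factor is such that the mode numbers of the two factors add up to `n`. -/
def bilinear (δ : ℤ) (B : κ → ℤ → Module.End ℂ W) (i j : κ) (n : ℤ) : Module.End ℂ W :=
  sumEnd fun k => B i (n - k - δ) * B j k

/-- The normally ordered product of the modes `k` and `l` of one fermion: the mode of larger number
is put to the right, with a sign for the exchange, and the square of a mode is put to zero. -/
def normalOrder (b : ℤ → Module.End ℂ W) (k l : ℤ) : Module.End ℂ W :=
  if k < l then b k * b l else if l < k then -(b l * b k) else 0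

variable {δ : ℤ} {B : κ → ℤ → Module.End ℂ W}

namespace IsFermionFamily

lemma anti (hB : IsFermionFamily δ B) {i j : κ} {k l : ℤ} (h : ¬(i = j ∧ k + l + δ = 0)) :
    B i k * B j l = -(B j l * B i k) := by
  have := hB.car i j k l
  rw [if_neg h] at this
  exact eq_neg_of_add_eq_zero_left this

lemma locallyFinite (hB : IsFermionFamily δ B) {i j : κ} (hij : i ≠ j) (n : ℤ) :
    LocallyFinite fun k => B i (n - k - δ) * B j k := by
  intro v
  obtain ⟨N, hN⟩ := hB.smooth v
  refine (Set.finite_Ioo (n - δ - N) N).subset fun k hk => ?_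
  rw [Function.mem_support] at hk
  by_contra hk'
  rw [Set.mem_Ioo, not_and_or, not_lt, not_lt] at hk'
  apply hk
  change (B i (n - k - δ) * B j k) v = 0
  rcases hk' with h | h
  · rw [hB.anti (fun h => hij h.1), LinearMap.neg_apply, Module.End.mul_apply,
      hN i _ (by omega), map_zero, neg_zero]
  · rw [Module.End.mul_apply, hN j _ h, map_zero]

/-- The commutator of a bilinear with a mode, for a bilinear containing the mode on the right. -/
lemma bilinear_right (hB : IsFermionFamily δ B) {i j : κ} (hij : i ≠ j) (n l : ℤ) :
    bilinear δ B i j n * B j l = B j l * bilinear δ B i j n + B i (n + l) := by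
  have hf := hB.locallyFinite hij n
  have key : ∀ k, B i (n - k - δ) * B j k * B j l =
      B j l * (B i (n - k - δ) * B j k) + if k = -l - δ then B i (n + l) else 0 := by
    intro k
    have h1 := hB.car j j k l
    have h2 := hB.anti (i := i) (j := j) (k := n - k - δ) (l := l) (fun h => hij h.1)
    by_cases hk : k = -l - δ
    · rw [if_pos ⟨rfl, by omega⟩] at h1
      rw [if_pos hk, show n + l = n - k - δ by omega, mul_assoc, eq_sub_of_add_eq h1, mul_sub,
        ← mul_assoc, h2, ← mul_assoc]
      simp only [mul_one, neg_mul]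
      abel
    · rw [if_neg (fun h => hk (by omega))] at h1
      rw [if_neg hk, mul_assoc, eq_sub_of_add_eq h1, mul_sub, ← mul_assoc, h2, ← mul_assoc]
      simp only [mul_zero, neg_mul]
      abel
  ext v
  simp only [LinearMap.add_apply, Module.End.mul_apply, bilinear, sumEnd_apply hf]
  have hm : B j l (∑ᶠ k, B i (n - k - δ) (B j k v)) = ∑ᶠ k, B j l (B i (n - k - δ) (B j k v)) :=
    map_finsum (B j l) (hf v)
  rw [hm]
  have hs : ∀ k, (B i (n - k - δ)) ((B j k) ((B j l) v)) =
      B j l (B i (n - k - δ) (B j k v)) + if k = -l - δ then B i (n + l) v else 0 := by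
    intro k
    have := LinearMap.congr_fun (key k) v
    simp only [LinearMap.add_apply, Module.End.mul_apply] at this
    rw [this]
    split_ifs <;> rfl
  rw [finsum_congr hs, finsum_add_distrib, finsum_eq_single _ (-l - δ) (fun k hk => if_neg hk),
    if_pos rfl]
  · refine (hf v).subset fun k hk => ?_
    rw [Function.mem_support] at hk ⊢
    intro h
    exact hk (by rw [← Module.End.mul_apply (B i _), h, map_zero])
  · refine (Set.finite_singleton (-l - δ)).subset fun k hk => ?_
    by_contra h
    exact hk (if_neg h)

lemma bilinear_swap (hB : IsFermionFamily δ B) {i j : κ} (hij : i ≠ j) (n : ℤ) :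
    bilinear δ B i j n = -bilinear δ B j i n := by
  ext v
  rw [LinearMap.neg_apply, bilinear, bilinear, sumEnd_apply (hB.locallyFinite hij n),
    sumEnd_apply (hB.locallyFinite hij.symm n), ← finsum_neg_distrib]
  let e : ℤ ≃ ℤ := ⟨fun k => n - k - δ, fun k => n - k - δ, fun k => by ring, fun k => by ring⟩
  rw [← finsum_comp_equiv e]
  refine finsum_congr fun k => ?_
  change (B i (n - (n - k - δ) - δ) * B j (n - k - δ)) v = _
  rw [show n - (n - k - δ) - δ = k by ring, hB.anti (fun h => hij h.1)]
  rfl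

lemma bilinear_left (hB : IsFermionFamily δ B) {i j : κ} (hij : i ≠ j) (n l : ℤ) :
    bilinear δ B i j n * B i l = B i l * bilinear δ B i j n - B j (n + l) := by
  rw [hB.bilinear_swap hij, neg_mul, hB.bilinear_right hij.symm, mul_neg]
  abel

lemma bilinear_commute (hB : IsFermionFamily δ B) {i j m : κ} (hi : m ≠ i) (hj : m ≠ j)
    (n l : ℤ) : Commute (B m l) (bilinear δ B i j n) := by
  refine commute_sumEnd fun k => ?_
  change B m l * (B i _ * B j k) = B i _ * B j k * B m l
  rw [← mul_assoc, hB.anti (fun h => hi h.1), neg_mul, mul_assoc, hB.anti (fun h => hj h.1),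
    mul_neg, neg_neg, mul_assoc]

/-- A term of the square of one fermion field; if the mode numbers of the two factors add up to zero,
the identity is subtracted for negative `k`, so that only finitely many terms are nonzero. -/
def square (δ : ℤ) (B : κ → ℤ → Module.End ℂ W) (i : κ) (p : ℤ) (v : W) (k : ℤ) : W :=
  B i (p - k - δ) (B i k v) - if p = 0 ∧ k < 0 then v else 0

lemma square_finite (hB : IsFermionFamily δ B) (i : κ) (p : ℤ) (v : W) :
    (Function.support (square δ B i p v)).Finite := by
  obtain ⟨N, hN⟩ := hB.smooth v
  refine (Set.finite_Icc (min (p - δ - N) (-1)) (max N 0)).subset fun k hk => ?_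
  rw [Function.mem_support] at hk
  by_contra hk'
  rw [Set.mem_Icc, not_and_or, not_le, not_le, lt_min_iff, max_lt_iff] at hk'
  apply hk
  rcases hk' with h | h
  · have h1 := LinearMap.congr_fun (hB.car i i (p - k - δ) k) v
    rw [LinearMap.add_apply, Module.End.mul_apply, Module.End.mul_apply] at h1
    rw [hN i (p - k - δ) (by omega), map_zero, add_zero] at h1
    rw [square, h1]
    by_cases hp : p = 0
    · rw [if_pos ⟨rfl, by omega⟩, if_pos ⟨hp, by omega⟩]
      exact sub_self v
    · rw [if_neg (fun h => hp (by omega)), if_neg (fun h => hp h.1)]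
      exact sub_self 0
  · rw [square, hN i k h.1.le, map_zero, if_neg (by omega), sub_zero]

lemma square_sum (hB : IsFermionFamily δ B) (i j : κ) (p : ℤ) (v : W) :
    ∑ᶠ k, square δ B i p v k = ∑ᶠ k, square δ B j p v k := by
  let e : ℤ ≃ ℤ := ⟨fun k => p - k - δ, fun k => p - k - δ, fun k => by ring, fun k => by ring⟩
  have key : ∀ i, ∑ᶠ k, square δ B i p v k + ∑ᶠ k, square δ B i p v k =
      ∑ᶠ k, ((if p = 0 then v else 0) - (if p = 0 ∧ k < 0 then v else 0) -
        (if p = 0 ∧ p - k - δ < 0 then v else 0)) := by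
    intro i
    have hfin := hB.square_finite i p v
    have hfin' : (Function.support fun k => square δ B i p v (e k)).Finite :=
      hfin.preimage e.injective.injOn
    nth_rewrite 2 [← finsum_comp_equiv e]
    rw [← finsum_add_distrib hfin hfin']
    refine finsum_congr fun k => ?_
    have h1 := LinearMap.congr_fun (hB.car i i (p - k - δ) k) v
    rw [LinearMap.add_apply, Module.End.mul_apply, Module.End.mul_apply] at h1
    change square δ B i p v k + square δ B i p v (p - k - δ) = _
    have h2 : (if p = 0 then v else 0) =
        B i (p - k - δ) (B i k v) + B i k (B i (p - k - δ) v) := by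
      rw [h1]
      by_cases hp : p = 0
      · rw [if_pos hp, if_pos ⟨rfl, by omega⟩]
        rfl
      · rw [if_neg hp, if_neg (fun h => hp (by omega))]
        rfl
    rw [h2, square, square, show p - (p - k - δ) - δ = k by ring]
    abel
  have h := (key i).trans (key j).symm
  rw [← two_smul ℂ, ← two_smul ℂ] at h
  exact smul_right_injective W (two_ne_zero : (2 : ℂ) ≠ 0) h

lemma step_sum (n : ℤ) (v : W) :
    (Function.support fun k : ℤ => (if k + n < 0 then v else 0) - if k < 0 then v else 0).Finite ∧
    ∑ᶠ k : ℤ, ((if k + n < 0 then v else 0) - if k < 0 then v else 0) = -((n : ℂ) • v) := by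
  have hs : (fun k : ℤ => (if k + n < 0 then v else 0) - if k < 0 then v else 0) =
      fun k => (if k ∈ Finset.Ico 0 (-n) then v else 0) -
        if k ∈ Finset.Ico (-n) 0 then v else 0 := by
    funext k
    simp only [Finset.mem_Ico]
    split_ifs <;> first | omega | simp
  have hsub : (Function.support fun k : ℤ => (if k ∈ Finset.Ico 0 (-n) then v else 0) -
      if k ∈ Finset.Ico (-n) 0 then v else 0) ⊆
      ((Finset.Ico 0 (-n) ∪ Finset.Ico (-n) 0 : Finset ℤ) : Set ℤ) := by
    intro k hk
    by_contra h
    rw [Finset.mem_coe, Finset.mem_union, not_or] at h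
    exact hk (by simp only [if_neg h.1, if_neg h.2, sub_self])
  rw [hs]
  refine ⟨(Finset.finite_toSet _).subset hsub, ?_⟩
  rw [finsum_eq_sum_of_support_subset _ hsub, Finset.sum_sub_distrib, Finset.sum_ite_mem,
    Finset.sum_ite_mem, Finset.union_inter_cancel_left, Finset.union_inter_cancel_right,
    Finset.sum_const, Finset.sum_const, Int.card_Ico, Int.card_Ico, ← Nat.cast_smul_eq_nsmul ℂ,
    ← Nat.cast_smul_eq_nsmul ℂ, ← sub_smul, ← neg_smul]
  congr 1
  have h : (((-n - 0).toNat : ℤ) - ((0 - -n).toNat : ℤ)) = -n := by omega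
  exact_mod_cast congrArg (Int.cast : ℤ → ℂ) h

/-- The Heisenberg relations for a bilinear in two fermions. -/
lemma bilinear_lie (hB : IsFermionFamily δ B) {i j : κ} (hij : i ≠ j) (n m : ℤ) :
    bilinear δ B i j n * bilinear δ B i j m - bilinear δ B i j m * bilinear δ B i j n =
      if n + m = 0 then -(n : ℂ) • 1 else 0 := by
  have hf := hB.locallyFinite hij m
  have key : ∀ k v, bilinear δ B i j n (B i (m - k - δ) (B j k v)) -
      B i (m - k - δ) (B j k (bilinear δ B i j n v)) =
      square δ B i (n + m) v (k + n) - square δ B j (n + m) v k +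
        ((if n + m = 0 ∧ k + n < 0 then v else 0) - if n + m = 0 ∧ k < 0 then v else 0) := by
    intro k v
    have h1 := LinearMap.congr_fun (hB.bilinear_left hij n (m - k - δ)) (B j k v)
    have h2 := LinearMap.congr_fun (hB.bilinear_right hij n k) v
    simp only [LinearMap.add_apply, LinearMap.sub_apply, Module.End.mul_apply] at h1 h2
    rw [h1, h2, map_add, square, square, show n + m - (k + n) - δ = m - k - δ by ring,
      show n + (m - k - δ) = n + m - k - δ by ring, add_comm n k]
    abel
  ext v
  have hsq : (Function.support fun k => square δ B i (n + m) v (k + n)).Finite :=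
    (hB.square_finite i (n + m) v).preimage (Equiv.addRight n).injective.injOn
  have hm : bilinear δ B i j n (∑ᶠ k, B i (m - k - δ) (B j k v)) =
      ∑ᶠ k, bilinear δ B i j n (B i (m - k - δ) (B j k v)) :=
    map_finsum (bilinear δ B i j n) (hf v)
  have hfin : (Function.support fun k =>
      bilinear δ B i j n (B i (m - k - δ) (B j k v))).Finite := by
    refine (hf v).subset fun k hk => ?_
    rw [Function.mem_support] at hk ⊢
    intro h
    exact hk (by rw [← Module.End.mul_apply (B i _), h, map_zero])
  have e1 : ∀ u, bilinear δ B i j m u = ∑ᶠ k, B i (m - k - δ) (B j k u) := fun u => by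
    rw [bilinear, sumEnd_apply hf]
    rfl
  have hfin' : (Function.support fun k =>
      B i (m - k - δ) (B j k (bilinear δ B i j n v))).Finite := hf _
  rw [LinearMap.sub_apply, Module.End.mul_apply, Module.End.mul_apply, e1, e1, hm,
    ← finsum_sub_distrib hfin hfin', finsum_congr fun k => key k v]
  have hz : ∑ᶠ k, square δ B i (n + m) v (k + n) - ∑ᶠ k, square δ B j (n + m) v k = 0 := by
    rw [sub_eq_zero, hB.square_sum j i]
    exact finsum_comp_equiv (f := square δ B i (n + m) v) (Equiv.addRight n)
  have hfin2 : (Function.support fun k => square δ B i (n + m) v (k + n) -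
      square δ B j (n + m) v k).Finite :=
    (hsq.union (hB.square_finite j (n + m) v)).subset (Function.support_sub _ _)
  have hsqj := hB.square_finite j (n + m) v
  by_cases h0 : n + m = 0
  · simp only [h0, true_and, if_true] at hz hfin2 hsq hsqj ⊢
    rw [finsum_add_distrib hfin2 (step_sum n v).1, (step_sum n v).2,
      finsum_sub_distrib hsq hsqj, hz, zero_add]
    simp
  · simp only [h0, false_and, if_false, sub_zero, add_zero]
    rw [finsum_sub_distrib hsq hsqj, hz]
    rfl

end IsFermionFamily

end Fermions

/-! ## Heisenberg modules from currents -/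

section HeisAction

variable {W : Type*} [AddCommGroup W] [Module ℂ W]

/-- The action of `Heis ⊕ Heis` in which the generators `a n`, `ā n` act by given operators and both
central elements act as the identity. -/
def heisAction (J : Chirality → ℤ → Module.End ℂ W) : Heis × Heis →ₗ[ℂ] Module.End ℂ W :=
  (Finsupp.linearCombination ℂ (J .left) ∘ₗ Heis.coeff + Heis.central.smulRight 1) ∘ₗ
      LinearMap.fst ℂ Heis Heis +
    (Finsupp.linearCombination ℂ (J .right) ∘ₗ Heis.coeff + Heis.central.smulRight 1) ∘ₗ
      LinearMap.snd ℂ Heis Heis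

/-- The relations of `Heis ⊕ Heis` with both central elements acting as the identity. -/
structure HeisRelations (J : Chirality → ℤ → Module.End ℂ W) : Prop where
  lie : ∀ χ n m, J χ n * J χ m - J χ m * J χ n = if n + m = 0 then (n : ℂ) • 1 else 0
  comm : ∀ n m, Commute (J .left n) (J .right m)

namespace HeisRelations

variable {J : Chirality → ℤ → Module.End ℂ W}

lemma combination_lie (hJ : HeisRelations J) (χ : Chirality) (x y : ℤ →₀ ℂ) :
    Finsupp.linearCombination ℂ (J χ) x * Finsupp.linearCombination ℂ (J χ) y -
      Finsupp.linearCombination ℂ (J χ) y * Finsupp.linearCombination ℂ (J χ) x =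
      heisCocycle x y • (1 : Module.End ℂ W) := by
  induction x using Finsupp.induction_linear with
  | zero => simp
  | add x x' hx hx' =>
    rw [map_add, add_mul, mul_add, map_add, LinearMap.add_apply, add_smul, ← hx, ← hx']
    abel
  | single n c =>
    induction y using Finsupp.induction_linear with
    | zero => simp
    | add y y' hy hy' =>
      rw [map_add, add_mul, mul_add, map_add, add_smul, ← hy, ← hy']
      abel
    | single m d =>
      simp only [Finsupp.linearCombination_single, smul_mul_smul_comm]
      rw [mul_comm d c, ← smul_sub, hJ.lie]
      by_cases h : n + m = 0
      · obtain rfl : m = -n := by omega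
        rw [if_pos h]
        simp [heisCocycle, smul_smul]
        congr 1
        ring
      · rw [if_neg h, heisCocycle]
        simp [show m ≠ -n from fun h' => h (by omega)]

lemma combination_comm (hJ : HeisRelations J) (x y : ℤ →₀ ℂ) :
    Commute (Finsupp.linearCombination ℂ (J .left) x)
      (Finsupp.linearCombination ℂ (J .right) y) := by
  induction x using Finsupp.induction_linear with
  | zero => simp
  | add x x' hx hx' =>
    rw [map_add]
    exact hx.add_left hx'
  | single n c =>
    induction y using Finsupp.induction_linear with
    | zero => simp
    | add y y' hy hy' =>
      rw [map_add]
      exact hy.add_right hy'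
    | single m d =>
      rw [Finsupp.linearCombination_single, Finsupp.linearCombination_single]
      exact ((hJ.comm n m).smul_left c).smul_right d

lemma heisAction_lie (hJ : HeisRelations J) (x y : Heis × Heis) :
    heisAction J ⁅x, y⁆ = heisAction J x * heisAction J y - heisAction J y * heisAction J x := by
  have h1 := hJ.combination_lie .left x.1.coeff y.1.coeff
  have h2 := hJ.combination_lie .right x.2.coeff y.2.coeff
  have h3 := (hJ.combination_comm x.1.coeff y.2.coeff).eq
  have h4 := (hJ.combination_comm y.1.coeff x.2.coeff).eq
  simp only [heisAction, LinearMap.add_apply, LinearMap.comp_apply, LinearMap.fst_apply,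
    LinearMap.snd_apply, LinearMap.smulRight_apply, LieAlgebra.Prod.bracket_apply, Heis.coeff_lie,
    Heis.central_lie, map_zero, zero_add]
  rw [← h1, ← h2]
  simp only [add_mul, mul_add, smul_mul_assoc, mul_smul_comm, one_mul, mul_one, h3, h4, smul_add]
  rw [smul_smul, smul_smul]
  module

/-- The module structure defined by operators that satisfy the relations. -/
@[reducible] def lieRingModule (hJ : HeisRelations J) : LieRingModule (Heis × Heis) W where
  bracket x v := heisAction J x v
  add_lie x y v := by rw [map_add, LinearMap.add_apply]
  lie_add x v w := map_add _ v w
  leibniz_lie x y v := by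
    rw [hJ.heisAction_lie, LinearMap.sub_apply, Module.End.mul_apply, Module.End.mul_apply,
      sub_add_cancel]

end HeisRelations

end HeisAction

/-! ## The mode operators of the Majorana fermion -/

section MajoranaFacts

variable {I : Type}

lemma create_create (i j : I) : create i * create j + create j * create i = 0 := by
  refine LinearMap.ext fun v => ?_
  simp only [create, LinearMap.add_apply, Module.End.mul_apply, LinearMap.mulLeft_apply,
    ← mul_assoc, ← add_mul, ExteriorAlgebra.ι_add_mul_swap, zero_mul, LinearMap.zero_apply]

lemma annihilate_annihilate (i j : I) :
    annihilate i * annihilate j + annihilate j * annihilate i = 0 := by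
  refine LinearMap.ext fun v => ?_
  simp only [annihilate, LinearMap.add_apply, Module.End.mul_apply, LinearMap.zero_apply]
  rw [CliffordAlgebra.contractLeft_comm, neg_add_cancel]

lemma annihilate_create (i j : I) :
    annihilate i * create j + create j * annihilate i =
      (Finsupp.single j (1 : ℂ) i) • (1 : Module.End ℂ (ExteriorAlgebra ℂ (I →₀ ℂ))) := by
  refine LinearMap.ext fun v => ?_
  simp only [create, annihilate, LinearMap.add_apply, Module.End.mul_apply,
    LinearMap.mulLeft_apply]
  erw [CliffordAlgebra.contractLeft_ι_mul]
  rw [sub_add_cancel]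
  rfl

lemma annihilate_create_self (i : I) :
    annihilate i * create i + create i * annihilate i =
      (1 : Module.End ℂ (ExteriorAlgebra ℂ (I →₀ ℂ))) := by
  rw [annihilate_create, Finsupp.single_eq_same, one_smul]

lemma annihilate_create_ne {i j : I} (h : i ≠ j) :
    annihilate i * create j + create j * annihilate i = 0 := by
  rw [annihilate_create, Finsupp.single_eq_of_ne h, zero_smul]

lemma annihilate_finite (v : ExteriorAlgebra ℂ (I →₀ ℂ)) : {i | annihilate i v ≠ 0}.Finite := by
  induction v using CliffordAlgebra.left_induction with
  | algebraMap r => simp [annihilate]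
  | add x y hx hy =>
    refine (hx.union hy).subset fun i hi => ?_
    by_contra h
    rw [Set.mem_union, not_or, Set.mem_ofPred_eq, Set.mem_ofPred_eq, not_not, not_not] at h
    exact hi (by rw [map_add, h.1, h.2, add_zero])
  | ι_mul x m hx =>
    refine (hx.union m.hasFiniteSupport).subset fun i hi => ?_
    by_contra h
    rw [Set.mem_union, not_or, Set.mem_ofPred_eq, not_not, Function.mem_support, not_not] at h
    refine hi ?_
    have h1 := h.1
    rw [annihilate] at h1 ⊢
    rw [CliffordAlgebra.contractLeft_ι_mul, h1, Finsupp.lapply_apply, h.2, zero_smul, mul_zero,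
      sub_zero]

lemma parity_parity :
    fermionParity * fermionParity = (1 : Module.End ℂ (ExteriorAlgebra ℂ (I →₀ ℂ))) := by
  refine LinearMap.ext fun v => ?_
  exact CliffordAlgebra.involute_involute v

lemma parity_create (i : I) : fermionParity * create i + create i * fermionParity = 0 := by
  refine LinearMap.ext fun v => ?_
  simp only [create, fermionParity, LinearMap.add_apply, Module.End.mul_apply,
    LinearMap.mulLeft_apply, AlgHom.toLinearMap_apply, map_mul]
  erw [CliffordAlgebra.involute_ι]
  rw [neg_mul]
  exact neg_add_cancel _

lemma parity_annihilate (i : I) :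
    fermionParity * annihilate i + annihilate i * fermionParity = 0 := by
  refine LinearMap.ext fun v => ?_
  simp only [annihilate, fermionParity, LinearMap.add_apply, Module.End.mul_apply,
    AlgHom.toLinearMap_apply, LinearMap.zero_apply]
  induction v using CliffordAlgebra.left_induction with
  | algebraMap r => simp
  | add x y hx hy =>
    simp only [map_add]
    rw [add_add_add_comm, hx, hy, add_zero]
  | ι_mul x m hx =>
    rw [CliffordAlgebra.contractLeft_ι_mul, map_sub, map_smul, map_mul, map_mul,
      CliffordAlgebra.involute_ι, neg_mul, neg_mul, map_neg, CliffordAlgebra.contractLeft_ι_mul,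
      eq_neg_of_add_eq_zero_left hx, mul_neg]
    abel

lemma zeroMode_parity (χ : Chirality) :
    fermionParity * zeroMode χ + zeroMode χ * fermionParity = 0 := by
  have hc := eq_neg_of_add_eq_zero_left (parity_create CreationMode.zero)
  have ha := eq_neg_of_add_eq_zero_left (parity_annihilate CreationMode.zero)
  rcases χ with _ | _ <;>
    simp only [zeroMode, mul_add, add_mul, mul_sub, sub_mul, mul_smul_comm, smul_mul_assoc, hc,
      ha] <;> module

lemma majorana_parity (s : Sector) (χ : Chirality) (k : ℤ) :
    fermionParity * majoranaMode s χ k + majoranaMode s χ k * fermionParity = 0 := by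
  rcases s with _ | _
  · rcases k with j | j
    · exact parity_annihilate _
    · exact parity_create _
  · rcases k with (_ | j) | j
    · exact zeroMode_parity χ
    · exact parity_annihilate _
    · exact parity_create _

lemma zeroMode_anti (χ : Chirality) {x : Module.End ℂ (Majorana .P)}
    (hc : create .zero * x + x * create .zero = 0)
    (ha : annihilate .zero * x + x * annihilate .zero = 0) :
    zeroMode χ * x + x * zeroMode χ = 0 := by
  have hc' := eq_neg_of_add_eq_zero_left hc
  have ha' := eq_neg_of_add_eq_zero_left ha
  rcases χ with _ | _ <;>
    simp only [zeroMode, mul_add, add_mul, mul_sub, sub_mul, mul_smul_comm, smul_mul_assoc, hc',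
      ha'] <;> module

lemma zeroMode_car (χ χ' : Chirality) :
    zeroMode χ * zeroMode χ' + zeroMode χ' * zeroMode χ = if χ = χ' then 1 else 0 := by
  have hcc := create_create CreationMode.zero CreationMode.zero
  have haa := annihilate_annihilate CreationMode.zero CreationMode.zero
  have hac := eq_sub_of_add_eq (annihilate_create_self CreationMode.zero)
  rw [← two_smul ℂ, smul_eq_zero_iff_right two_ne_zero] at hcc haa
  rcases χ with _ | _ <;> rcases χ' with _ | _ <;>
    simp only [zeroMode, add_mul, mul_add, mul_sub, sub_mul, mul_smul_comm, smul_mul_assoc,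
      hcc, haa, hac, reduceCtorEq, if_true, if_false, smul_zero, smul_sub, smul_add, smul_smul]
    <;> match_scalars <;> ring_nf <;> simp only [Complex.I_sq, neg_neg]

lemma osc_car {s : Sector} (χ χ' : Chirality) (j j' : ℕ) :
    annihilate (CreationMode.osc (s := s) χ j) * create (.osc χ' j') +
      create (.osc χ' j') * annihilate (.osc χ j) = if χ = χ' ∧ j = j' then 1 else 0 := by
  by_cases h : χ = χ' ∧ j = j'
  · obtain ⟨rfl, rfl⟩ := h
    rw [if_pos ⟨rfl, rfl⟩, annihilate_create_self]
  · rw [if_neg h, annihilate_create_ne]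
    rintro ⟨⟩
    exact h ⟨rfl, rfl⟩

lemma majorana_car (s : Sector) (χ χ' : Chirality) (k l : ℤ) :
    majoranaMode s χ k * majoranaMode s χ' l + majoranaMode s χ' l * majoranaMode s χ k =
      if χ = χ' ∧ k + l + s.shift = 0 then 1 else 0 := by
  have h0 : ∀ {x : Module.End ℂ (Majorana s)} {p : Prop} [Decidable p], ¬p → x = 0 →
      x = if χ = χ' ∧ p then 1 else 0 := fun hp hx => by
    rw [if_neg fun h => hp h.2, hx]
  have h1 : ∀ {x : Module.End ℂ (Majorana s)} {p : Prop} [Decidable p] {j j' : ℕ}, (j = j' ↔ p) →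
      (x = if χ = χ' ∧ j = j' then 1 else 0) → x = if χ = χ' ∧ p then 1 else 0 := fun hp hx => by
    rw [hx]
    exact if_congr (and_congr_right fun _ => hp) rfl rfl
  have h2 : ∀ {x y : Module.End ℂ (Majorana s)} {p : Prop} [Decidable p] {j j' : ℕ}, (j = j' ↔ p) →
      (y + x = if χ' = χ ∧ j' = j then 1 else 0) → x + y = if χ = χ' ∧ p then 1 else 0 :=
    fun hp hx => by
      rw [add_comm, hx]
      exact if_congr (and_congr eq_comm (eq_comm.trans hp)) rfl rfl
  rcases s with _ | _
  · have hs : Sector.shift .A = 1 := rfl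
    rcases k with j | j <;> rcases l with j' | j' <;> rw [hs]
    · exact h0 (by rw [Int.ofNat_eq_natCast, Int.ofNat_eq_natCast]; omega)
        (annihilate_annihilate _ _)
    · exact h1 (by rw [Int.ofNat_eq_natCast]; omega) (osc_car χ χ' j j')
    · exact h2 (by rw [Int.ofNat_eq_natCast]; omega) (osc_car χ' χ j' j)
    · exact h0 (by omega) (create_create _ _)
  · have hs : Sector.shift .P = 0 := rfl
    have ha : ∀ χ χ' j, zeroMode χ * annihilate (.osc χ' j) +
        annihilate (.osc χ' j) * zeroMode χ = 0 := fun χ χ' j =>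
      zeroMode_anti χ (by rw [add_comm]; exact annihilate_create_ne (by rintro ⟨⟩))
        (annihilate_annihilate _ _)
    have hc : ∀ χ χ' j, zeroMode χ * create (.osc χ' j) +
        create (.osc χ' j) * zeroMode χ = 0 := fun χ χ' j =>
      zeroMode_anti χ (create_create _ _) (annihilate_create_ne (by rintro ⟨⟩))
    rcases k with (_ | j) | j <;> rcases l with (_ | j') | j' <;> rw [hs]
    · refine (zeroMode_car χ χ').trans (if_congr ?_ rfl rfl)
      simp
    · exact h0 (by rw [Int.ofNat_eq_natCast, Int.ofNat_eq_natCast]; omega) (ha _ _ _)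
    · exact h0 (by rw [Int.ofNat_eq_natCast]; omega) (hc _ _ _)
    · exact h0 (by rw [Int.ofNat_eq_natCast, Int.ofNat_eq_natCast]; omega)
        ((add_comm _ _).trans (ha _ _ _))
    · exact h0 (by rw [Int.ofNat_eq_natCast, Int.ofNat_eq_natCast]; omega)
        (annihilate_annihilate _ _)
    · exact h1 (by rw [Int.ofNat_eq_natCast]; omega) (osc_car χ χ' j j')
    · exact h0 (by rw [Int.ofNat_eq_natCast]; omega) ((add_comm _ _).trans (hc _ _ _))
    · exact h2 (by rw [Int.ofNat_eq_natCast]; omega) (osc_car χ' χ j' j)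
    · exact h0 (by omega) (create_create _ _)

lemma majorana_smooth (s : Sector) (v : Majorana s) :
    ∃ N : ℤ, ∀ χ k, N ≤ k → majoranaMode s χ k v = 0 := by
  have hinj : Function.Injective fun x : Chirality × ℕ => CreationMode.osc (s := s) x.1 x.2 := by
    rintro ⟨χ, j⟩ ⟨χ', j'⟩ h
    cases h
    rfl
  obtain ⟨N, hN⟩ := (((annihilate_finite v).preimage hinj.injOn).image Prod.snd).bddAbove
  have hN' : ∀ χ j, N < j → annihilate (CreationMode.osc (s := s) χ j) v = 0 := fun χ j hj => by
    by_contra h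
    exact absurd (hN ⟨(χ, j), h, rfl⟩) (by simpa using hj)
  rcases s with _ | _
  · refine ⟨N + 1, fun χ k hk => ?_⟩
    rcases k with j | j
    · exact hN' χ j (by simp only [Int.ofNat_eq_natCast] at hk; omega)
    · omega
  · refine ⟨N + 2, fun χ k hk => ?_⟩
    rcases k with (_ | j) | j
    · simp only [Int.ofNat_eq_natCast] at hk
      omega
    · exact hN' χ j (by simp only [Int.ofNat_eq_natCast] at hk; omega)
    · omega

end MajoranaFacts

/-! ## The Dirac fermion -/

/-- The space of states `H_s ⊗ H_s` of the Dirac fermion in the sector `s`; the two factors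
correspond to two Majorana fermions with the same boundary condition. -/
def Dirac (s : Sector) : Type := Majorana s ⊗[ℂ] Majorana s

namespace Dirac

instance (s : Sector) : AddCommGroup (Dirac s) :=
  inferInstanceAs (AddCommGroup (Majorana s ⊗[ℂ] Majorana s))

instance (s : Sector) : Module ℂ (Dirac s) :=
  inferInstanceAs (Module ℂ (Majorana s ⊗[ℂ] Majorana s))

/-- The tensor product of two operators. -/
def tmul {s : Sector} (f g : Module.End ℂ (Majorana s)) : Module.End ℂ (Dirac s) :=
  (TensorProduct.map f g : Module.End ℂ (Majorana s ⊗[ℂ] Majorana s))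

/-- The mode operators of the Majorana fermion `c` (`0` or `1`, acting on the first or on the
second tensor factor) of chirality `χ`; the parity of the first factor makes the modes of
different fermions anticommute. -/
def mode (s : Sector) : Chirality × Fin 2 → ℤ → Module.End ℂ (Dirac s)
  | (χ, 0), k => tmul (majoranaMode s χ k) 1
  | (χ, 1), k => tmul fermionParity (majoranaMode s χ k)

/-- The total parity operator. -/
def parity (s : Sector) : Module.End ℂ (Dirac s) := tmul fermionParity fermionParity

lemma tmul_mul {s : Sector} (f g f' g' : Module.End ℂ (Majorana s)) :
    tmul f g * tmul f' g' = tmul (f * f') (g * g') :=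
  (TensorProduct.map_mul f f' g g').symm

lemma tmul_add_left {s : Sector} (f f' g : Module.End ℂ (Majorana s)) :
    tmul f g + tmul f' g = tmul (f + f') g := (TensorProduct.map_add_left f f' g).symm

lemma tmul_add_right {s : Sector} (f g g' : Module.End ℂ (Majorana s)) :
    tmul f g + tmul f g' = tmul f (g + g') := (TensorProduct.map_add_right f g g').symm

lemma tmul_zero {s : Sector} (f : Module.End ℂ (Majorana s)) : tmul f 0 = 0 :=
  TensorProduct.map_zero_right f

lemma zero_tmul {s : Sector} (g : Module.End ℂ (Majorana s)) : tmul 0 g = 0 :=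
  TensorProduct.map_zero_left g

lemma one_tmul_one {s : Sector} : tmul (1 : Module.End ℂ (Majorana s)) 1 = 1 :=
  TensorProduct.map_one

lemma mode_parity (s : Sector) (i : Chirality × Fin 2) (k : ℤ) :
    parity s * mode s i k = -(mode s i k * parity s) := by
  rw [eq_neg_iff_add_eq_zero]
  obtain ⟨χ, c⟩ := i
  fin_cases c
  · change tmul _ _ * tmul _ _ + tmul _ _ * tmul _ _ = 0
    rw [tmul_mul, tmul_mul, mul_one, one_mul, tmul_add_left, majorana_parity, zero_tmul]
  · change tmul _ _ * tmul _ _ + tmul _ _ * tmul _ _ = 0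
    rw [tmul_mul, tmul_mul, tmul_add_right, majorana_parity, tmul_zero]

lemma isFermionFamily (s : Sector) : IsFermionFamily s.shift (mode s) where
  car := by
    rintro ⟨χ, c⟩ ⟨χ', c'⟩ k l
    have hp := parity_parity (I := CreationMode s)
    have h1 := majorana_car s χ χ' k l
    fin_cases c <;> fin_cases c'
    · change tmul _ _ * tmul _ _ + tmul _ _ * tmul _ _ = _
      rw [tmul_mul, tmul_mul, mul_one, tmul_add_left, h1]
      simp only [Prod.mk.injEq, and_true, Fin.zero_eta]
      split_ifs
      · exact one_tmul_one
      · exact zero_tmul _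
    · change tmul _ _ * tmul _ _ + tmul _ _ * tmul _ _ = _
      rw [tmul_mul, tmul_mul, mul_one, one_mul, tmul_add_left, add_comm, majorana_parity,
        zero_tmul, if_neg (by simp)]
    · change tmul _ _ * tmul _ _ + tmul _ _ * tmul _ _ = _
      rw [tmul_mul, tmul_mul, mul_one, one_mul, tmul_add_left, majorana_parity, zero_tmul,
        if_neg (by simp)]
    · change tmul _ _ * tmul _ _ + tmul _ _ * tmul _ _ = _
      rw [tmul_mul, tmul_mul, tmul_add_right, h1, hp]
      simp only [Prod.mk.injEq, and_true, Fin.mk_one]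
      split_ifs
      · exact one_tmul_one
      · exact tmul_zero _
  smooth := by
    intro v
    induction v using TensorProduct.induction_on with
    | zero => exact ⟨0, fun i k _ => map_zero _⟩
    | add x y hx hy =>
      obtain ⟨N, hN⟩ := hx
      obtain ⟨M, hM⟩ := hy
      refine ⟨max N M, fun i k hk => ?_⟩
      have := (mode s i k).map_add x y
      rw [hN i k ((le_max_left _ _).trans hk), hM i k ((le_max_right _ _).trans hk),
        add_zero] at this
      exact this
    | tmul x y =>
      obtain ⟨N, hN⟩ := majorana_smooth s x
      obtain ⟨M, hM⟩ := majorana_smooth s y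
      refine ⟨max N M, ?_⟩
      rintro ⟨χ, c⟩ k hk
      fin_cases c
      · change TensorProduct.map _ _ (x ⊗ₜ y) = 0
        rw [TensorProduct.map_tmul, hN χ k ((le_max_left _ _).trans hk), TensorProduct.zero_tmul]
      · change TensorProduct.map _ _ (x ⊗ₜ y) = 0
        rw [TensorProduct.map_tmul, hM χ k ((le_max_right _ _).trans hk), TensorProduct.tmul_zero]

/-- The modes of the currents `j = :ψ₊ ψ₋: = -i ψ₁ ψ₂` and `j̄ = :ψ̄₊ ψ̄₋: = i ψ̄₁ ψ̄₂`, where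
`ψ± = (ψ₁ ± i ψ₂) / √2` and `ψ̄± = (ψ̄₁ ∓ i ψ̄₂) / √2`. -/
def current (s : Sector) : Chirality → ℤ → Module.End ℂ (Dirac s)
  | .left, n => (-Complex.I) • bilinear s.shift (mode s) (.left, 0) (.left, 1) n
  | .right, n => Complex.I • bilinear s.shift (mode s) (.right, 0) (.right, 1) n

/-- The Virasoro operators `L n` (`χ = left`) and `L̄ n` (`χ = right`) of the two Majorana fermions:
the sum over both fermions of `∑ m, (m / 2 + 1 / 4) :b (n - m) b m: + δ_{n,0} h`, where `m` runs
over the mode numbers of the sector and `h` is `0` for `A` and `1 / 16` for `P`. -/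
def virasoro (s : Sector) (χ : Chirality) (n : ℤ) : Module.End ℂ (Dirac s) :=
  ∑ c : Fin 2, ((sumEnd fun k => ((s.modeNumber k / 2 + 1 / 4 : ℚ) : ℂ) •
      normalOrder (mode s (χ, c)) (n - k - s.shift) k) +
    if s = .P ∧ n = 0 then (1 / 16 : ℂ) • 1 else 0)

lemma heisRelations (s : Sector) : HeisRelations (current s) where
  lie χ n m := by
    have hB := isFermionFamily s
    have hI : Complex.I * Complex.I = -1 := Complex.I_mul_I
    have h := hB.bilinear_lie (i := (χ, 0)) (j := (χ, 1)) (by simp) n m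
    have h' : current s χ n * current s χ m - current s χ m * current s χ n =
        -(bilinear s.shift (mode s) (χ, 0) (χ, 1) n * bilinear s.shift (mode s) (χ, 0) (χ, 1) m -
          bilinear s.shift (mode s) (χ, 0) (χ, 1) m *
            bilinear s.shift (mode s) (χ, 0) (χ, 1) n) := by
      rcases χ with _ | _ <;>
        simp only [current, smul_mul_smul_comm, neg_mul_neg, hI] <;> module
    rw [h', h]
    split_ifs <;> simp
  comm n m := by
    have hB := isFermionFamily s
    refine ((commute_sumEnd fun k => ?_).symm.smul_left _).smul_right _
    exact ((hB.bilinear_commute (by simp) (by simp) _ _).symm.mul_right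
      (hB.bilinear_commute (by simp) (by simp) _ _).symm).symm.symm

instance (s : Sector) : LieRingModule (Heis × Heis) (Dirac s) := (heisRelations s).lieRingModule

instance (s : Sector) : LieModule ℂ (Heis × Heis) (Dirac s) where
  smul_lie t x v := by
    change heisAction (current s) (t • x) v = t • heisAction (current s) x v
    rw [map_smul, LinearMap.smul_apply]
  lie_smul t x v := map_smul (heisAction (current s) x) t v

lemma commute_parity_mul (s : Sector) (i j : Chirality × Fin 2) (k l : ℤ) :
    Commute (parity s) (mode s i k * mode s j l) := by
  change parity s * (mode s i k * mode s j l) = mode s i k * mode s j l * parity s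
  rw [← mul_assoc, mode_parity, neg_mul, mul_assoc, mode_parity, mul_neg, neg_neg, mul_assoc]

lemma commute_parity_current (s : Sector) (χ : Chirality) (n : ℤ) :
    Commute (parity s) (current s χ n) := by
  rcases χ with _ | _ <;>
    exact (commute_sumEnd fun k => commute_parity_mul s _ _ _ _).smul_right _

lemma commute_parity_heisAction (s : Sector) (x : Heis × Heis) :
    Commute (parity s) (heisAction (current s) x) := by
  have h : ∀ χ (y : ℤ →₀ ℂ),
      Commute (parity s) (Finsupp.linearCombination ℂ (current s χ) y) := fun χ y =>
    Commute.sum_right _ _ _ fun n _ => (commute_parity_current s χ n).smul_right _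
  exact ((h .left _).add_right ((Commute.one_right _).smul_right _)).add_right
    ((h .right _).add_right ((Commute.one_right _).smul_right _))

lemma commute_parity_virasoro (s : Sector) (χ : Chirality) (n : ℤ) :
    Commute (parity s) (virasoro s χ n) := by
  refine Commute.sum_right _ _ _ fun c _ => (commute_sumEnd fun k => ?_).add_right ?_
  · refine Commute.smul_right ?_ _
    rw [normalOrder]
    split_ifs
    · exact commute_parity_mul s _ _ _ _
    · exact (commute_parity_mul s _ _ _ _).neg_right
    · exact Commute.zero_right _
  · split_ifs
    · exact (Commute.one_right _).smul_right _
    · exact Commute.zero_right _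

/-- The even part of `H_s ⊗ H_s`. -/
def even (s : Sector) : LieSubmodule ℂ (Heis × Heis) (Dirac s) where
  carrier := {v | parity s v = v}
  add_mem' {v w} hv hw := by
    change parity s (v + w) = v + w
    rw [map_add, show parity s v = v from hv, show parity s w = w from hw]
  zero_mem' := map_zero (parity s)
  smul_mem' t v hv := by
    change parity s (t • v) = t • v
    rw [map_smul, show parity s v = v from hv]
  lie_mem {x v} hv := by
    change parity s (heisAction (current s) x v) = heisAction (current s) x v
    have h := LinearMap.congr_fun (commute_parity_heisAction s x).eq v
    rw [Module.End.mul_apply, Module.End.mul_apply, show parity s v = v from hv] at h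
    exact h

/-- The Virasoro operators on the even part of `H_s ⊗ H_s`. -/
def evenVirasoro (s : Sector) (χ : Chirality) (n : ℤ) : Module.End ℂ (even s) :=
  LinearMap.restrict (virasoro s χ n) (p := (even s).toSubmodule) (q := (even s).toSubmodule)
    fun v hv => by
      have h := LinearMap.congr_fun (commute_parity_virasoro s χ n).eq v
      rw [Module.End.mul_apply, Module.End.mul_apply, show parity s v = v from hv] at h
      exact h

end Dirac

/-- The space of states of the Dirac fermion, `H_A ⊗ H_A ⊕ H_P ⊗ H_P`. -/
abbrev DiracSpace : Type := ⨁ s : Sector, Dirac s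

namespace DiracSpace

/-- The parity operator on the space of states of the Dirac fermion. -/
def parity : Module.End ℂ DiracSpace := DirectSum.lmap Dirac.parity

/-- The Virasoro operators on the space of states of the Dirac fermion. -/
def virasoro (χ : Chirality) (n : ℤ) : Module.End ℂ DiracSpace :=
  DirectSum.lmap fun s => Dirac.virasoro s χ n

/-- The even part of the space of states of the Dirac fermion. -/
def even : LieSubmodule ℂ (Heis × Heis) DiracSpace where
  carrier := {v | parity v = v}
  add_mem' {v w} hv hw := by
    change parity (v + w) = v + w
    rw [map_add, show parity v = v from hv, show parity w = w from hw]
  zero_mem' := map_zero parity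
  smul_mem' t v hv := by
    change parity (t • v) = t • v
    rw [map_smul, show parity v = v from hv]
  lie_mem {x v} hv := by
    refine DFinsupp.ext fun s => ?_
    have hs : v s ∈ Dirac.even s := DFunLike.congr_fun (show parity v = v from hv) s
    exact (Dirac.even s).lie_mem (x := x) hs

/-- The Virasoro operators on the even part of the space of states of the Dirac fermion. -/
def evenVirasoro (χ : Chirality) (n : ℤ) : Module.End ℂ even :=
  LinearMap.restrict (virasoro χ n) (p := even.toSubmodule) (q := even.toSubmodule)
    fun v hv => by
      refine DFinsupp.ext fun s => ?_
      have hs : v s ∈ Dirac.even s := DFunLike.congr_fun (show parity v = v from hv) s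
      exact (Dirac.evenVirasoro s χ n ⟨v s, hs⟩).2

end DiracSpace

end Bosonization

end

/-!
# The bosonization correspondence

The space of states of the Dirac fermion decomposes into Verma modules of `Heis ⊕ Heis` because it
is generated, under the currents, by the filled Fermi seas.

*The seas.*  In each sector and for each pair of levels `t, t̄ ∈ ℤ` there is a vector in which,
of any two conjugate modes of the charged fields `b₁ ± i b₂`, exactly one annihilates
(`IsSea`, `sea`).  It is a highest weight vector for the currents, of weight
`((1 - δ) / 2 - t, (1 - δ) / 2 - t̄)` with `δ = 1` in the sector `A` and `δ = 0` in the sector `P`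
(`IsGround.isVacuum_sea`), and it is even if and only if `t - t̄` is.  So the even seas have the
weights in `Λ₁` for `A` and in `Λ₂` for `P`, and together those of the boson at radius `2`.

*The seas generate.*  Commutators with the currents turn a mode of a charged field into another
mode, so it is enough that every mode of the field maps every sea into what the currents generate
from the seas.  This follows from the finite identity
`∑_{i<m} a (i - m) ψ (t - 1 - i) |t⟩ = ± m ψ (t - 1 - m) |t⟩` (`IsSea.sum_current_charged`) by
induction on `m`: `ψ (t - 1) |t⟩` is a sea again.  No character formula is needed.

*Highest weight modules.*  A nonzero homomorphism from a Verma module is injective, because `L 0`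
grades the module and a homogeneous vector of the kernel of least degree would be a highest weight
vector with the wrong energy (`IsVacuum.injective`).  Hence a module generated by highest weight
vectors of distinct weights is the direct sum of the corresponding Verma modules
(`exists_equiv_directSum`).

*The Virasoro operators.*  Homomorphisms intertwine the Sugawara operators, so it remains to see
that these are the Virasoro operators of the fermions (`IsGround.virasoro_eq_sug`).  The difference
`D n` commutes with the currents, since they are primary of weight `1` for both.  `D 0` kills the
seas, on which both operators have the eigenvalue `q ^ 2 / 2`; so `D 0 = 0`.  Then `D n` commutes
with `L 0`, which is a series in the currents, while `[L 0, D n] = -n • D n`; so `D n = 0`.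
-/

noncomputable section

namespace Bosonization

/-! ### Calculus of locally finite sums -/

section LocallyFiniteSums

variable {W W' : Type*} [AddCommGroup W] [Module ℂ W] [AddCommGroup W'] [Module ℂ W']

lemma LocallyFinite.add {f g : ℤ → Module.End ℂ W} (hf : LocallyFinite f) (hg : LocallyFinite g) :
    LocallyFinite fun k => f k + g k := fun v =>
  ((hf v).union (hg v)).subset (Function.support_add _ _)

lemma LocallyFinite.smul {f : ℤ → Module.End ℂ W} (hf : LocallyFinite f) (c : ℤ → ℂ) :
    LocallyFinite fun k => c k • f k := fun v =>
  (hf v).subset (Function.support_smul_subset_right c _)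

lemma LocallyFinite.comp_equiv {f : ℤ → Module.End ℂ W} (hf : LocallyFinite f) (e : ℤ ≃ ℤ) :
    LocallyFinite fun k => f (e k) := fun v => (hf v).preimage e.injective.injOn

lemma LocallyFinite.mul_left {f : ℤ → Module.End ℂ W} (hf : LocallyFinite f)
    (A : Module.End ℂ W) : LocallyFinite fun k => A * f k := fun v =>
  (hf v).subset fun k hk h => hk (by
    change A (f k v) = 0
    rw [show f k v = 0 from h, map_zero])

lemma LocallyFinite.mul_right {f : ℤ → Module.End ℂ W} (hf : LocallyFinite f)
    (A : Module.End ℂ W) : LocallyFinite fun k => f k * A := fun v => hf (A v)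

lemma LocallyFinite.neg {f : ℤ → Module.End ℂ W} (hf : LocallyFinite f) :
    LocallyFinite fun k => -f k := fun v =>
  (hf v).subset fun k hk h => hk (by
    change -(f k v) = 0
    rw [show f k v = 0 from h, neg_zero])

lemma LocallyFinite.sub {f g : ℤ → Module.End ℂ W} (hf : LocallyFinite f) (hg : LocallyFinite g) :
    LocallyFinite fun k => f k - g k := by
  simpa only [sub_eq_add_neg] using hf.add hg.neg

lemma LocallyFinite.single (a : ℤ) (X : Module.End ℂ W) :
    LocallyFinite fun k => if k = a then X else 0 := fun v =>
  (Set.finite_singleton a).subset fun k hk => by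
    by_contra h
    exact hk (by
      change (if k = a then X else 0) v = 0
      rw [if_neg (show ¬k = a from h), LinearMap.zero_apply])

lemma sumEnd_add {f g : ℤ → Module.End ℂ W} (hf : LocallyFinite f) (hg : LocallyFinite g) :
    sumEnd (fun k => f k + g k) = sumEnd f + sumEnd g := by
  ext v
  rw [LinearMap.add_apply, sumEnd_apply (hf.add hg), sumEnd_apply hf, sumEnd_apply hg]
  exact finsum_add_distrib (hf v) (hg v)

lemma sumEnd_smul {f : ℤ → Module.End ℂ W} (hf : LocallyFinite f) (c : ℂ) :
    sumEnd (fun k => c • f k) = c • sumEnd f := by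
  ext v
  rw [LinearMap.smul_apply, sumEnd_apply (hf.smul fun _ => c), sumEnd_apply hf]
  exact (smul_finsum' c (hf v)).symm

lemma sumEnd_neg {f : ℤ → Module.End ℂ W} (hf : LocallyFinite f) :
    sumEnd (fun k => -f k) = -sumEnd f := by
  simpa only [neg_one_smul] using sumEnd_smul hf (-1)

lemma sumEnd_sub {f g : ℤ → Module.End ℂ W} (hf : LocallyFinite f) (hg : LocallyFinite g) :
    sumEnd (fun k => f k - g k) = sumEnd f - sumEnd g := by
  simp only [sub_eq_add_neg]
  rw [sumEnd_add hf hg.neg, sumEnd_neg hg]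

lemma sumEnd_mul_left {f : ℤ → Module.End ℂ W} (hf : LocallyFinite f) (A : Module.End ℂ W) :
    sumEnd (fun k => A * f k) = A * sumEnd f := by
  ext v
  rw [Module.End.mul_apply, sumEnd_apply (hf.mul_left A), sumEnd_apply hf]
  exact (map_finsum A (hf v)).symm

lemma sumEnd_mul_right {f : ℤ → Module.End ℂ W} (hf : LocallyFinite f) (A : Module.End ℂ W) :
    sumEnd (fun k => f k * A) = sumEnd f * A := by
  ext v
  rw [Module.End.mul_apply, sumEnd_apply (hf.mul_right A), sumEnd_apply hf]
  rfl

lemma sumEnd_comp_equiv {f : ℤ → Module.End ℂ W} (hf : LocallyFinite f) (e : ℤ ≃ ℤ) :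
    sumEnd (fun k => f (e k)) = sumEnd f := by
  ext v
  rw [sumEnd_apply (hf.comp_equiv e), sumEnd_apply hf]
  exact finsum_comp_equiv (f := fun k => f k v) e

lemma sumEnd_single (a : ℤ) (X : Module.End ℂ W) :
    sumEnd (fun k => if k = a then X else 0) = X := by
  ext v
  rw [sumEnd_apply (LocallyFinite.single a X), finsum_eq_single _ a, if_pos rfl]
  intro k hk
  rw [if_neg hk, LinearMap.zero_apply]

/-- The commutator with an operator may be computed term by term. -/
lemma sumEnd_commutator {f h : ℤ → Module.End ℂ W} (hf : LocallyFinite f) {A : Module.End ℂ W}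
    (hA : ∀ k, f k * A - A * f k = h k) : sumEnd f * A - A * sumEnd f = sumEnd h := by
  rw [← sumEnd_mul_left hf, ← sumEnd_mul_right hf, ← sumEnd_sub (hf.mul_right A) (hf.mul_left A)]
  exact congrArg sumEnd (funext hA)

/-- A linear map that intertwines two locally finite families term by term intertwines their
sums. -/
lemma sumEnd_intertwine {f : ℤ → Module.End ℂ W} {g : ℤ → Module.End ℂ W'}
    (hf : LocallyFinite f) (hg : LocallyFinite g) (Φ : W →ₗ[ℂ] W')
    (h : ∀ k v, Φ (f k v) = g k (Φ v)) (v : W) : Φ (sumEnd f v) = sumEnd g (Φ v) := by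
  rw [sumEnd_apply hf, sumEnd_apply hg, map_finsum Φ (hf v)]
  exact finsum_congr fun k => h k v

lemma sumEnd_apply_eq_zero {f : ℤ → Module.End ℂ W} {v : W} (h : ∀ k, f k v = 0) :
    sumEnd f v = 0 := by
  by_cases hf : LocallyFinite f
  · rw [sumEnd_apply hf, finsum_congr h, finsum_zero]
  · rw [sumEnd, dif_neg hf, LinearMap.zero_apply]

end LocallyFiniteSums

/-! ### Smooth representations of the Heisenberg relations -/

section Smooth

variable {W W' : Type*} [AddCommGroup W] [Module ℂ W] [AddCommGroup W'] [Module ℂ W']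

/-- Each vector is killed by all operators of sufficiently large index. -/
def IsSmooth (J : Chirality → ℤ → Module.End ℂ W) : Prop :=
  ∀ v, ∃ N : ℤ, ∀ χ k, N ≤ k → J χ k v = 0

/-- The normally ordered product of `J k` and `J l`: the factor with the larger index is put to the
right. -/
def normalProduct (J : ℤ → Module.End ℂ W) (k l : ℤ) : Module.End ℂ W :=
  if k ≤ l then J k * J l else J l * J k

/-- The Sugawara operators `½ ∑ k, :J (n - k) J k:` of a family of operators. -/
def sug (J : Chirality → ℤ → Module.End ℂ W) (χ : Chirality) (n : ℤ) : Module.End ℂ W :=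
  (1 / 2 : ℂ) • sumEnd fun k => normalProduct (J χ) (n - k) k

/-- The vector `v` is a highest weight vector of weight `w`. -/
structure IsVacuum (J : Chirality → ℤ → Module.End ℂ W) (w : Chirality → ℂ) (v : W) : Prop where
  pos : ∀ χ n, 0 < n → J χ n v = 0
  zero : ∀ χ, J χ 0 v = w χ • v

/-- The vectors of `S` generate the whole space under the operators `J`. -/
def Generates (J : Chirality → ℤ → Module.End ℂ W) (S : Set W) : Prop :=
  ∀ N : Submodule ℂ W, S ⊆ N → (∀ χ n, ∀ v ∈ N, J χ n v ∈ N) → N = ⊤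

variable {J : Chirality → ℤ → Module.End ℂ W} {J' : Chirality → ℤ → Module.End ℂ W'}

lemma IsSmooth.locallyFinite (hs : IsSmooth J) (χ : Chirality) (n : ℤ) :
    LocallyFinite fun k => normalProduct (J χ) (n - k) k := by
  intro v
  obtain ⟨N, hN⟩ := hs v
  -- Outside this interval the larger of the two indices is at least `N`.
  refine (Set.finite_Icc (min (n - N) (n - (n / 2 + 1))) (max N (n / 2 + 1))).subset
    fun k hk => ?_
  rw [Function.mem_support] at hk
  by_contra hk'
  rw [Set.mem_Icc, not_and_or, not_le, not_le, lt_min_iff, max_lt_iff] at hk'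
  apply hk
  change normalProduct (J χ) (n - k) k v = 0
  rw [normalProduct]
  split_ifs with h
  · rw [Module.End.mul_apply, hN χ k (by omega), map_zero]
  · rw [Module.End.mul_apply, hN χ (n - k) (by omega), map_zero]

lemma HeisRelations.commute_of_ne (hJ : HeisRelations J) {χ χ' : Chirality} (h : χ ≠ χ')
    (n m : ℤ) : Commute (J χ n) (J χ' m) := by
  rcases χ with _ | _ <;> rcases χ' with _ | _
  · exact absurd rfl h
  · exact hJ.comm n m
  · exact (hJ.comm m n).symm
  · exact absurd rfl h

lemma HeisRelations.commutator (hJ : HeisRelations J) (χ χ' : Chirality) (n m : ℤ) :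
    J χ n * J χ' m = J χ' m * J χ n + (if χ = χ' ∧ n + m = 0 then (n : ℂ) else 0) • 1 := by
  by_cases h : χ = χ'
  · subst h
    rw [← sub_eq_iff_eq_add', hJ.lie]
    by_cases h' : n + m = 0 <;> simp [h']
  · rw [if_neg (fun h' => h h'.1), zero_smul, add_zero, (hJ.commute_of_ne h n m).eq]

lemma commutator_normalProduct (hJ : HeisRelations J) (χ : Chirality) (k l m : ℤ) :
    normalProduct (J χ) k l * J χ m - J χ m * normalProduct (J χ) k l =
      (if l + m = 0 then (l : ℂ) else 0) • J χ k + (if k + m = 0 then (k : ℂ) else 0) • J χ l := by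
  have h : ∀ {X Y A : Module.End ℂ W} {x y : ℂ}, X * A = A * X + x • 1 → Y * A = A * Y + y • 1 →
      X * Y * A - A * (X * Y) = y • X + x • Y := by
    intro X Y A x y hX hY
    rw [mul_assoc, hY, mul_add, ← mul_assoc, hX, add_mul, mul_smul_comm, smul_mul_assoc, mul_one,
      one_mul, mul_assoc]
    abel
  have h1 := hJ.commutator χ χ k m
  have h2 := hJ.commutator χ χ l m
  simp only [true_and] at h1 h2
  by_cases hkl : k ≤ l
  · rw [normalProduct, if_pos hkl]
    exact h h1 h2
  · rw [normalProduct, if_neg hkl, h h2 h1, add_comm]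

/-- The currents are primary fields of weight `1` for the Sugawara operators. -/
lemma sug_commutator (hJ : HeisRelations J) (hs : IsSmooth J) (χ χ' : Chirality) (n m : ℤ) :
    sug J χ n * J χ' m - J χ' m * sug J χ n = if χ = χ' then (-m : ℂ) • J χ (n + m) else 0 := by
  rw [sug, smul_mul_assoc, mul_smul_comm, ← smul_sub]
  by_cases h : χ = χ'
  · subst h
    rw [sumEnd_commutator (hs.locallyFinite χ n)
      (h := fun k => (if k = -m then (-m : ℂ) • J χ (n + m) else 0) +
        if k = n + m then (-m : ℂ) • J χ (n + m) else 0), sumEnd_add (.single _ _) (.single _ _),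
      sumEnd_single, sumEnd_single, if_pos rfl]
    · module
    · intro k
      rw [commutator_normalProduct hJ]
      congr 1
      · by_cases hk : k = -m
        · subst hk
          simp [sub_neg_eq_add]
        · rw [if_neg hk, if_neg (by omega), zero_smul]
      · by_cases hk : k = n + m
        · subst hk
          simp
        · rw [if_neg hk, if_neg (by omega), zero_smul]
  · rw [if_neg h, (commute_sumEnd fun k => ?_ : Commute (J χ' m) _).eq, sub_self, smul_zero]
    have h1 := hJ.commute_of_ne (Ne.symm h) m
    rw [normalProduct]
    split_ifs
    · exact (h1 _).mul_right (h1 _)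
    · exact (h1 _).mul_right (h1 _)

/-- Operators that commute with the currents commute with the Sugawara operators. -/
lemma commute_sug {A : Module.End ℂ W} (hA : ∀ χ n, Commute A (J χ n)) (χ : Chirality) (n : ℤ) :
    Commute A (sug J χ n) := by
  refine (commute_sumEnd fun k => ?_).smul_right _
  rw [normalProduct]
  split_ifs
  · exact (hA _ _).mul_right (hA _ _)
  · exact (hA _ _).mul_right (hA _ _)

lemma sug_intertwine (hs : IsSmooth J) (hs' : IsSmooth J') (Φ : W →ₗ[ℂ] W')
    (h : ∀ χ n v, Φ (J χ n v) = J' χ n (Φ v)) (χ : Chirality) (n : ℤ) (v : W) :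
    Φ (sug J χ n v) = sug J' χ n (Φ v) := by
  rw [sug, sug, LinearMap.smul_apply, LinearMap.smul_apply, map_smul,
    sumEnd_intertwine (hs.locallyFinite χ n) (hs'.locallyFinite χ n) Φ]
  intro k v
  rw [normalProduct, normalProduct]
  split_ifs <;> simp only [Module.End.mul_apply, h]

lemma IsVacuum.sug_zero {w : Chirality → ℂ} {v : W} (hs : IsSmooth J) (hv : IsVacuum J w v)
    (χ : Chirality) : sug J χ 0 v = (w χ ^ 2 / 2) • v := by
  rw [sug, LinearMap.smul_apply, sumEnd_apply (hs.locallyFinite χ 0), finsum_eq_single _ 0]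
  · rw [normalProduct, if_pos (by omega), Module.End.mul_apply, sub_zero, hv.zero, map_smul,
      hv.zero, smul_smul, smul_smul]
    congr 1
    ring
  · intro k hk
    rw [normalProduct]
    split_ifs
    · rw [Module.End.mul_apply, hv.pos χ k (by omega), map_zero]
    · rw [Module.End.mul_apply, hv.pos χ (0 - k) (by omega), map_zero]

lemma HeisRelations.commute_zero (hJ : HeisRelations J) (χ χ' : Chirality) (n : ℤ) :
    Commute (J χ 0) (J χ' n) := by
  change _ * _ = _ * _
  rw [hJ.commutator]
  simp

/-- Smoothness has to be checked on generators only. -/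
lemma Generates.isSmooth (hJ : HeisRelations J) {S : Set W} (hS : Generates J S)
    (h : ∀ v ∈ S, ∃ N : ℤ, ∀ χ k, N ≤ k → J χ k v = 0) : IsSmooth J := by
  let P : Submodule ℂ W :=
    { carrier := {v | ∃ N : ℤ, ∀ χ k, N ≤ k → J χ k v = 0}
      add_mem' := by
        rintro v v' ⟨N, hN⟩ ⟨M, hM⟩
        refine ⟨max N M, fun χ k hk => ?_⟩
        rw [map_add, hN χ k (by omega), hM χ k (by omega), add_zero]
      zero_mem' := ⟨0, fun χ k _ => map_zero _⟩
      smul_mem' := by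
        rintro t v ⟨N, hN⟩
        exact ⟨N, fun χ k hk => by rw [map_smul, hN χ k hk, smul_zero]⟩ }
  have hP : P = ⊤ := hS P h (by
    rintro χ n v ⟨N, hN⟩
    refine ⟨max N (1 - n), fun χ' k hk => ?_⟩
    rw [← Module.End.mul_apply, hJ.commutator, if_neg (by omega), zero_smul, add_zero,
      Module.End.mul_apply, hN χ' k (by omega), map_zero])
  intro v
  have hv : v ∈ P := hP ▸ Submodule.mem_top
  exact hv

end Smooth

/-! ### Lie modules over the sum of two Heisenberg algebras -/

section LieModules

variable (M : Type*) [AddCommGroup M] [Module ℂ M] [LieRingModule (Heis × Heis) M]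
  [LieModule ℂ (Heis × Heis) M]

/-- The operators by which the generators `a n`, `ā n` act on a module. -/
def modes (χ : Chirality) (n : ℤ) : Module.End ℂ M :=
  LieModule.toEnd ℂ (Heis × Heis) M (heisIncl χ (Heis.a n))

/-- Both central elements act as the identity. -/
def CentralOne : Prop := ∀ χ (v : M), ⁅heisIncl χ Heis.K, v⁆ = v

variable {M}

lemma lie_heisIncl_a (χ χ' : Chirality) (n m : ℤ) :
    ⁅heisIncl χ (Heis.a n), heisIncl χ' (Heis.a m)⁆ =
      (if χ = χ' ∧ n + m = 0 then (n : ℂ) else 0) • heisIncl χ Heis.K := by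
  have hK : ∀ x y : Heis, ⁅x, y⁆ = heisCocycle x.coeff y.coeff • Heis.K := fun x y =>
    Prod.ext (smul_zero _).symm (mul_one _).symm
  have hc : heisCocycle (Heis.a n).coeff (Heis.a m).coeff = if n + m = 0 then (n : ℂ) else 0 := by
    change heisCocycle (Finsupp.single n 1) (Finsupp.single m 1) = _
    by_cases h : n + m = 0
    · obtain rfl : m = -n := by omega
      simp [heisCocycle]
    · simp [heisCocycle, h, show m ≠ -n from fun h' => h (by omega)]
  rcases χ with _ | _ <;> rcases χ' with _ | _ <;>
    simp [heisIncl, LieAlgebra.Prod.bracket_apply, hK, hc, Prod.smul_mk] <;>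
    split_ifs <;> rfl

lemma CentralOne.heisRelations (hK : CentralOne M) : HeisRelations (modes M) := by
  have h : ∀ χ χ' n m, modes M χ n * modes M χ' m - modes M χ' m * modes M χ n =
      (if χ = χ' ∧ n + m = 0 then (n : ℂ) else 0) • 1 := by
    intro χ χ' n m
    ext v
    have := lie_lie (heisIncl χ (Heis.a n)) (heisIncl χ' (Heis.a m)) v
    rw [lie_heisIncl_a, smul_lie, hK] at this
    exact this.symm
  refine ⟨fun χ n m => ?_, fun n m => ?_⟩
  · rw [h]
    by_cases h' : n + m = 0 <;> simp [h']
  · have := h .left .right n m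
    simp only [reduceCtorEq, false_and, if_false, zero_smul] at this
    exact sub_eq_zero.1 this

/-- If the central elements act as the identity, the action is determined by that of the
generators. -/
lemma CentralOne.toEnd_eq (hK : CentralOne M) (x : Heis × Heis) (v : M) :
    ⁅x, v⁆ = heisAction (modes M) x v := by
  have hx : ∀ χ (y : Heis), heisIncl χ y =
      (y.coeff.sum fun n c => c • heisIncl χ (Heis.a n)) + y.central • heisIncl χ Heis.K := by
    have h0 : ∀ y : Heis, y = (y.coeff.sum fun n c => c • Heis.a n) + y.central • Heis.K := by
      intro y
      refine Prod.ext ?_ ?_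
      · change y.coeff = Heis.coeff (_ + _)
        rw [map_add, map_smul, Finsupp.sum, map_sum]
        have h1 : ∀ n (c : ℂ), Heis.coeff (c • Heis.a n) = Finsupp.single n c := fun n c => by
          rw [map_smul]
          change c • Finsupp.single n (1 : ℂ) = _
          simp
        simp only [h1]
        change _ = _ + y.central • (0 : ℤ →₀ ℂ)
        rw [smul_zero, add_zero]
        exact (Finsupp.sum_single _).symm
      · change y.central = Heis.central (_ + _)
        rw [map_add, map_smul, Finsupp.sum, map_sum]
        have h1 : ∀ n (c : ℂ), Heis.central (c • Heis.a n) = 0 := fun n c => by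
          rw [map_smul]
          exact mul_zero c
        simp only [h1]
        change _ = _ + y.central • (1 : ℂ)
        simp
    intro χ y
    let I : Heis →ₗ[ℂ] Heis × Heis := match χ with
      | .left => LinearMap.inl ℂ Heis Heis
      | .right => LinearMap.inr ℂ Heis Heis
    have hI : ∀ y, heisIncl χ y = I y := by
      intro y
      rcases χ with _ | _ <;> rfl
    simp only [hI]
    conv_lhs => rw [h0 y]
    rw [map_add, map_smul, Finsupp.sum, map_sum]
    simp only [map_smul]
    rfl
  have hs : x = heisIncl .left x.1 + heisIncl .right x.2 := by simp [heisIncl]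
  have h1 : ∀ χ (y : Heis), ⁅heisIncl χ y, v⁆ =
      (Finsupp.linearCombination ℂ (modes M χ) y.coeff) v + y.central • v := by
    intro χ y
    rw [hx χ y, add_lie, smul_lie, hK, Finsupp.linearCombination_apply, Finsupp.sum, Finsupp.sum,
      sum_lie, LinearMap.sum_apply]
    simp only [smul_lie]
    rfl
  conv_lhs => rw [hs]
  rw [add_lie, h1, h1]
  rfl

/-- Linear combinations of the generators and of the identity preserve a subspace that the
generators preserve. -/
lemma heisAction_mem {W : Type*} [AddCommGroup W] [Module ℂ W]
    {J : Chirality → ℤ → Module.End ℂ W} {N : Submodule ℂ W}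
    (hN : ∀ χ n, ∀ v ∈ N, J χ n v ∈ N) (x : Heis × Heis) {v : W} (hv : v ∈ N) :
    heisAction J x v ∈ N := by
  have h1 : ∀ χ (y : Heis),
      (Finsupp.linearCombination ℂ (J χ) y.coeff) v + y.central • v ∈ N := by
    intro χ y
    refine N.add_mem ?_ (N.smul_mem _ hv)
    rw [Finsupp.linearCombination_apply, Finsupp.sum, LinearMap.sum_apply]
    exact N.sum_mem fun n _ => N.smul_mem _ (hN χ n v hv)
  exact N.add_mem (h1 .left x.1) (h1 .right x.2)

end LieModules

/-! ### Verma modules -/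

namespace Verma

variable (w : Chirality → ℂ)

/-- The highest weight vector. -/
def vac : Verma w := Submodule.Quotient.mk 1

lemma smul_vac (u : UniversalEnvelopingAlgebra ℂ (Heis × Heis)) :
    u • vac w = (Submodule.Quotient.mk u : _ ⧸ vermaIdeal w) := by
  change (Submodule.Quotient.mk (u • 1) : _ ⧸ vermaIdeal w) = _
  rw [smul_eq_mul, mul_one]

attribute [local instance 100] LieRing.ofAssociativeRing in
lemma adjoin_range_ι :
    Algebra.adjoin ℂ (Set.range (UniversalEnvelopingAlgebra.ι ℂ (L := Heis × Heis))) = ⊤ := by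
  set S := Algebra.adjoin ℂ (Set.range (UniversalEnvelopingAlgebra.ι ℂ (L := Heis × Heis)))
  let f : Heis × Heis →ₗ⁅ℂ⁆ S :=
    { toFun := fun x => ⟨UniversalEnvelopingAlgebra.ι ℂ x, Algebra.subset_adjoin ⟨x, rfl⟩⟩
      map_add' := fun x y => Subtype.ext (map_add _ x y)
      map_smul' := fun t x => Subtype.ext (map_smul (UniversalEnvelopingAlgebra.ι ℂ) t x)
      map_lie' := fun {x y} => Subtype.ext (ι_lie x y) }
  have h : S.val.comp (UniversalEnvelopingAlgebra.lift ℂ f) = AlgHom.id ℂ _ := by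
    refine UniversalEnvelopingAlgebra.hom_ext ℂ (LieHom.ext fun x => ?_)
    change S.val (UniversalEnvelopingAlgebra.lift ℂ f (UniversalEnvelopingAlgebra.ι ℂ x)) =
      UniversalEnvelopingAlgebra.ι ℂ x
    rw [UniversalEnvelopingAlgebra.lift_ι_apply]
    rfl
  refine eq_top_iff.2 fun u _ => ?_
  have hu := DFunLike.congr_fun h u
  change ((UniversalEnvelopingAlgebra.lift ℂ f u : S) : UniversalEnvelopingAlgebra ℂ _) = u at hu
  rw [← hu]
  exact SetLike.coe_mem _

/-- A subspace that is preserved by the Lie algebra and contains the highest weight vector is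
everything. -/
lemma eq_top_of_lie_mem (N : Submodule ℂ (Verma w)) (h0 : vac w ∈ N)
    (h : ∀ x : Heis × Heis, ∀ v ∈ N, ⁅x, v⁆ ∈ N) : N = ⊤ := by
  have key : ∀ u : UniversalEnvelopingAlgebra ℂ (Heis × Heis), ∀ v ∈ N, u • v ∈ N := by
    intro u
    have hu : u ∈ Algebra.adjoin ℂ
        (Set.range (UniversalEnvelopingAlgebra.ι ℂ (L := Heis × Heis))) := by
      rw [adjoin_range_ι]
      trivial
    induction hu using Algebra.adjoin_induction with
    | mem u hu =>
      obtain ⟨x, rfl⟩ := hu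
      exact h x
    | algebraMap r =>
      intro v hv
      rw [algebraMap_smul]
      exact N.smul_mem r hv
    | add u u' _ _ hu hu' =>
      intro v hv
      rw [add_smul]
      exact N.add_mem (hu v hv) (hu' v hv)
    | mul u u' _ _ hu hu' =>
      intro v hv
      rw [mul_smul]
      exact hu _ (hu' v hv)
  refine eq_top_iff.2 fun v _ => ?_
  obtain ⟨u, rfl⟩ := Submodule.Quotient.mk_surjective _ v
  have := key u _ h0
  rwa [smul_vac] at this

lemma smul_vac_eq_zero {u : UniversalEnvelopingAlgebra ℂ (Heis × Heis)} (hu : u ∈ vermaIdeal w) :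
    u • vac w = 0 := by
  rw [smul_vac]
  exact (Submodule.Quotient.mk_eq_zero _).2 hu

lemma isVacuum_vac : IsVacuum (modes (Verma w)) w (vac w) where
  pos χ n hn := smul_vac_eq_zero w (Submodule.subset_span (Or.inl (Or.inl ⟨χ, n, hn, rfl⟩)))
  zero χ := by
    have h := smul_vac_eq_zero w (Submodule.subset_span (Or.inl (Or.inr ⟨χ, rfl⟩)))
    rw [sub_smul, algebraMap_smul, sub_eq_zero] at h
    exact h

lemma centralOne : CentralOne (Verma w) := by
  intro χ v
  let N : Submodule ℂ (Verma w) :=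
    LinearMap.eqLocus (LieModule.toEnd ℂ (Heis × Heis) (Verma w) (heisIncl χ Heis.K)) 1
  suffices h : N = ⊤ by
    have hv : v ∈ N := h ▸ Submodule.mem_top
    exact hv
  refine eq_top_of_lie_mem w N ?_ fun x v hv => ?_
  · have h := smul_vac_eq_zero w (Submodule.subset_span (Or.inr ⟨χ, rfl⟩))
    rw [sub_smul, one_smul, sub_eq_zero] at h
    exact h
  · have hv' : ⁅heisIncl χ Heis.K, v⁆ = v := hv
    have hc : ⁅heisIncl χ Heis.K, x⁆ = 0 := by
      have h0 : ∀ y : Heis, ⁅Heis.K, y⁆ = 0 := fun y => Prod.ext rfl (by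
        change heisCocycle 0 y.coeff = 0
        simp)
      rcases χ with _ | _ <;> simp [heisIncl, LieAlgebra.Prod.bracket_apply, h0]
    change ⁅heisIncl χ Heis.K, ⁅x, v⁆⁆ = ⁅x, v⁆
    rw [leibniz_lie, hc, zero_lie, zero_add, hv']

lemma generates_vac : Generates (modes (Verma w)) {vac w} := by
  intro N h0 hN
  refine eq_top_of_lie_mem w N (h0 rfl) fun x v hv => ?_
  rw [(centralOne w).toEnd_eq]
  exact heisAction_mem hN x hv

lemma isSmooth : IsSmooth (modes (Verma w)) := by
  refine (generates_vac w).isSmooth (centralOne w).heisRelations ?_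
  rintro v rfl
  exact ⟨1, fun χ k hk => (isVacuum_vac w).pos χ k (by omega)⟩

section Universal

variable {w} {M : Type*} [AddCommGroup M] [Module ℂ M] [LieRingModule (Heis × Heis) M]
  [LieModule ℂ (Heis × Heis) M]

attribute [local instance 100] LieRing.ofAssociativeRing in
/-- The universal property of the Verma module. -/
lemma exists_hom (hK : CentralOne M) {v : M} (hv : IsVacuum (modes M) w v) :
    ∃ Φ : Verma w →ₗ[ℂ] M, Φ (vac w) = v ∧ ∀ (x : Heis × Heis) u, Φ ⁅x, u⁆ = ⁅x, Φ u⁆ := by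
  let F : UniversalEnvelopingAlgebra ℂ (Heis × Heis) →ₐ[ℂ] Module.End ℂ M :=
    UniversalEnvelopingAlgebra.lift ℂ (LieModule.toEnd ℂ (Heis × Heis) M)
  have hF : ∀ x m, F (UniversalEnvelopingAlgebra.ι ℂ x) m = ⁅x, m⁆ := fun x m => by
    rw [UniversalEnvelopingAlgebra.lift_ι_apply]
    rfl
  let Ann : Submodule (UniversalEnvelopingAlgebra ℂ (Heis × Heis))
      (UniversalEnvelopingAlgebra ℂ (Heis × Heis)) :=
    { carrier := {u | F u v = 0}
      add_mem' := fun {u u'} (hu : F u v = 0) (hu' : F u' v = 0) => by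
        change F (u + u') v = 0
        rw [map_add, LinearMap.add_apply, hu, hu', add_zero]
      zero_mem' := by
        change F 0 v = 0
        rw [map_zero, LinearMap.zero_apply]
      smul_mem' := fun c u (hu : F u v = 0) => by
        change F (c * u) v = 0
        rw [map_mul, Module.End.mul_apply, hu, map_zero] }
  have hle : vermaIdeal w ≤ Ann := by
    refine Submodule.span_le.2 ?_
    rintro u ((⟨χ, n, hn, rfl⟩ | ⟨χ, rfl⟩) | ⟨χ, rfl⟩)
    · exact (hF _ v).trans (hv.pos χ n hn)
    · change F (_ - _) v = 0
      rw [map_sub, LinearMap.sub_apply, hF, AlgHom.commutes, Module.algebraMap_end_apply,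
        sub_eq_zero]
      exact hv.zero χ
    · change F (_ - _) v = 0
      rw [map_sub, LinearMap.sub_apply, hF, map_one, Module.End.one_apply, hK, sub_self]
  let Φ₀ : UniversalEnvelopingAlgebra ℂ (Heis × Heis) →ₗ[ℂ] M :=
    LinearMap.applyₗ v ∘ₗ F.toLinearMap
  let Φ : Verma w →ₗ[ℂ] M :=
    ((vermaIdeal w).restrictScalars ℂ).liftQ Φ₀ (fun u hu => hle hu) ∘ₗ
      (Submodule.Quotient.restrictScalarsEquiv ℂ (vermaIdeal w)).symm.toLinearMap
  have hΦ : ∀ u : UniversalEnvelopingAlgebra ℂ (Heis × Heis),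
      Φ (Submodule.Quotient.mk u : _ ⧸ vermaIdeal w) = F u v := fun u => rfl
  refine ⟨Φ, ?_, fun x u => ?_⟩
  · refine (hΦ 1).trans ?_
    rw [map_one, Module.End.one_apply]
  · obtain ⟨u, rfl⟩ := Submodule.Quotient.mk_surjective _ u
    refine (hΦ (UniversalEnvelopingAlgebra.ι ℂ x * u)).trans ?_
    rw [map_mul, Module.End.mul_apply, hF]
    exact congrArg _ (hΦ u).symm

end Universal

end Verma

/-! ### Homomorphisms from highest weight representations -/

section Irreducible

variable {W W' : Type*} [AddCommGroup W] [Module ℂ W] [AddCommGroup W'] [Module ℂ W']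
  {J : Chirality → ℤ → Module.End ℂ W} {J' : Chirality → ℤ → Module.End ℂ W'}
  {w : Chirality → ℂ} {v : W}

/-- Eigenvectors of an operator for distinct eigenvalues have sum zero only if all of them
vanish. -/
lemma eq_zero_of_sum_eigenvectors {ι : Type*} (A : Module.End ℂ W) {μ : ι → ℂ}
    (hμ : Function.Injective μ) (s : Finset ι) (f : ι → W) (hf : ∀ i ∈ s, A (f i) = μ i • f i)
    (h : ∑ i ∈ s, f i = 0) : ∀ i ∈ s, f i = 0 :=
  (iSupIndep_iff_finsetSum_eq_zero_imp_eq_zero _).1 (A.eigenspaces_iSupIndep.comp hμ) s f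
    (fun i hi => Module.End.mem_eigenspace_iff.2 (hf i hi)) h

/-- The zero modes act by scalars on a highest weight representation. -/
lemma IsVacuum.zero_apply (hJ : HeisRelations J) (hv : IsVacuum J w v) (hg : Generates J {v})
    (χ : Chirality) (x : W) : J χ 0 x = w χ • x := by
  have h : LinearMap.eqLocus (J χ 0) (w χ • 1) = ⊤ := by
    refine hg _ (Set.singleton_subset_iff.2 (hv.zero χ)) fun χ' n y hy => ?_
    have hy' : J χ 0 y = w χ • y := hy
    change J χ 0 (J χ' n y) = w χ • J χ' n y
    rw [← Module.End.mul_apply, (hJ.commute_zero χ χ' n).eq, Module.End.mul_apply, hy', map_smul]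
  have hx : x ∈ LinearMap.eqLocus (J χ 0) (w χ • 1) := h ▸ Submodule.mem_top
  exact hx

/-- The vectors `a χ₁ (-n₁) ⋯ a χᵣ (-nᵣ) v` with all `nᵢ > 0`, of degree `n₁ + ⋯ + nᵣ`. -/
inductive Monomial (J : Chirality → ℤ → Module.End ℂ W) (v : W) : ℤ → W → Prop
  | vac : Monomial J v 0 v
  | step (χ : Chirality) (n d : ℤ) (x : W) (hn : 0 < n) (hx : Monomial J v d x) :
      Monomial J v (d + n) (J χ (-n) x)

/-- The span of the monomials of a given degree. -/
def gradedPart (J : Chirality → ℤ → Module.End ℂ W) (v : W) (d : ℤ) : Submodule ℂ W :=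
  Submodule.span ℂ {x | Monomial J v d x}

lemma gradedPart_neg {d : ℤ} (hd : d < 0) : gradedPart J v d = ⊥ := by
  have h : ∀ d x, Monomial J v d x → 0 ≤ d := by
    intro d x hx
    induction hx with
    | vac => exact le_rfl
    | step χ n d x hn _ ih => omega
  rw [gradedPart, Submodule.span_eq_bot]
  intro x hx
  exact absurd (h d x hx) (by omega)

lemma gradedPart_zero_le : gradedPart J v 0 ≤ Submodule.span ℂ {v} := by
  have h : ∀ d x, Monomial J v d x → 0 ≤ d ∧ (d = 0 → x = v) := by
    intro d x hx
    induction hx with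
    | vac => exact ⟨le_rfl, fun _ => rfl⟩
    | step χ n d x hn _ ih => exact ⟨by omega, fun h => by omega⟩
  refine Submodule.span_le.2 fun x hx => ?_
  rw [(h 0 x hx).2 rfl]
  exact Submodule.mem_span_singleton_self v

lemma gradedPart_step {d : ℤ} {x : W} (hx : x ∈ gradedPart J v d) (χ : Chirality) {m : ℤ}
    (hm : m < 0) : J χ m x ∈ gradedPart J v (d - m) := by
  have hle : gradedPart J v d ≤ (gradedPart J v (d - m)).comap (J χ m) := by
    refine Submodule.span_le.2 fun y hy => ?_
    have h := Monomial.step χ (-m) d y (by omega) hy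
    rw [neg_neg] at h
    exact Submodule.subset_span h
  exact hle hx

/-- The generator `a m` lowers the degree by `m`. -/
lemma gradedPart_apply (hJ : HeisRelations J) (hv : IsVacuum J w v) {d : ℤ} {x : W}
    (hx : x ∈ gradedPart J v d) (χ : Chirality) (m : ℤ) : J χ m x ∈ gradedPart J v (d - m) := by
  have h : ∀ d x, Monomial J v d x → ∀ m, J χ m x ∈ gradedPart J v (d - m) := by
    intro d x hx
    induction hx with
    | vac =>
      intro m
      rcases lt_trichotomy m 0 with h | rfl | h
      · exact gradedPart_step (Submodule.subset_span .vac) χ h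
      · rw [hv.zero, sub_zero]
        exact Submodule.smul_mem _ _ (Submodule.subset_span .vac)
      · rw [hv.pos χ m h]
        exact Submodule.zero_mem _
    | step χ' n d x hn hx ih =>
      intro m
      rw [← Module.End.mul_apply, hJ.commutator, LinearMap.add_apply, Module.End.mul_apply]
      refine Submodule.add_mem _ ?_ ?_
      · have := gradedPart_step (ih m) χ' (m := -n) (by omega)
        rwa [show d - m - -n = d + n - m by ring] at this
      · rw [LinearMap.smul_apply, Module.End.one_apply]
        split_ifs with h
        · rw [show d + n - m = d by omega]
          exact Submodule.smul_mem _ _ (Submodule.subset_span hx)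
        · rw [zero_smul]
          exact Submodule.zero_mem _
  have hle : gradedPart J v d ≤ (gradedPart J v (d - m)).comap (J χ m) :=
    Submodule.span_le.2 fun y hy => h d y hy m
  exact hle hx

lemma iSup_gradedPart (hJ : HeisRelations J) (hv : IsVacuum J w v) (hg : Generates J {v}) :
    ⨆ d, gradedPart J v d = ⊤ := by
  refine hg _ (Set.singleton_subset_iff.2 ?_) fun χ n x hx => ?_
  · exact Submodule.mem_iSup_of_mem 0 (Submodule.subset_span .vac)
  · have hle : ⨆ d, gradedPart J v d ≤ (⨆ d, gradedPart J v d).comap (J χ n) :=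
      iSup_le fun d y hy => Submodule.mem_iSup_of_mem (d - n) (gradedPart_apply hJ hv hy χ n)
    exact hle hx

/-- The operator `L 0 + L̄ 0`. -/
def energy (J : Chirality → ℤ → Module.End ℂ W) : Module.End ℂ W := sug J .left 0 + sug J .right 0

/-- The energy of the highest weight vectors of weight `w`. -/
def vacuumEnergy (w : Chirality → ℂ) : ℂ := w .left ^ 2 / 2 + w .right ^ 2 / 2

lemma IsVacuum.energy_apply (hs : IsSmooth J) (hv : IsVacuum J w v) :
    energy J v = vacuumEnergy w • v := by
  rw [energy, LinearMap.add_apply, hv.sug_zero hs, hv.sug_zero hs, vacuumEnergy, add_smul]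

lemma energy_commutator (hJ : HeisRelations J) (hs : IsSmooth J) (χ : Chirality) (m : ℤ) (x : W) :
    energy J (J χ m x) = J χ m (energy J x) - (m : ℂ) • J χ m x := by
  have h1 := LinearMap.congr_fun (sug_commutator hJ hs .left χ 0 m) x
  have h2 := LinearMap.congr_fun (sug_commutator hJ hs .right χ 0 m) x
  simp only [LinearMap.sub_apply, Module.End.mul_apply, zero_add] at h1 h2
  rw [energy, LinearMap.add_apply, LinearMap.add_apply, map_add, eq_add_of_sub_eq h1,
    eq_add_of_sub_eq h2]
  rcases χ with _ | _ <;> simp <;> abel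

/-- The homogeneous components are eigenspaces of the energy. -/
lemma energy_gradedPart (hJ : HeisRelations J) (hs : IsSmooth J) (hv : IsVacuum J w v) {d : ℤ}
    {x : W} (hx : x ∈ gradedPart J v d) : energy J x = (d + vacuumEnergy w) • x := by
  have h : ∀ d x, Monomial J v d x → energy J x = (d + vacuumEnergy w) • x := by
    intro d x hx
    induction hx with
    | vac => rw [hv.energy_apply hs, Int.cast_zero, zero_add]
    | step χ n d x hn _ ih =>
      rw [energy_commutator hJ hs, ih, map_smul]
      push_cast
      module
  have hle : gradedPart J v d ≤ LinearMap.eqLocus (energy J) ((d + vacuumEnergy w) • 1) :=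
    Submodule.span_le.2 fun y hy => h d y hy
  exact hle hx

/-- A homomorphism from a highest weight representation is injective as soon as it does not kill
the highest weight vector.  A homogeneous vector of the kernel is killed by the `a n` with `n > 0`,
by induction on the degree, so that its energy is that of the highest weight vector. -/
lemma IsVacuum.injective (hJ : HeisRelations J) (hs : IsSmooth J) (hs' : IsSmooth J')
    (hv : IsVacuum J w v) (hg : Generates J {v}) (Φ : W →ₗ[ℂ] W')
    (hΦ : ∀ χ n x, Φ (J χ n x) = J' χ n (Φ x)) (h0 : Φ v ≠ 0) : Function.Injective Φ := by
  have key : ∀ (N : ℕ) (d : ℤ), d < N → ∀ x ∈ gradedPart J v d, Φ x = 0 → x = 0 := by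
    intro N
    induction N with
    | zero =>
      intro d hd x hx _
      rw [gradedPart_neg (by exact_mod_cast hd)] at hx
      exact (Submodule.mem_bot ℂ).1 hx
    | succ N ih =>
      intro d hd x hx hΦx
      rcases lt_trichotomy d 0 with h | rfl | h
      · rw [gradedPart_neg h] at hx
        exact (Submodule.mem_bot ℂ).1 hx
      · obtain ⟨c, rfl⟩ := Submodule.mem_span_singleton.1 (gradedPart_zero_le hx)
        rw [map_smul, smul_eq_zero] at hΦx
        rw [hΦx.resolve_right h0, zero_smul]
      · have hvac : IsVacuum J w x :=
          ⟨fun χ n hn => ih (d - n) (by push_cast at hd; omega) _ (gradedPart_apply hJ hv hx χ n)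
            (by rw [hΦ, hΦx, map_zero]), fun χ => hv.zero_apply hJ hg χ x⟩
        have h1 := hvac.energy_apply hs
        rw [energy_gradedPart hJ hs hv hx, add_smul, add_eq_right, smul_eq_zero] at h1
        exact h1.resolve_left (by exact_mod_cast h.ne')
  have hE : ∀ x, Φ (energy J x) = energy J' (Φ x) := fun x => by
    rw [energy, energy, LinearMap.add_apply, LinearMap.add_apply, map_add,
      sug_intertwine hs hs' Φ hΦ, sug_intertwine hs hs' Φ hΦ]
  rw [injective_iff_map_eq_zero]
  intro x hx
  have hx' : x ∈ ⨆ d, gradedPart J v d := iSup_gradedPart hJ hv hg ▸ Submodule.mem_top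
  obtain ⟨f, hf, rfl⟩ := (Submodule.mem_iSup_iff_exists_finsupp _ _).1 hx'
  rw [Finsupp.sum, map_sum] at hx
  have h1 := eq_zero_of_sum_eigenvectors (energy J') (μ := fun d : ℤ => d + vacuumEnergy w)
    (fun d d' h => by exact_mod_cast add_right_cancel h) f.support (fun d => Φ (f d))
    (fun d _ => by rw [← hE, energy_gradedPart hJ hs hv (hf d), map_smul]) hx
  refine Finset.sum_eq_zero fun d hd => ?_
  exact key (d.toNat + 1) d (by push_cast; omega) _ (hf d) (h1 d hd)

end Irreducible

/-! ### Modules generated by highest weight vectors -/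

section Classification

variable {M : Type*} [AddCommGroup M] [Module ℂ M] [LieRingModule (Heis × Heis) M]
  [LieModule ℂ (Heis × Heis) M] {ι : Type} {w : ι → Chirality → ℂ}

lemma modes_directSum_apply (χ : Chirality) (n : ℤ) (x : ⨁ i, Verma (w i)) (i : ι) :
    modes (⨁ i, Verma (w i)) χ n x i = modes (Verma (w i)) χ n (x i) :=
  DirectSum.lie_module_bracket_apply _ _ _

lemma isSmooth_directSum_verma : IsSmooth (modes (⨁ i, Verma (w i))) := by
  classical
  intro x
  choose N hN using fun i => Verma.isSmooth (w i) (x i)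
  refine ⟨x.support.sum fun i => |N i|, fun χ k hk => DFinsupp.ext fun i => ?_⟩
  refine (modes_directSum_apply χ k x i).trans ?_
  by_cases hi : i ∈ x.support
  · have := Finset.single_le_sum (f := fun i => |N i|) (fun j _ => abs_nonneg (N j)) hi
    exact hN i χ k ((le_abs_self _).trans (this.trans hk))
  · rw [DFinsupp.notMem_support_iff.1 hi, map_zero]
    rfl

/-- A module that is generated by highest weight vectors of distinct weights is the direct sum of
the corresponding Verma modules.  The weights are told apart by the eigenvalue of `a 0 + i ā 0`. -/
theorem exists_equiv_directSum (hK : CentralOne M) (hs : IsSmooth (modes M)) (v : ι → M)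
    (hv : ∀ i, IsVacuum (modes M) (w i) (v i)) (h0 : ∀ i, v i ≠ 0)
    (hw : Function.Injective fun i => w i .left + Complex.I * w i .right)
    (hg : Generates (modes M) (Set.range v)) :
    ∃ Φ : M ≃ₗ⁅ℂ, Heis × Heis⁆ (⨁ i, Verma (w i)),
      ∀ χ n x, Φ (sugawara M χ n x) = sugawara (⨁ i, Verma (w i)) χ n (Φ x) := by
  classical
  choose φ hφv hφ using fun i => Verma.exists_hom hK (hv i)
  have hinj : ∀ i, Function.Injective (φ i) := fun i =>
    (Verma.isVacuum_vac (w i)).injective (Verma.centralOne _).heisRelations (Verma.isSmooth _) hs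
      (Verma.generates_vac _) (φ i) (fun χ n x => hφ i _ x) (by rw [hφv]; exact h0 i)
  let Ψ : (⨁ i, Verma (w i)) →ₗ[ℂ] M := DirectSum.toModule ℂ ι M φ
  have hΨ : ∀ i x, Ψ (DirectSum.lof ℂ ι _ i x) = φ i x := fun i x => DirectSum.toModule_lof ..
  have hlie : ∀ (y : Heis × Heis) x, Ψ ⁅y, x⁆ = ⁅y, Ψ x⁆ := by
    intro y x
    induction x using DirectSum.induction_on with
    | zero => rw [lie_zero, map_zero, lie_zero]
    | add x x' hx hx' => rw [lie_add, map_add, map_add, lie_add, hx, hx']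
    | of i x =>
      have h := (DirectSum.lieModuleOf ℂ ι (Heis × Heis) (fun i => Verma (w i)) i).map_lie y x
      change DirectSum.lof ℂ ι (fun i => Verma (w i)) i ⁅y, x⁆ =
        ⁅y, DirectSum.lof ℂ ι (fun i => Verma (w i)) i x⁆ at h
      change Ψ ⁅y, DirectSum.lof ℂ ι (fun i => Verma (w i)) i x⁆ =
        ⁅y, Ψ (DirectSum.lof ℂ ι (fun i => Verma (w i)) i x)⁆
      rw [← h, hΨ, hΨ, hφ]
  have hΨsum : ∀ x, Ψ x = ∑ i ∈ x.support, φ i (x i) := by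
    intro x
    conv_lhs => rw [← DirectSum.sum_support_of x]
    rw [map_sum]
    exact Finset.sum_congr rfl fun i _ => hΨ i (x i)
  have hinjΨ : Function.Injective Ψ := by
    rw [injective_iff_map_eq_zero]
    intro x hx
    rw [hΨsum] at hx
    have h1 := eq_zero_of_sum_eigenvectors (modes M .left 0 + Complex.I • modes M .right 0) hw
      x.support (fun i => φ i (x i)) (fun i _ => by
        have h2 : ∀ χ, modes M χ 0 (φ i (x i)) = w i χ • φ i (x i) := fun χ => by
          have h3 := (Verma.isVacuum_vac (w i)).zero_apply (Verma.centralOne _).heisRelations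
            (Verma.generates_vac _) χ (x i)
          rw [← map_smul, ← h3]
          exact (hφ i _ _).symm
        rw [LinearMap.add_apply, LinearMap.smul_apply, h2, h2, add_smul, smul_smul]) hx
    refine DFinsupp.ext fun i => ?_
    by_cases hi : i ∈ x.support
    · exact (injective_iff_map_eq_zero _).1 (hinj i) _ (h1 i hi)
    · exact DFinsupp.notMem_support_iff.1 hi
  have hsurj : Function.Surjective Ψ := by
    rw [← LinearMap.range_eq_top]
    refine hg _ ?_ ?_
    · rintro _ ⟨i, rfl⟩
      exact ⟨DirectSum.lof ℂ ι _ i (Verma.vac _), by rw [hΨ, hφv]⟩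
    · rintro χ n _ ⟨x, rfl⟩
      exact ⟨⁅heisIncl χ (Heis.a n), x⁆, hlie _ _⟩
  let e : (⨁ i, Verma (w i)) ≃ₗ[ℂ] M := LinearEquiv.ofBijective Ψ ⟨hinjΨ, hsurj⟩
  have he : ∀ (y : Heis × Heis) x, e.symm ⁅y, x⁆ = ⁅y, e.symm x⁆ := by
    intro y x
    rw [LinearEquiv.symm_apply_eq]
    refine Eq.symm ((hlie y _).trans ?_)
    congr 1
    exact e.apply_symm_apply x
  let Φ : M ≃ₗ⁅ℂ, Heis × Heis⁆ (⨁ i, Verma (w i)) :=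
    { e.symm with map_lie' := fun {y x} => he y x }
  refine ⟨Φ, fun χ n x => ?_⟩
  exact sug_intertwine hs isSmooth_directSum_verma e.symm.toLinearMap (fun χ n x => he _ x) χ n x

end Classification

/-! ### Bilinears of one fermion field -/

namespace IsFermionFamily

variable {W : Type*} [AddCommGroup W] [Module ℂ W] {κ : Type*} [DecidableEq κ]
  {δ : ℤ} {B : κ → ℤ → Module.End ℂ W}

lemma locallyFinite_of_ne_zero (hB : IsFermionFamily δ B) (i j : κ) {n : ℤ} (hn : n ≠ 0) :
    LocallyFinite fun k => B i (n - k - δ) * B j k := by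
  intro v
  obtain ⟨N, hN⟩ := hB.smooth v
  refine (Set.finite_Ioo (n - δ - N) N).subset fun k hk => ?_
  rw [Function.mem_support] at hk
  by_contra hk'
  rw [Set.mem_Ioo, not_and_or, not_lt, not_lt] at hk'
  apply hk
  change (B i (n - k - δ) * B j k) v = 0
  rcases hk' with h | h
  · rw [hB.anti (fun h => hn (by omega)), LinearMap.neg_apply, Module.End.mul_apply,
      hN i _ (by omega), map_zero, neg_zero]
  · rw [Module.End.mul_apply, hN j _ h, map_zero]

/-- The nonzero modes of the square of a fermion field vanish. -/
lemma sumEnd_square (hB : IsFermionFamily δ B) (i : κ) {n : ℤ} (hn : n ≠ 0) :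
    sumEnd (fun k => B i (n - k - δ) * B i k) = 0 := by
  have hf := hB.locallyFinite_of_ne_zero i i hn
  let e : ℤ ≃ ℤ := ⟨fun k => n - k - δ, fun k => n - k - δ, fun k => by ring, fun k => by ring⟩
  have h : sumEnd (fun k => B i (n - k - δ) * B i k) =
      -sumEnd (fun k => B i (n - k - δ) * B i k) := by
    rw [← sumEnd_neg hf]
    nth_rewrite 1 [← sumEnd_comp_equiv hf e]
    refine congrArg sumEnd (funext fun k => ?_)
    change B i (n - (n - k - δ) - δ) * B i (n - k - δ) = _
    rw [show n - (n - k - δ) - δ = k by ring, hB.anti (fun h => hn (by omega))]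
  rw [eq_neg_iff_add_eq_zero, ← two_smul ℂ] at h
  exact (smul_eq_zero.1 h).resolve_left two_ne_zero

lemma locallyFinite_normalOrder (hB : IsFermionFamily δ B) (i : κ) (n : ℤ) :
    LocallyFinite fun k => normalOrder (B i) (n - k - δ) k := by
  intro v
  obtain ⟨N, hN⟩ := hB.smooth v
  refine (Set.finite_Icc (min (n - δ - N) ((n - δ) / 2 - 1)) (max N ((n - δ) / 2 + 1))).subset
    fun k hk => ?_
  rw [Function.mem_support] at hk
  by_contra hk'
  rw [Set.mem_Icc, not_and_or, not_le, not_le, lt_min_iff, max_lt_iff] at hk'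
  apply hk
  change normalOrder (B i) (n - k - δ) k v = 0
  rw [normalOrder]
  split_ifs with h h'
  · rw [Module.End.mul_apply, hN i k (by omega), map_zero]
  · rw [LinearMap.neg_apply, Module.End.mul_apply, hN i (n - k - δ) (by omega), map_zero, neg_zero]
  · rfl

lemma normalOrder_commutator (hB : IsFermionFamily δ B) (i j : κ) (k l m : ℤ) :
    normalOrder (B i) k l * B j m - B j m * normalOrder (B i) k l =
      (if i = j ∧ l + m + δ = 0 then (1 : ℂ) else 0) • B i k -
        (if i = j ∧ k + m + δ = 0 then (1 : ℂ) else 0) • B i l := by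
  have h : ∀ {X Y A : Module.End ℂ W} {x y : ℂ}, X * A + A * X = x • 1 → Y * A + A * Y = y • 1 →
      X * Y * A - A * (X * Y) = y • X - x • Y := by
    intro X Y A x y hX hY
    have h1 : X * Y * A - A * (X * Y) = X * (Y * A + A * Y) - (X * A + A * X) * Y := by
      noncomm_ring
    rw [h1, hX, hY, mul_smul_comm, smul_mul_assoc, mul_one, one_mul]
  have hc : ∀ k, B i k * B j m + B j m * B i k =
      (if i = j ∧ k + m + δ = 0 then (1 : ℂ) else 0) • 1 := fun k => by
    rw [hB.car]
    split_ifs <;> simp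
  rcases lt_trichotomy k l with hkl | rfl | hkl
  · rw [normalOrder, if_pos hkl, h (hc k) (hc l)]
  · rw [normalOrder, if_neg (lt_irrefl k), if_neg (lt_irrefl k)]
    simp
  · rw [normalOrder, if_neg hkl.not_gt, if_pos hkl, neg_mul, mul_neg, sub_neg_eq_add,
      neg_add_eq_sub, ← neg_sub, h (hc l) (hc k), neg_sub]

end IsFermionFamily

/-! ### The charged fermions and the currents -/

/-- The sign that distinguishes the currents `j = -i ψ₁ ψ₂` and `j̄ = i ψ̄₁ ψ̄₂`. -/
def Chirality.sign : Chirality → ℂ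
  | .left => 1
  | .right => -1

lemma Chirality.sign_mul_self (χ : Chirality) : χ.sign * χ.sign = 1 := by
  rcases χ with _ | _ <;> simp [Chirality.sign]

namespace Dirac

variable {s : Sector}

/-- The modes of the field `b₁ ± i b₂` (`b̄₁ ∓ i b̄₂` for the right movers) of charge `ε = ±1`. -/
def charged (s : Sector) (ε : ℂ) (χ : Chirality) (k : ℤ) : Module.End ℂ (Dirac s) :=
  mode s (χ, 0) k + (Complex.I * (ε * χ.sign)) • mode s (χ, 1) k

lemma mode_zero_eq (ε : ℂ) (χ : Chirality) (k : ℤ) :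
    mode s (χ, 0) k = (1 / 2 : ℂ) • (charged s ε χ k + charged s (-ε) χ k) := by
  rw [charged, charged]
  module

lemma mode_one_eq {ε : ℂ} (hε : ε * ε = 1) (χ : Chirality) (k : ℤ) :
    mode s (χ, 1) k =
      (-Complex.I * (ε * χ.sign) / 2) • (charged s ε χ k - charged s (-ε) χ k) := by
  have h : Complex.I * Complex.I * (ε * ε) * (χ.sign * χ.sign) = -1 := by
    rw [Complex.I_mul_I, hε, χ.sign_mul_self]
    ring
  have h1 : charged s ε χ k - charged s (-ε) χ k =
      (2 * (Complex.I * (ε * χ.sign))) • mode s (χ, 1) k := by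
    rw [charged, charged]
    module
  rw [h1, smul_smul, show -Complex.I * (ε * χ.sign) / 2 * (2 * (Complex.I * (ε * χ.sign))) =
    -(Complex.I * Complex.I * (ε * ε) * (χ.sign * χ.sign)) by ring, h, neg_neg, one_smul]

lemma charged_car (ε ε' : ℂ) (χ χ' : Chirality) (k l : ℤ) :
    charged s ε χ k * charged s ε' χ' l + charged s ε' χ' l * charged s ε χ k =
      (if χ = χ' ∧ k + l + s.shift = 0 then 1 - ε * ε' else 0) • 1 := by
  have hB := isFermionFamily s
  have h00 := hB.car (χ, 0) (χ', 0) k l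
  have h01 := hB.car (χ, 0) (χ', 1) k l
  have h10 := hB.car (χ, 1) (χ', 0) k l
  have h11 := hB.car (χ, 1) (χ', 1) k l
  simp only [Prod.mk.injEq, and_true, and_false, false_and, one_ne_zero, zero_ne_one,
    if_false] at h00 h01 h10 h11
  have h : charged s ε χ k * charged s ε' χ' l + charged s ε' χ' l * charged s ε χ k =
      (mode s (χ, 0) k * mode s (χ', 0) l + mode s (χ', 0) l * mode s (χ, 0) k) +
      (Complex.I * (ε' * χ'.sign)) •
        (mode s (χ, 0) k * mode s (χ', 1) l + mode s (χ', 1) l * mode s (χ, 0) k) +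
      (Complex.I * (ε * χ.sign)) •
        (mode s (χ, 1) k * mode s (χ', 0) l + mode s (χ', 0) l * mode s (χ, 1) k) +
      (Complex.I * (ε * χ.sign) * (Complex.I * (ε' * χ'.sign))) •
        (mode s (χ, 1) k * mode s (χ', 1) l + mode s (χ', 1) l * mode s (χ, 1) k) := by
    simp only [charged, add_mul, mul_add, smul_mul_assoc, mul_smul_comm]
    module
  rw [h, h00, h01, h10, h11, smul_zero, smul_zero, add_zero, add_zero]
  split_ifs with hc
  · obtain ⟨rfl, _⟩ := hc
    rw [show Complex.I * (ε * χ.sign) * (Complex.I * (ε' * χ.sign)) =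
      Complex.I * Complex.I * (ε * ε') * (χ.sign * χ.sign) by ring, χ.sign_mul_self,
      Complex.I_mul_I]
    module
  · simp

lemma charged_anti {ε ε' : ℂ} {χ χ' : Chirality} {k l : ℤ}
    (h : ¬(χ = χ' ∧ k + l + s.shift = 0)) :
    charged s ε χ k * charged s ε' χ' l = -(charged s ε' χ' l * charged s ε χ k) := by
  rw [eq_neg_iff_add_eq_zero, charged_car, if_neg h, zero_smul]

lemma charged_anti_same {ε : ℂ} (hε : ε * ε = 1) (χ : Chirality) (k l : ℤ) :
    charged s ε χ k * charged s ε χ l = -(charged s ε χ l * charged s ε χ k) := by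
  rw [eq_neg_iff_add_eq_zero, charged_car, hε]
  simp

lemma parity_charged (ε : ℂ) (χ : Chirality) (k : ℤ) (v : Dirac s) :
    parity s (charged s ε χ k v) = -charged s ε χ k (parity s v) := by
  have h0 := LinearMap.congr_fun (mode_parity s (χ, 0) k) v
  have h1 := LinearMap.congr_fun (mode_parity s (χ, 1) k) v
  simp only [Module.End.mul_apply, LinearMap.neg_apply] at h0 h1
  rw [charged, LinearMap.add_apply, LinearMap.add_apply, LinearMap.smul_apply,
    LinearMap.smul_apply, map_add, map_smul, h0, h1]
  module

lemma current_eq (χ : Chirality) (n : ℤ) : current s χ n =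
    (-(Complex.I * χ.sign)) • bilinear s.shift (mode s) (χ, 0) (χ, 1) n := by
  rcases χ with _ | _ <;> simp [current, Chirality.sign]

/-- The field `charged s ε χ` has charge `ε` for the current of chirality `χ` and charge `0` for the
other one. -/
lemma current_charged {ε : ℂ} (hε : ε * ε = 1) (χ χ' : Chirality) (n l : ℤ) :
    current s χ n * charged s ε χ' l = charged s ε χ' l * current s χ n +
      if χ = χ' then ε • charged s ε χ (n + l) else 0 := by
  have hB := isFermionFamily s
  by_cases h : χ = χ'
  · subst h
    have h0 := hB.bilinear_left (i := (χ, 0)) (j := (χ, 1)) (by simp) n l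
    have h1 := hB.bilinear_right (i := (χ, 0)) (j := (χ, 1)) (by simp) n l
    rw [current_eq, if_pos rfl, charged, charged, mul_add, add_mul, mul_smul_comm, smul_mul_assoc,
      smul_mul_assoc, h0, h1, smul_mul_assoc, mul_smul_comm, mul_smul_comm]
    have h2 : Complex.I * (ε * χ.sign) * (-(Complex.I * χ.sign)) = ε := by
      rw [show Complex.I * (ε * χ.sign) * (-(Complex.I * χ.sign)) =
        -(Complex.I * Complex.I * (χ.sign * χ.sign)) * ε by ring, χ.sign_mul_self,
        Complex.I_mul_I]
      ring
    have h3 : ε * (Complex.I * (ε * χ.sign)) = Complex.I * χ.sign := by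
      rw [show ε * (Complex.I * (ε * χ.sign)) = (ε * ε) * (Complex.I * χ.sign) by ring, hε,
        one_mul]
    simp only [smul_add, smul_sub, smul_smul, h2, h3]
    module
  · rw [if_neg h, add_zero, current_eq, charged]
    have h' : χ' ≠ χ := Ne.symm h
    have h0 := (hB.bilinear_commute (i := (χ, 0)) (j := (χ, 1)) (m := (χ', 0)) (by simp [h'])
      (by simp [h']) n l)
    have h1 := (hB.bilinear_commute (i := (χ, 0)) (j := (χ, 1)) (m := (χ', 1)) (by simp [h'])
      (by simp [h']) n l)
    exact ((h0.add_left (h1.smul_left _)).smul_right _).eq.symm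

lemma isSmooth_current : IsSmooth (current s) := by
  intro v
  have hB := isFermionFamily s
  obtain ⟨N, hN⟩ := hB.smooth v
  refine ⟨2 * N + s.shift, fun χ n hn => ?_⟩
  rw [current_eq, LinearMap.smul_apply, bilinear, sumEnd_apply_eq_zero, smul_zero]
  intro k
  by_cases hk : N ≤ k
  · rw [Module.End.mul_apply, hN _ k hk, map_zero]
  · rw [hB.anti (by simp), LinearMap.neg_apply, Module.End.mul_apply, hN _ _ (by omega), map_zero,
      neg_zero]

lemma charged_mul_eq {ε : ℂ} (hε : ε * ε = 1) (χ : Chirality) (p k : ℤ) :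
    charged s ε χ p * charged s (-ε) χ k =
      (mode s (χ, 0) p * mode s (χ, 0) k + mode s (χ, 1) p * mode s (χ, 1) k) +
      (Complex.I * (ε * χ.sign)) •
        (mode s (χ, 1) p * mode s (χ, 0) k - mode s (χ, 0) p * mode s (χ, 1) k) := by
  have h : Complex.I * (ε * χ.sign) * (Complex.I * (-ε * χ.sign)) = 1 := by
    rw [show Complex.I * (ε * χ.sign) * (Complex.I * (-ε * χ.sign)) =
        -(Complex.I * Complex.I * (ε * ε) * (χ.sign * χ.sign)) by ring, χ.sign_mul_self, hε,
        Complex.I_mul_I]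
    ring
  rw [charged, charged, mul_add, add_mul, add_mul, smul_mul_smul_comm, h, smul_mul_assoc,
    mul_smul_comm]
  module

/-- The nonzero modes of a current as bilinears in the charged fermions. -/
lemma current_eq_charged {ε : ℂ} (hε : ε * ε = 1) (χ : Chirality) {n : ℤ} (hn : n ≠ 0) :
    LocallyFinite (fun k => charged s ε χ (n - k - s.shift) * charged s (-ε) χ k) ∧
    current s χ n =
      (ε / 2) • sumEnd fun k => charged s ε χ (n - k - s.shift) * charged s (-ε) χ k := by
  have hB := isFermionFamily s
  have hf := fun i j => hB.locallyFinite_of_ne_zero i j hn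
  simp only [charged_mul_eq hε]
  have h1 := (hf (χ, 0) (χ, 0)).add (hf (χ, 1) (χ, 1))
  have h2 := ((hf (χ, 1) (χ, 0)).sub (hf (χ, 0) (χ, 1)))
  have h3 := h2.smul fun _ => Complex.I * (ε * χ.sign)
  refine ⟨h1.add h3, ?_⟩
  rw [sumEnd_add h1 h3, sumEnd_add (hf _ _) (hf _ _), hB.sumEnd_square _ hn,
    hB.sumEnd_square _ hn, sumEnd_smul h2, sumEnd_sub (hf _ _) (hf _ _), current_eq, add_zero,
    zero_add]
  change _ = (ε / 2) • (Complex.I * (ε * χ.sign)) •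
    (bilinear s.shift (mode s) (χ, 1) (χ, 0) n - bilinear s.shift (mode s) (χ, 0) (χ, 1) n)
  rw [hB.bilinear_swap (i := (χ, 1)) (j := (χ, 0)) (by simp), smul_smul,
    show ε / 2 * (Complex.I * (ε * χ.sign)) = (ε * ε) * (Complex.I * χ.sign) / 2 by ring, hε]
  module

/-! ### The Virasoro operators of the fermions -/

/-- The modes of each fermion are primary of weight `1/2` for the Virasoro operators of their
chirality. -/
lemma virasoro_mode (χ χ' : Chirality) (c : Fin 2) (n m : ℤ) :
    virasoro s χ n * mode s (χ', c) m - mode s (χ', c) m * virasoro s χ n =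
      if χ = χ' then (-(m + s.shift / 2 + n / 2) : ℂ) • mode s (χ', c) (n + m) else 0 := by
  have hB := isFermionFamily s
  have key : ∀ d : Fin 2,
      (sumEnd (fun k => ((s.modeNumber k / 2 + 1 / 4 : ℚ) : ℂ) •
        normalOrder (mode s (χ, d)) (n - k - s.shift) k)) * mode s (χ', c) m -
      mode s (χ', c) m * (sumEnd (fun k => ((s.modeNumber k / 2 + 1 / 4 : ℚ) : ℂ) •
        normalOrder (mode s (χ, d)) (n - k - s.shift) k)) =
      if (χ, d) = (χ', c) then (-(m + s.shift / 2 + n / 2) : ℂ) • mode s (χ', c) (n + m)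
        else 0 := by
    intro d
    have hf := (hB.locallyFinite_normalOrder (χ, d) n).smul
      fun k => ((s.modeNumber k / 2 + 1 / 4 : ℚ) : ℂ)
    by_cases h : (χ, d) = (χ', c)
    · rw [sumEnd_commutator hf (h := fun k =>
        (if k = -m - s.shift then ((s.modeNumber (-m - s.shift) / 2 + 1 / 4 : ℚ) : ℂ) •
          mode s (χ', c) (n + m) else 0) -
        (if k = n + m then ((s.modeNumber (n + m) / 2 + 1 / 4 : ℚ) : ℂ) •
          mode s (χ', c) (n + m) else 0)), sumEnd_sub (.single _ _) (.single _ _),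
        sumEnd_single, sumEnd_single, if_pos h, ← sub_smul]
      · congr 1
        simp only [Sector.modeNumber]
        push_cast
        ring
      · intro k
        rw [smul_mul_assoc, mul_smul_comm, ← smul_sub, hB.normalOrder_commutator, h, smul_sub]
        congr 1
        · by_cases hk : k = -m - s.shift
          · subst hk
            rw [if_pos ⟨rfl, by omega⟩, if_pos rfl, one_smul,
              show n - (-m - s.shift) - s.shift = n + m by ring]
          · rw [if_neg fun h => hk (by omega), if_neg hk, zero_smul, smul_zero]
        · by_cases hk : k = n + m
          · subst hk
            rw [if_pos ⟨rfl, by omega⟩, if_pos rfl, one_smul]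
          · rw [if_neg fun h => hk (by omega), if_neg hk, zero_smul, smul_zero]
    · rw [if_neg h, (commute_sumEnd fun k => ?_ : Commute (mode s (χ', c) m) _).eq, sub_self]
      refine Commute.smul_right ?_ _
      have h1 := hB.normalOrder_commutator (χ, d) (χ', c) (n - k - s.shift) k m
      rw [if_neg fun h' => h h'.1, if_neg fun h' => h h'.1, zero_smul, zero_smul, sub_zero,
        sub_eq_zero] at h1
      exact h1.symm
  have hc : ∀ p : Prop, ∀ [Decidable p], Commute (mode s (χ', c) m)
      (if p then (1 / 16 : ℂ) • (1 : Module.End ℂ (Dirac s)) else 0) := by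
    intro p _
    split_ifs
    · exact (Commute.one_right _).smul_right _
    · exact Commute.zero_right _
  rw [virasoro, Fin.sum_univ_two]
  simp only [add_mul, mul_add, (hc _).eq]
  -- The central terms `δ_{n,0} h` drop out of the commutator.
  have e : ∀ a b x y p : Module.End ℂ (Dirac s), a + p + (b + p) - (x + p + (y + p)) =
    (a - x) + (b - y) := fun a b x y p => by abel
  rw [e, key, key]
  by_cases h : χ = χ'
  · subst h
    fin_cases c <;> simp
  · simp [h]

lemma virasoro_charged (ε : ℂ) (χ χ' : Chirality) (n m : ℤ) :
    virasoro s χ n * charged s ε χ' m - charged s ε χ' m * virasoro s χ n =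
      if χ = χ' then (-(m + s.shift / 2 + n / 2) : ℂ) • charged s ε χ' (n + m) else 0 := by
  have h0 := virasoro_mode (s := s) χ χ' 0 n m
  have h1 := virasoro_mode (s := s) χ χ' 1 n m
  rw [charged, charged, mul_add, add_mul, mul_smul_comm, smul_mul_assoc, add_sub_add_comm,
    ← smul_sub, h0, h1]
  split_ifs
  · module
  · simp

/-- The currents are primary of weight `1` for the Virasoro operators of the fermions. -/
lemma virasoro_current (χ χ' : Chirality) (n m : ℤ) :
    virasoro s χ n * current s χ' m - current s χ' m * virasoro s χ n =
      if χ = χ' then (-m : ℂ) • current s χ (n + m) else 0 := by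
  have hB := isFermionFamily s
  have hf := fun m => hB.locallyFinite (i := (χ', 0)) (j := (χ', 1)) (by simp) m
  have hmul : ∀ X Y A : Module.End ℂ (Dirac s), X * Y * A - A * (X * Y) =
      -(X * (A * Y - Y * A)) - (A * X - X * A) * Y := fun X Y A => by noncomm_ring
  rw [current_eq, mul_smul_comm, smul_mul_assoc, ← smul_sub, ← neg_sub, bilinear]
  by_cases h : χ = χ'
  · subst h
    have hf' : LocallyFinite fun k => mode s (χ, 0) (n + m - k - s.shift) * mode s (χ, 1) k :=
      hf (n + m)
    -- The commutator with `mode s (χ, 1) k` shifts its index by `n`; the sum is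
    -- reindexed accordingly.
    let e : ℤ ≃ ℤ := Equiv.addLeft n
    have h1 := hf'.smul fun k => (m - k - s.shift / 2 + n / 2 : ℂ)
    have h2 := hf'.smul fun k => (k - n / 2 + s.shift / 2 : ℂ)
    have h3 := h2.comp_equiv e
    rw [sumEnd_commutator (hf m) (h := fun k =>
      (m - k - s.shift / 2 + n / 2 : ℂ) •
        (mode s (χ, 0) (n + m - k - s.shift) * mode s (χ, 1) k) +
      (((e k : ℤ) : ℂ) - n / 2 + s.shift / 2) •
        (mode s (χ, 0) (n + m - e k - s.shift) * mode s (χ, 1) (e k))), sumEnd_add h1 h3,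
      sumEnd_comp_equiv h2 e, ← sumEnd_add h1 h2, if_pos rfl, current_eq, bilinear, smul_neg,
      smul_comm, ← smul_neg, ← sumEnd_smul hf', ← sumEnd_neg (h1.add h2)]
    · refine congrArg _ (congrArg sumEnd (funext fun k => ?_))
      module
    · intro k
      have hm0 := virasoro_mode (s := s) χ χ 0 n (m - k - s.shift)
      have hm1 := virasoro_mode (s := s) χ χ 1 n k
      rw [if_pos rfl] at hm0 hm1
      rw [hmul, hm0, hm1]
      change _ = _ + (((n + k : ℤ) : ℂ) - n / 2 + s.shift / 2) •
        (mode s (χ, 0) (n + m - (n + k) - s.shift) * mode s (χ, 1) (n + k))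
      rw [show n + m - (n + k) - s.shift = m - k - s.shift by ring,
        show n + (m - k - s.shift) = n + m - k - s.shift by ring, mul_smul_comm, smul_mul_assoc]
      push_cast
      module
  · rw [if_neg h, (commute_sumEnd fun k => ?_ : Commute (virasoro s χ n) _).eq, sub_self, neg_zero,
      smul_zero]
    have hm := fun c l => virasoro_mode (s := s) χ χ' c n l
    simp only [if_neg h, sub_eq_zero] at hm
    exact (show Commute _ _ from hm 0 _).mul_right (hm 1 _)

lemma virasoro_zero_virasoro (χ : Chirality) (n : ℤ) :
    virasoro s χ n * virasoro s χ 0 - virasoro s χ 0 * virasoro s χ n =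
      (n : ℂ) • virasoro s χ n := by
  have hB := isFermionFamily s
  have key : ∀ d : Fin 2,
      (sumEnd (fun k => ((s.modeNumber k / 2 + 1 / 4 : ℚ) : ℂ) •
        normalOrder (mode s (χ, d)) (n - k - s.shift) k)) * virasoro s χ 0 -
      virasoro s χ 0 * (sumEnd (fun k => ((s.modeNumber k / 2 + 1 / 4 : ℚ) : ℂ) •
        normalOrder (mode s (χ, d)) (n - k - s.shift) k)) =
      (n : ℂ) • (sumEnd (fun k => ((s.modeNumber k / 2 + 1 / 4 : ℚ) : ℂ) •
        normalOrder (mode s (χ, d)) (n - k - s.shift) k)) := by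
    intro d
    have hf := (hB.locallyFinite_normalOrder (χ, d) n).smul
      fun k => ((s.modeNumber k / 2 + 1 / 4 : ℚ) : ℂ)
    rw [← sumEnd_smul hf]
    refine sumEnd_commutator hf fun k => ?_
    rw [smul_mul_assoc, mul_smul_comm, ← smul_sub, smul_comm]
    congr 1
    have hm : ∀ k, virasoro s χ 0 * mode s (χ, d) k = mode s (χ, d) k * virasoro s χ 0 +
        (-(k + s.shift / 2) : ℂ) • mode s (χ, d) k := fun k => by
      rw [← sub_eq_iff_eq_add', virasoro_mode, if_pos rfl, zero_add]
      congr 1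
      push_cast
      ring
    have hmm : ∀ k l, k + l + s.shift = n → mode s (χ, d) k * mode s (χ, d) l * virasoro s χ 0 -
        virasoro s χ 0 * (mode s (χ, d) k * mode s (χ, d) l) =
          (n : ℂ) • (mode s (χ, d) k * mode s (χ, d) l) := by
      rintro k l rfl
      rw [← mul_assoc (virasoro s χ 0), hm, add_mul, mul_assoc _ (virasoro s χ 0), hm, mul_add,
        mul_smul_comm, smul_mul_assoc, mul_assoc]
      push_cast
      module
    rw [normalOrder]
    split_ifs
    · exact hmm _ _ (by ring)
    · rw [neg_mul, mul_neg, sub_neg_eq_add, neg_add_eq_sub, ← neg_sub, hmm _ _ (by ring), smul_neg]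
    · simp
  have hc : (n : ℂ) • (if s = .P ∧ n = 0 then (1 / 16 : ℂ) • (1 : Module.End ℂ (Dirac s)) else 0)
      = 0 := by
    split_ifs with h
    · rw [h.2, Int.cast_zero, zero_smul]
    · rw [smul_zero]
  have hc' : Commute (virasoro s χ 0)
      (if s = .P ∧ n = 0 then (1 / 16 : ℂ) • (1 : Module.End ℂ (Dirac s)) else 0) := by
    split_ifs
    · exact (Commute.one_right _).smul_right _
    · exact Commute.zero_right _
  conv_lhs => rw [virasoro, Finset.sum_mul, Finset.mul_sum, ← Finset.sum_sub_distrib]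
  conv_rhs => rw [virasoro, Finset.smul_sum]
  refine Finset.sum_congr rfl fun d _ => ?_
  rw [add_mul, mul_add, hc'.eq, smul_add, hc, add_zero, add_sub_add_right_eq_sub]
  exact key d

end Dirac

namespace Dirac

variable {s : Sector}

/-! ### Filled seas of fermions -/

/-- A Fermi sea of level `t`: the modes of `charged s ε χ` from the index `t` on kill `v`, and so do
the conjugates of its other modes, which are modes of `charged s (-ε) χ`. -/
structure IsSea (s : Sector) (ε : ℂ) (χ : Chirality) (t : ℤ) (v : Dirac s) : Prop where
  pos : ∀ k, t ≤ k → charged s ε χ k v = 0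
  neg : ∀ k, 1 - t - s.shift ≤ k → charged s (-ε) χ k v = 0

namespace IsSea

variable {ε : ℂ} {χ : Chirality} {t : ℤ} {v : Dirac s}

/-- Exchanging the roles of the two charges. -/
lemma symm (h : IsSea s ε χ t v) : IsSea s (-ε) χ (1 - t - s.shift) v where
  pos := h.neg
  neg k hk := by
    rw [neg_neg]
    exact h.pos k (by omega)

/-- The conjugate of the mode `t` of the field raises the level of the sea. -/
lemma step (hε : ε * ε = 1) (h : IsSea s ε χ t v) :
    IsSea s ε χ (t + 1) (charged s (-ε) χ (-t - s.shift) v) where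
  pos k hk := by
    rw [← Module.End.mul_apply, charged_anti (by omega), LinearMap.neg_apply,
      Module.End.mul_apply, h.pos k (by omega), map_zero, neg_zero]
  neg k hk := by
    have h1 := LinearMap.congr_fun
      (charged_anti_same (s := s) (ε := -ε) (by rw [neg_mul_neg, hε]) χ k (-t - s.shift)) v
    rw [LinearMap.neg_apply, Module.End.mul_apply, Module.End.mul_apply] at h1
    rcases hk.eq_or_lt with rfl | hk'
    · rw [show 1 - (t + 1) - s.shift = -t - s.shift by ring] at h1 ⊢
      rw [eq_neg_iff_add_eq_zero, ← two_smul ℂ] at h1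
      exact (smul_eq_zero.1 h1).resolve_left two_ne_zero
    · rw [h1, h.neg k (by omega), map_zero, neg_zero]

/-- Conjugate modes undo each other, up to the normalization of the charged fields. -/
lemma step_inv (hε : ε * ε = 1) (h : IsSea s ε χ t v) :
    charged s ε χ t (charged s (-ε) χ (-t - s.shift) v) = (2 : ℂ) • v := by
  have h1 := LinearMap.congr_fun (charged_car (s := s) ε (-ε) χ χ t (-t - s.shift)) v
  rw [LinearMap.add_apply, Module.End.mul_apply, Module.End.mul_apply, h.pos t le_rfl, map_zero,
    add_zero, if_pos ⟨rfl, by omega⟩, mul_neg, hε, sub_neg_eq_add, one_add_one_eq_two] at h1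
  exact h1

/-- Modes of the other chirality do not affect the sea. -/
lemma of_ne (h : IsSea s ε χ t v) {χ' : Chirality} (hχ : χ ≠ χ') (ε' : ℂ) (l : ℤ) :
    IsSea s ε χ t (charged s ε' χ' l v) where
  pos k hk := by
    rw [← Module.End.mul_apply, charged_anti (fun h => hχ h.1), LinearMap.neg_apply,
      Module.End.mul_apply, h.pos k hk, map_zero, neg_zero]
  neg k hk := by
    rw [← Module.End.mul_apply, charged_anti (fun h => hχ h.1), LinearMap.neg_apply,
      Module.End.mul_apply, h.neg k hk, map_zero, neg_zero]

/-- A sea is killed by the positive modes of the current. -/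
lemma current_pos (hε : ε * ε = 1) (h : IsSea s ε χ t v) {n : ℤ} (hn : 0 < n) :
    current s χ n v = 0 := by
  rw [(current_eq_charged hε χ hn.ne').2, LinearMap.smul_apply, sumEnd_apply_eq_zero, smul_zero]
  intro k
  by_cases hk : 1 - t - s.shift ≤ k
  · rw [Module.End.mul_apply, h.neg k hk, map_zero]
  · rw [charged_anti (by omega), LinearMap.neg_apply, Module.End.mul_apply, h.pos _ (by omega),
      map_zero, neg_zero]

/-- A negative mode of the current lifts one fermion out of the sea.  Only finitely many terms of
the bilinear survive, those in which neither factor kills the sea. -/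
lemma current_neg (hε : ε * ε = 1) (h : IsSea s ε χ t v) {m : ℕ} (hm : 0 < m) :
    current s χ (-m) v = (ε / 2) • ∑ j ∈ Finset.range m,
      charged s ε χ (t - 1 - j) (charged s (-ε) χ (-s.shift - t - (m - 1 - j)) v) := by
  obtain ⟨hf, hJ⟩ := current_eq_charged (s := s) hε χ (n := -m) (by omega)
  have hinj : Function.Injective fun j : ℕ => -s.shift - t - ((m : ℤ) - 1 - j) := by
    intro j j' hj
    have : -s.shift - t - ((m : ℤ) - 1 - j) = -s.shift - t - ((m : ℤ) - 1 - j') := hj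
    omega
  rw [hJ, LinearMap.smul_apply, sumEnd_apply hf, finsum_eq_sum_of_support_subset
    (s := (Finset.range m).image fun j : ℕ => -s.shift - t - ((m : ℤ) - 1 - j)),
    Finset.sum_image hinj.injOn]
  · congr 1
    refine Finset.sum_congr rfl fun j _ => ?_
    rw [Module.End.mul_apply]
    congr 2
    ring
  · intro k hk
    rw [Function.mem_support] at hk
    by_contra hk'
    apply hk
    by_cases h1 : 1 - t - s.shift ≤ k
    · rw [Module.End.mul_apply, h.neg k h1, map_zero]
    · rw [charged_anti (by omega), LinearMap.neg_apply, Module.End.mul_apply, h.pos, map_zero,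
        neg_zero]
      by_contra h2
      refine hk' ?_
      rw [Finset.mem_coe, Finset.mem_image]
      refine ⟨(k + s.shift + t + m - 1).toNat, ?_, ?_⟩
      · rw [Finset.mem_range]
        omega
      · rw [Int.toNat_of_nonneg (by omega)]
        ring

/-- The recursion `∑_{i<m} a (i - m) ψ (t - 1 - i) |t⟩ = ε m ψ (t - 1 - m) |t⟩`.  The terms in which
the current acts on the sea cancel, because they are sums of products of two modes of `ψ` over a
symmetric set of indices. -/
lemma sum_current_charged (hε : ε * ε = 1) (h : IsSea s ε χ t v) (m : ℕ) :
    ∑ i ∈ Finset.range m, current s χ (i - m) (charged s ε χ (t - 1 - i) v) =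
      (ε * m) • charged s ε χ (t - 1 - m) v := by
  let g : ℕ → ℕ → Dirac s := fun i j => charged s ε χ (t - 1 - i) (charged s ε χ (t - 1 - j)
    (charged s (-ε) χ (-s.shift - t - (m - i - 1 - j)) v))
  have hg : ∀ i j, g i j = -g j i := by
    intro i j
    have h1 := LinearMap.congr_fun (charged_anti_same (s := s) hε χ (t - 1 - i) (t - 1 - j))
      (charged s (-ε) χ (-s.shift - t - (m - i - 1 - j)) v)
    rw [LinearMap.neg_apply, Module.End.mul_apply, Module.End.mul_apply] at h1
    refine h1.trans ?_
    change _ = -(charged s ε χ (t - 1 - j) (charged s ε χ (t - 1 - i)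
      (charged s (-ε) χ (-s.shift - t - (m - j - 1 - i)) v)))
    rw [show (m : ℤ) - i - 1 - j = m - j - 1 - i by ring]
  -- The terms with the current on the sea: a sum of the antisymmetric `g` over a symmetric set.
  have hS : ∑ i ∈ Finset.range m, ∑ j ∈ Finset.range (m - i), g i j = 0 := by
    have h1 : ∑ i ∈ Finset.range m, ∑ j ∈ Finset.range (m - i), g i j =
        -∑ i ∈ Finset.range m, ∑ j ∈ Finset.range (m - i), g i j := by
      conv_lhs => rw [Finset.sum_comm' (t' := Finset.range m)
        (s' := fun j => Finset.range (m - j)) (by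
          intro i j
          simp only [Finset.mem_range]
          omega)]
      rw [← Finset.sum_neg_distrib]
      refine Finset.sum_congr rfl fun i _ => ?_
      rw [← Finset.sum_neg_distrib]
      exact Finset.sum_congr rfl fun j _ => hg j i
    rw [eq_neg_iff_add_eq_zero, ← two_smul ℂ] at h1
    exact (smul_eq_zero.1 h1).resolve_left two_ne_zero
  have hterm : ∀ i ∈ Finset.range m, current s χ (i - m) (charged s ε χ (t - 1 - i) v) =
      (ε / 2) • ∑ j ∈ Finset.range (m - i), g i j + ε • charged s ε χ (t - 1 - m) v := by
    intro i hi
    rw [Finset.mem_range] at hi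
    have h1 := LinearMap.congr_fun (current_charged (s := s) hε χ χ (i - m) (t - 1 - i)) v
    rw [if_pos rfl, LinearMap.add_apply, Module.End.mul_apply, Module.End.mul_apply,
      show (i : ℤ) - m + (t - 1 - i) = t - 1 - m by ring] at h1
    rw [h1, LinearMap.smul_apply]
    congr 1
    have h2 := h.current_neg hε (m := m - i) (by omega)
    rw [Nat.cast_sub hi.le, neg_sub] at h2
    rw [h2, map_smul, map_sum]
  rw [Finset.sum_congr rfl hterm, Finset.sum_add_distrib, ← Finset.smul_sum, hS, smul_zero,
    zero_add, Finset.sum_const, Finset.card_range, ← Nat.cast_smul_eq_nsmul ℂ, smul_smul,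
    mul_comm]

/-- A subspace that is stable under the current and contains `ψ (t - 1) |t⟩` contains `ψ k |t⟩` for
all `k`. -/
lemma charged_mem (hε : ε * ε = 1) (h : IsSea s ε χ t v) {N : Submodule ℂ (Dirac s)}
    (hN : ∀ n, ∀ x ∈ N, current s χ n x ∈ N) (h0 : charged s ε χ (t - 1) v ∈ N) (k : ℤ) :
    charged s ε χ k v ∈ N := by
  have key : ∀ m : ℕ, charged s ε χ (t - 1 - m) v ∈ N := by
    intro m
    induction m using Nat.strong_induction_on with
    | _ m ih =>
      rcases Nat.eq_zero_or_pos m with rfl | hm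
      · rwa [Nat.cast_zero, sub_zero]
      · have hne : ε * (m : ℂ) ≠ 0 := mul_ne_zero (fun h0 => by simp [h0] at hε)
          (by exact_mod_cast hm.ne')
        rw [← Submodule.smul_mem_iff N hne, ← h.sum_current_charged hε m]
        exact N.sum_mem fun i hi => hN _ _ (ih i (Finset.mem_range.1 hi))
  by_cases hk : t ≤ k
  · rw [h.pos k hk]
    exact N.zero_mem
  · have := key (t - 1 - k).toNat
    rwa [Int.toNat_of_nonneg (by omega), show t - 1 - (t - 1 - k) = k by ring] at this

end IsSea

/-! ### Moving the level of a sea -/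

/-- The operator that moves the sea of chirality `χ` from level `0` to level `t`: a product of `|t|`
consecutive modes of the field of charge `-1` (for `t > 0`) or `1` (for `t < 0`). -/
def fill (s : Sector) (χ : Chirality) : ℤ → Module.End ℂ (Dirac s)
  | Int.ofNat n => n.rec 1 fun n F => charged s (-1) χ (-n - s.shift) * F
  | Int.negSucc n => n.rec (charged s 1 χ (-1)) fun n F => charged s 1 χ (-(n + 2)) * F

lemma fill_zero (χ : Chirality) : fill s χ 0 = 1 := rfl

lemma fill_add_one (χ : Chirality) {t : ℤ} (ht : 0 ≤ t) :
    fill s χ (t + 1) = charged s (-1) χ (-t - s.shift) * fill s χ t := by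
  obtain ⟨n, rfl⟩ := Int.eq_ofNat_of_zero_le ht
  rfl

lemma fill_sub_one (χ : Chirality) {t : ℤ} (ht : t ≤ 0) :
    fill s χ (t - 1) = charged s 1 χ (t - 1) * fill s χ t := by
  obtain ⟨n, hn⟩ := Int.eq_ofNat_of_zero_le (show 0 ≤ -t by omega)
  rcases n with _ | n
  · obtain rfl : t = 0 := by simpa using hn
    exact (mul_one _).symm
  · obtain rfl : t = Int.negSucc n := by omega
    rw [show Int.negSucc n - 1 = Int.negSucc (n + 1) by omega]
    rfl

/-- The sign `(-1) ^ t`. -/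
def levelSign (t : ℤ) : ℂ := if Even t then 1 else -1

lemma levelSign_add_one (t : ℤ) : levelSign (t + 1) = -levelSign t := by
  by_cases h : Even t <;> simp [levelSign, h]

lemma levelSign_sub_one (t : ℤ) : levelSign (t - 1) = -levelSign t := by
  have := levelSign_add_one (t - 1)
  rw [sub_add_cancel] at this
  rw [this, neg_neg]

/-- An operator that anticommutes with the charged fields of a chirality commutes with `fill` up to
a sign. -/
lemma mul_fill_of_anti {A : Module.End ℂ (Dirac s)} {χ : Chirality}
    (hA : ∀ ε k, A * charged s ε χ k = -(charged s ε χ k * A)) (t : ℤ) :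
    A * fill s χ t = levelSign t • (fill s χ t * A) := by
  have hstep : ∀ (X F : Module.End ℂ (Dirac s)) (c : ℂ), A * X = -(X * A) →
      A * F = c • (F * A) → A * (X * F) = (-c) • (X * F * A) := by
    intro X F c hX hF
    rw [← mul_assoc, hX, neg_mul, mul_assoc, hF, mul_smul_comm, neg_smul, mul_assoc]
  induction t using Int.induction_on with
  | zero => simp [fill_zero, levelSign]
  | succ n ih =>
    rw [fill_add_one χ (by omega), levelSign_add_one]
    exact hstep _ _ _ (hA _ _) ih
  | pred n ih =>
    rw [fill_sub_one χ (by omega), levelSign_sub_one]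
    exact hstep _ _ _ (hA _ _) ih

/-- If the charged fields are eigenvectors of the commutator with `A`, then so is `fill`. -/
lemma mul_fill_of_eigen {A : Module.End ℂ (Dirac s)} {χ : Chirality} {e c : ℤ → ℂ}
    {c' : ℤ → ℂ} (hpos : ∀ k, A * charged s 1 χ k - charged s 1 χ k * A = c k • charged s 1 χ k)
    (hneg : ∀ k, A * charged s (-1) χ k - charged s (-1) χ k * A = c' k • charged s (-1) χ k)
    (h0 : e 0 = 0) (hadd : ∀ t, e (t + 1) = e t + c' (-t - s.shift))
    (hsub : ∀ t, e (t - 1) = e t + c (t - 1)) (t : ℤ) :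
    A * fill s χ t = fill s χ t * A + e t • fill s χ t := by
  have hstep : ∀ (X F : Module.End ℂ (Dirac s)) (a b : ℂ), A * X - X * A = a • X →
      A * F = F * A + b • F → A * (X * F) = X * F * A + (b + a) • (X * F) := by
    intro X F a b hX hF
    rw [← mul_assoc, eq_add_of_sub_eq hX, add_mul, mul_assoc X A, hF, mul_add, mul_smul_comm,
      smul_mul_assoc, mul_assoc]
    module
  induction t using Int.induction_on with
  | zero => simp [fill_zero, h0]
  | succ n ih =>
    rw [fill_add_one χ (by omega), hadd]
    exact hstep _ _ _ _ (hneg _) ih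
  | pred n ih =>
    rw [fill_sub_one χ (by omega), hsub]
    exact hstep _ _ _ _ (hpos _) ih

section Fill

variable {χ : Chirality} {v : Dirac s}

lemma isSea_fill (h : IsSea s 1 χ 0 v) (t : ℤ) : IsSea s 1 χ t (fill s χ t v) := by
  induction t using Int.induction_on with
  | zero => rwa [fill_zero]
  | succ n ih =>
    rw [fill_add_one χ (by omega)]
    exact ih.step (one_mul 1)
  | pred n ih =>
    rw [fill_sub_one χ (by omega)]
    have h1 := (ih.symm.step (by norm_num)).symm
    rw [neg_neg, show 1 - (1 - (-(n : ℤ)) - s.shift + 1) - s.shift = -(n : ℤ) - 1 by ring,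
      show -(1 - -(n : ℤ) - s.shift) - s.shift = -(n : ℤ) - 1 by ring] at h1
    exact h1

/-- The highest mode of charge `1` that does not kill a sea lowers its level. -/
lemma charged_fill (h : IsSea s 1 χ 0 v) (t : ℤ) :
    ∃ c : ℂ, charged s 1 χ (t - 1) (fill s χ t v) = c • fill s χ (t - 1) v := by
  rcases le_or_gt t 0 with ht | ht
  · exact ⟨1, by rw [fill_sub_one χ ht, one_smul, Module.End.mul_apply]⟩
  · refine ⟨2, ?_⟩
    rw [← (isSea_fill h (t - 1)).step_inv (one_mul 1)]
    have := fill_add_one (s := s) χ (t := t - 1) (by omega)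
    rw [sub_add_cancel] at this
    rw [this, Module.End.mul_apply]

/-- The highest mode of charge `-1` that does not kill a sea raises its level. -/
lemma charged_neg_fill (h : IsSea s 1 χ 0 v) (t : ℤ) :
    ∃ c : ℂ, charged s (-1) χ (-t - s.shift) (fill s χ t v) = c • fill s χ (t + 1) v := by
  rcases le_or_gt 0 t with ht | ht
  · exact ⟨1, by rw [fill_add_one χ ht, one_smul, Module.End.mul_apply]⟩
  · refine ⟨2, ?_⟩
    rw [← (isSea_fill h (t + 1)).symm.step_inv (by norm_num)]
    have := fill_sub_one (s := s) χ (t := t + 1) (by omega)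
    rw [add_sub_cancel_right] at this
    rw [this, Module.End.mul_apply, neg_neg,
      show -(1 - (t + 1) - s.shift) - s.shift = t by ring,
      show 1 - (t + 1) - s.shift = -t - s.shift by ring]

lemma fill_ne_zero (h : IsSea s 1 χ 0 v) (hv : v ≠ 0) (t : ℤ) : fill s χ t v ≠ 0 := by
  induction t using Int.induction_on with
  | zero => rwa [fill_zero]
  | succ n ih =>
    intro h0
    have h1 := (isSea_fill h n).step_inv (one_mul 1)
    rw [← Module.End.mul_apply (charged s (-1) χ _), ← fill_add_one χ (by omega), h0, map_zero]
      at h1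
    exact ih ((smul_eq_zero.1 h1.symm).resolve_left two_ne_zero)
  | pred n ih =>
    intro h0
    have h1 := (isSea_fill h (-n)).symm.step_inv (by norm_num)
    rw [neg_neg, show -(1 - -(n : ℤ) - s.shift) - s.shift = -(n : ℤ) - 1 by ring,
      ← Module.End.mul_apply (charged s 1 χ _), ← fill_sub_one χ (by omega), h0, map_zero] at h1
    exact ih ((smul_eq_zero.1 h1.symm).resolve_left two_ne_zero)

end Fill

end Dirac

namespace Dirac

variable {s : Sector}

/-! ### The ground state -/

/-- A ground state: an even cyclic vector that is killed by the modes of positive number and, in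
the sector `P`, by the zero modes of charge `1`. -/
structure IsGround (s : Sector) (v : Dirac s) : Prop where
  ne_zero : v ≠ 0
  pos : ∀ i k, 0 < k + s.shift → mode s i k v = 0
  charged_eq_zero : ∀ χ k, 0 ≤ k → charged s 1 χ k v = 0
  even : parity s v = v
  cyclic : ∀ N : Submodule ℂ (Dirac s), v ∈ N → (∀ i k, ∀ x ∈ N, mode s i k x ∈ N) → N = ⊤

/-- The charge of the sea of level `t`. -/
def charge (s : Sector) (t : ℤ) : ℝ := (1 - s.shift) / 2 - t

namespace IsGround

variable {v : Dirac s}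

lemma isSea (hv : IsGround s v) (χ : Chirality) : IsSea s 1 χ 0 v where
  pos := hv.charged_eq_zero χ
  neg k hk := by
    rw [Dirac.charged, LinearMap.add_apply, LinearMap.smul_apply, hv.pos _ k (by omega),
      hv.pos _ k (by omega), smul_zero, add_zero]

lemma current_zero (hv : IsGround s v) (χ : Chirality) :
    current s χ 0 v = (charge s 0 : ℂ) • v := by
  have hB := isFermionFamily s
  rw [current_eq, LinearMap.smul_apply, bilinear,
    sumEnd_apply (hB.locallyFinite (by simp) 0)]
  -- Only the product of the two zero modes, in the sector `P`, does not kill the ground state.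
  have hkill : ∀ k, k ≠ 0 ∨ s.shift = 1 →
      (mode s (χ, 0) (0 - k - s.shift) * mode s (χ, 1) k) v = 0 := by
    intro k hk
    by_cases h : 0 < k + s.shift
    · rw [Module.End.mul_apply, hv.pos _ k h, map_zero]
    · have hs : s.shift = 0 ∨ s.shift = 1 := by rcases s with _ | _ <;> simp [Sector.shift]
      rw [hB.anti (by simp), LinearMap.neg_apply, Module.End.mul_apply,
        hv.pos _ (0 - k - s.shift) (by omega), map_zero, neg_zero]
  rcases s with _ | _
  · rw [finsum_congr fun k => hkill k (Or.inr rfl), finsum_zero, smul_zero]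
    simp [charge, Sector.shift]
  · rw [finsum_eq_single _ 0 fun k hk => hkill k (Or.inl hk)]
    have h0 : Sector.shift .P = 0 := rfl
    rw [h0, sub_zero, sub_zero, hB.anti (by simp), LinearMap.neg_apply, Module.End.mul_apply]
    have h1 := hv.charged_eq_zero χ 0 le_rfl
    rw [Dirac.charged, LinearMap.add_apply, LinearMap.smul_apply] at h1
    have h2 : mode .P (χ, 1) 0 (mode .P (χ, 1) 0 v) = (1 / 2 : ℂ) • v := by
      have h3 := LinearMap.congr_fun (hB.car (χ, 1) (χ, 1) 0 0) v
      rw [if_pos ⟨rfl, rfl⟩, LinearMap.add_apply, Module.End.mul_apply, ← two_smul ℂ,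
        Module.End.one_apply] at h3
      conv_rhs => rw [← h3]
      rw [smul_smul]
      norm_num
    rw [eq_neg_of_add_eq_zero_left h1, map_neg, map_smul, h2, neg_neg, smul_smul, smul_smul]
    congr 1
    rw [show -(Complex.I * χ.sign) * (Complex.I * (1 * χ.sign)) =
      -(Complex.I * Complex.I) * (χ.sign * χ.sign) by ring, χ.sign_mul_self, Complex.I_mul_I]
    simp [charge, h0]

lemma virasoro_zero (hv : IsGround s v) (χ : Chirality) :
    virasoro s χ 0 v = ((charge s 0 : ℂ) ^ 2 / 2) • v := by
  have hB := isFermionFamily s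
  have h1 : ∀ c : Fin 2, sumEnd (fun k => ((s.modeNumber k / 2 + 1 / 4 : ℚ) : ℂ) •
      normalOrder (mode s (χ, c)) (0 - k - s.shift) k) v = 0 := by
    intro c
    refine sumEnd_apply_eq_zero fun k => ?_
    rw [LinearMap.smul_apply, normalOrder]
    have hs : s.shift = 0 ∨ s.shift = 1 := by rcases s with _ | _ <;> simp [Sector.shift]
    split_ifs
    · rw [Module.End.mul_apply, hv.pos _ k (by omega), map_zero, smul_zero]
    · rw [LinearMap.neg_apply, Module.End.mul_apply, hv.pos _ (0 - k - s.shift) (by omega),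
        map_zero, neg_zero, smul_zero]
    · rw [LinearMap.zero_apply, smul_zero]
  rw [virasoro, Fin.sum_univ_two]
  simp only [LinearMap.add_apply]
  rw [h1, h1, zero_add]
  rcases s with _ | _
  · simp [charge, Sector.shift]
  · rw [if_pos (by simp), LinearMap.smul_apply, Module.End.one_apply, ← add_smul]
    congr 1
    simp [charge, Sector.shift]
    norm_num

end IsGround

/-- The sea with level `t .left` of the left movers and `t .right` of the right movers. -/
def sea (v : Dirac s) (t : Chirality → ℤ) : Dirac s :=
  fill s .left (t .left) (fill s .right (t .right) v)

section Sea

variable {v : Dirac s}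

lemma isSea_fill_of_ne {χ χ' : Chirality} (h : χ ≠ χ') {u : Dirac s} {r : ℤ}
    (hu : IsSea s 1 χ r u) (t : ℤ) : IsSea s 1 χ r (fill s χ' t u) := by
  induction t using Int.induction_on with
  | zero => exact hu
  | succ n ih =>
    rw [fill_add_one χ' (by omega)]
    exact ih.of_ne h _ _
  | pred n ih =>
    rw [fill_sub_one χ' (by omega)]
    exact ih.of_ne h _ _

lemma IsGround.isSea_sea (hv : IsGround s v) (t : Chirality → ℤ) (χ : Chirality) :
    IsSea s 1 χ (t χ) (sea v t) := by
  rcases χ with _ | _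
  · exact isSea_fill (isSea_fill_of_ne (by simp) (hv.isSea .left) _) _
  · exact isSea_fill_of_ne (by simp) (isSea_fill (hv.isSea .right) _) _

lemma IsGround.sea_ne_zero (hv : IsGround s v) (t : Chirality → ℤ) : sea v t ≠ 0 :=
  fill_ne_zero (isSea_fill_of_ne (by simp) (hv.isSea .left) _)
    (fill_ne_zero (hv.isSea .right) hv.ne_zero _) _

lemma IsGround.parity_sea (hv : IsGround s v) (t : Chirality → ℤ) :
    parity s (sea v t) = (levelSign (t .left) * levelSign (t .right)) • sea v t := by
  have h : ∀ χ ε k, parity s * charged s ε χ k = -(charged s ε χ k * parity s) := fun χ ε k =>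
    LinearMap.ext fun x => parity_charged ε χ k x
  rw [sea, ← Module.End.mul_apply, mul_fill_of_anti (h .left), LinearMap.smul_apply,
    Module.End.mul_apply, ← Module.End.mul_apply (parity s), mul_fill_of_anti (h .right),
    LinearMap.smul_apply, Module.End.mul_apply, hv.even, map_smul, smul_smul]

/-- The eigenvalue on a sea of an operator for which `fill` is an eigenvector of the commutator. -/
lemma eigen_sea {A : Module.End ℂ (Dirac s)} {a : ℂ} {e : Chirality → ℤ → ℂ} (h0 : A v = a • v)
    (hA : ∀ χ t, A * fill s χ t = fill s χ t * A + e χ t • fill s χ t) (t : Chirality → ℤ) :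
    A (sea v t) = (a + e .left (t .left) + e .right (t .right)) • sea v t := by
  rw [sea, ← Module.End.mul_apply, hA, LinearMap.add_apply, LinearMap.smul_apply,
    Module.End.mul_apply, ← Module.End.mul_apply A, hA, LinearMap.add_apply, LinearMap.smul_apply,
    Module.End.mul_apply, h0, map_smul, map_add, map_smul, map_smul]
  module

lemma IsGround.isVacuum_sea (hv : IsGround s v) (t : Chirality → ℤ) :
    IsVacuum (current s) (fun χ => (charge s (t χ) : ℂ)) (sea v t) where
  pos χ n hn := (hv.isSea_sea t χ).current_pos (one_mul 1) hn
  zero χ := by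
    have h : ∀ χ' r, current s χ 0 * fill s χ' r = fill s χ' r * current s χ 0 +
        (if χ = χ' then -(r : ℂ) else 0) • fill s χ' r := fun χ' =>
      mul_fill_of_eigen (e := fun r => if χ = χ' then -(r : ℂ) else 0)
        (c := fun _ => if χ = χ' then 1 else 0) (c' := fun _ => if χ = χ' then -1 else 0)
        (fun k => by
          rw [current_charged (one_mul 1), add_sub_cancel_left]
          split_ifs with h <;> simp [h])
        (fun k => by
          rw [current_charged (by norm_num), add_sub_cancel_left]
          split_ifs with h <;> simp [h])
        (by simp) (fun r => by split_ifs <;> push_cast <;> ring)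
        (fun r => by split_ifs <;> push_cast <;> ring)
    rw [eigen_sea (hv.current_zero χ) h]
    congr 1
    rcases χ with _ | _ <;> simp [charge] <;> ring

lemma IsGround.virasoro_sea (hv : IsGround s v) (t : Chirality → ℤ) (χ : Chirality) :
    virasoro s χ 0 (sea v t) = ((charge s (t χ) : ℂ) ^ 2 / 2) • sea v t := by
  have h : ∀ χ' r, virasoro s χ 0 * fill s χ' r = fill s χ' r * virasoro s χ 0 +
      (if χ = χ' then (r : ℂ) * (r - 1 + s.shift) / 2 else 0) • fill s χ' r := fun χ' =>
    mul_fill_of_eigen (e := fun r => if χ = χ' then (r : ℂ) * (r - 1 + s.shift) / 2 else 0)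
      (c := fun k => if χ = χ' then -(k + s.shift / 2 : ℂ) else 0)
      (c' := fun k => if χ = χ' then -(k + s.shift / 2 : ℂ) else 0)
      (fun k => by
        rw [virasoro_charged]
        split_ifs <;> simp)
      (fun k => by
        rw [virasoro_charged]
        split_ifs <;> simp)
      (by simp) (fun r => by split_ifs <;> push_cast <;> ring)
      (fun r => by split_ifs <;> push_cast <;> ring)
  rw [eigen_sea (hv.virasoro_zero χ) h]
  congr 1
  rcases χ with _ | _ <;> simp [charge] <;> ring

/-- The highest mode of a charged field that does not kill a sea maps it to a multiple of another
sea. -/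
lemma IsGround.exists_charged_sea (hv : IsGround s v) (t : Chirality → ℤ) (χ : Chirality) :
    (∃ (c : ℂ) (t' : Chirality → ℤ), charged s 1 χ (t χ - 1) (sea v t) = c • sea v t') ∧
    ∃ (c : ℂ) (t' : Chirality → ℤ),
      charged s (-1) χ (-t χ - s.shift) (sea v t) = c • sea v t' := by
  rcases χ with _ | _
  · have hu := isSea_fill_of_ne (χ := .left) (χ' := .right) (by simp) (hv.isSea .left) (t .right)
    obtain ⟨c, hc⟩ := charged_fill hu (t .left)
    obtain ⟨c', hc'⟩ := charged_neg_fill hu (t .left)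
    exact ⟨⟨c, fun | .left => t .left - 1 | .right => t .right, hc⟩,
      ⟨c', fun | .left => t .left + 1 | .right => t .right, hc'⟩⟩
  · have hA : ∀ ε' k' r, charged s ε' .right k' * fill s .left r =
        levelSign r • (fill s .left r * charged s ε' .right k') := fun ε' k' r =>
      mul_fill_of_anti (fun ε k => charged_anti (by simp)) r
    obtain ⟨c, hc⟩ := charged_fill (hv.isSea .right) (t .right)
    obtain ⟨c', hc'⟩ := charged_neg_fill (hv.isSea .right) (t .right)
    refine ⟨⟨levelSign (t .left) * c, fun | .left => t .left | .right => t .right - 1, ?_⟩,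
      ⟨levelSign (t .left) * c', fun | .left => t .left | .right => t .right + 1, ?_⟩⟩
    · rw [sea, ← Module.End.mul_apply, hA, LinearMap.smul_apply, Module.End.mul_apply, hc,
        map_smul, smul_smul]
      rfl
    · rw [sea, ← Module.End.mul_apply, hA, LinearMap.smul_apply, Module.End.mul_apply, hc',
        map_smul, smul_smul]
      rfl

/-- The seas generate the space of states under the currents: what they generate is stable under
the fermions. -/
lemma IsGround.generates_sea (hv : IsGround s v) :
    Generates (current s) (Set.range (sea v)) := by
  intro N hseas hN
  -- The subspace that the currents generate from the seas.
  let G : Submodule ℂ (Dirac s) := sInf {N | Set.range (sea v) ⊆ N ∧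
    ∀ χ n, ∀ x ∈ N, current s χ n x ∈ N}
  have hGN : G ≤ N := sInf_le ⟨hseas, hN⟩
  have hGsea : ∀ t, sea v t ∈ G := fun t =>
    (Submodule.mem_sInf).2 fun N' hN' => hN'.1 ⟨t, rfl⟩
  have hGJ : ∀ χ n, ∀ x ∈ G, current s χ n x ∈ G := fun χ n x hx =>
    (Submodule.mem_sInf).2 fun N' hN' => hN'.2 χ n x ((Submodule.mem_sInf).1 hx N' hN')
  have hGc : ∀ ε : ℂ, (ε = 1 ∨ ε = -1) → ∀ χ k, ∀ x ∈ G, charged s ε χ k x ∈ G := by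
    intro ε hε
    have hε' : ε * ε = 1 := by rcases hε with rfl | rfl <;> norm_num
    -- The vectors which all modes of the field map into `G` form a subspace that is stable under
    -- the currents.
    let G' : Submodule ℂ (Dirac s) := G ⊓ ⨅ χ, ⨅ k, G.comap (charged s ε χ k)
    have hG' : ∀ x, x ∈ G' ↔ x ∈ G ∧ ∀ χ k, charged s ε χ k x ∈ G := fun x => by
      simp [G', Submodule.mem_iInf]
    suffices h : G ≤ G' from fun χ k x hx => ((hG' x).1 (h hx)).2 χ k
    refine sInf_le ⟨?_, fun χ n x hx => ?_⟩
    · rintro _ ⟨t, rfl⟩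
      refine (hG' _).2 ⟨hGsea t, fun χ k => ?_⟩
      obtain ⟨⟨c, t', h1⟩, ⟨c', t'', h2⟩⟩ := hv.exists_charged_sea t χ
      rcases hε with rfl | rfl
      · refine (hv.isSea_sea t χ).charged_mem (one_mul 1) (hGJ χ) ?_ k
        rw [h1]
        exact G.smul_mem _ (hGsea _)
      · refine (hv.isSea_sea t χ).symm.charged_mem hε' (hGJ χ) ?_ k
        rw [show 1 - t χ - s.shift - 1 = -t χ - s.shift by ring, h2]
        exact G.smul_mem _ (hGsea _)
    · rw [hG'] at hx ⊢
      refine ⟨hGJ χ n x hx.1, fun χ' k => ?_⟩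
      have h1 := LinearMap.congr_fun (current_charged (s := s) hε' χ χ' n k) x
      rw [LinearMap.add_apply, Module.End.mul_apply, Module.End.mul_apply] at h1
      rw [← sub_eq_of_eq_add h1]
      refine G.sub_mem (hGJ χ n _ (hx.2 χ' k)) ?_
      split_ifs
      · exact G.smul_mem _ (hx.2 χ _)
      · exact G.zero_mem
  have hGm : ∀ i k, ∀ x ∈ G, mode s i k x ∈ G := by
    rintro ⟨χ, c⟩ k x hx
    have h1 := hGc 1 (Or.inl rfl) χ k x hx
    have h2 := hGc (-1) (Or.inr rfl) χ k x hx
    fin_cases c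
    · change mode s (χ, 0) k x ∈ G
      rw [mode_zero_eq 1]
      exact G.smul_mem _ (G.add_mem h1 h2)
    · change mode s (χ, 1) k x ∈ G
      rw [mode_one_eq (one_mul 1)]
      exact G.smul_mem _ (G.sub_mem h1 h2)
  have hv0 : v ∈ G := hGsea fun _ => 0
  exact top_unique (hv.cyclic G hv0 hGm ▸ hGN)

/-- The Virasoro operators of the fermions are the Sugawara operators of the currents.  Both have
the same commutators with the currents, so their difference `D n` commutes with the currents.
Hence `D 0`, which kills the seas, is zero; and `n • D n = -[L 0, D n]` vanishes, because `L 0` is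
now known to be a series in the currents. -/
lemma IsGround.virasoro_eq_sug (hv : IsGround s v) (χ : Chirality) (n : ℤ) :
    virasoro s χ n = sug (current s) χ n := by
  have hJ := heisRelations s
  have hs := isSmooth_current (s := s)
  have hD : ∀ n χ' m, Commute (virasoro s χ n - sug (current s) χ n) (current s χ' m) := by
    intro n χ' m
    have h1 := virasoro_current (s := s) χ χ' n m
    have h2 := sug_commutator hJ hs χ χ' n m
    change _ * _ = _ * _
    rw [sub_mul, mul_sub, ← sub_eq_zero]
    rw [← h2] at h1
    rw [← sub_eq_zero.2 h1]
    abel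
  have h0 : virasoro s χ 0 = sug (current s) χ 0 := by
    have hker : LinearMap.ker (virasoro s χ 0 - sug (current s) χ 0) = ⊤ := by
      refine hv.generates_sea _ ?_ fun χ' m x hx => ?_
      · rintro _ ⟨t, rfl⟩
        rw [SetLike.mem_coe, LinearMap.mem_ker, LinearMap.sub_apply, hv.virasoro_sea,
          (hv.isVacuum_sea t).sug_zero hs, sub_self]
      · rw [LinearMap.mem_ker] at hx ⊢
        rw [← Module.End.mul_apply, (hD 0 χ' m).eq, Module.End.mul_apply, hx, map_zero]
    rw [← sub_eq_zero]
    exact LinearMap.ker_eq_top.1 hker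
  by_cases hn : n = 0
  · rw [hn, h0]
  · have h1 := (commute_sug (hD n) χ 0).eq
    have hsug : sug (current s) χ n * sug (current s) χ 0 -
        sug (current s) χ 0 * sug (current s) χ n = (n : ℂ) • sug (current s) χ n := by
      have hm : ∀ k, current s χ k * sug (current s) χ 0 = sug (current s) χ 0 * current s χ k +
          (k : ℂ) • current s χ k := fun k => by
        have h2 := sug_commutator hJ hs χ χ 0 k
        rw [if_pos rfl, zero_add] at h2
        rw [eq_add_of_sub_eq h2]
        module
      have hmm : ∀ k l, k + l = n →
          current s χ k * current s χ l * sug (current s) χ 0 -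
            sug (current s) χ 0 * (current s χ k * current s χ l) =
          (n : ℂ) • (current s χ k * current s χ l) := by
        rintro k l rfl
        rw [mul_assoc, hm, mul_add, ← mul_assoc, hm, add_mul, mul_smul_comm, smul_mul_assoc,
          mul_assoc]
        push_cast
        module
      have hf := hs.locallyFinite χ n
      conv_lhs => rw [show sug (current s) χ n = (1 / 2 : ℂ) • sumEnd fun k =>
        normalProduct (current s χ) (n - k) k from rfl, smul_mul_assoc, mul_smul_comm, ← smul_sub]
      rw [sumEnd_commutator hf (h := fun k => (n : ℂ) •
        normalProduct (current s χ) (n - k) k), sumEnd_smul hf, sug, smul_comm]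
      intro k
      rw [normalProduct]
      split_ifs
      · exact hmm _ _ (by ring)
      · exact hmm _ _ (by ring)
    have h2 := virasoro_zero_virasoro (s := s) χ n
    have h3 : (n : ℂ) • (virasoro s χ n - sug (current s) χ n) = 0 := by
      rw [smul_sub, ← h2, ← hsug, h0, sub_sub_sub_comm, ← sub_mul, ← mul_sub, sub_eq_zero]
      exact h1
    exact sub_eq_zero.1 ((smul_eq_zero.1 h3).resolve_left (by exact_mod_cast hn))

end Sea
end Dirac

namespace Dirac

/-! ### Existence of the ground states -/

/-- The elementary tensors of the space of states of the Dirac fermion. -/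
def tensor {s : Sector} (x y : Majorana s) : Dirac s := (x ⊗ₜ[ℂ] y : Majorana s ⊗[ℂ] Majorana s)

lemma tmul_tensor {s : Sector} (f g : Module.End ℂ (Majorana s)) (x y : Majorana s) :
    tmul f g (tensor x y) = tensor (f x) (g y) := rfl

lemma parity_one {I : Type} : fermionParity (1 : ExteriorAlgebra ℂ (I →₀ ℂ)) = 1 :=
  map_one (CliffordAlgebra.involute (Q := (0 : QuadraticForm ℂ (I →₀ ℂ))))

/-- A subspace that contains the vacuum and is stable under the creation operators is everything. -/
lemma eq_top_of_create {s : Sector} (N : Submodule ℂ (Dirac s)) (h1 : tensor 1 1 ∈ N)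
    (hl : ∀ i, ∀ x ∈ N, tmul (create i) 1 x ∈ N)
    (hr : ∀ i, ∀ x ∈ N, tmul fermionParity (create i) x ∈ N) : N = ⊤ := by
  let T : Majorana s →ₗ[ℂ] Majorana s →ₗ[ℂ] Dirac s := TensorProduct.mk ℂ (Majorana s) (Majorana s)
  have hι : ∀ (P : Submodule ℂ (Majorana s)) (x : Majorana s),
      (∀ i, create i x ∈ P) → ∀ m, ExteriorAlgebra.ι ℂ m * x ∈ P := by
    intro P x hx m
    induction m using Finsupp.induction_linear with
    | zero => simp
    | add m m' hm hm' =>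
      rw [map_add, add_mul]
      exact P.add_mem hm hm'
    | single i c =>
      rw [← mul_one c, ← smul_eq_mul c 1, ← Finsupp.smul_single, map_smul, smul_mul_assoc]
      exact P.smul_mem _ (hx i)
  have hy : ∀ y, T 1 y ∈ N := by
    intro y
    induction y using CliffordAlgebra.left_induction with
    | algebraMap r =>
      rw [Algebra.algebraMap_eq_smul_one, map_smul]
      exact N.smul_mem _ h1
    | add x y hx hy =>
      rw [map_add]
      exact N.add_mem hx hy
    | ι_mul y m hy =>
      refine hι (N.comap (T 1)) y (fun i => ?_) m
      have h2 : tmul fermionParity (create i) (T 1 y) = T (fermionParity 1) (create i y) := rfl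
      have h4 := hr i _ hy
      rw [h2, parity_one] at h4
      exact h4
  have hxy : ∀ x y, T x y ∈ N := by
    intro x y
    induction x using CliffordAlgebra.left_induction with
    | algebraMap r =>
      rw [Algebra.algebraMap_eq_smul_one, map_smul]
      exact N.smul_mem _ (hy y)
    | add x x' hx hx' =>
      rw [map_add]
      exact N.add_mem hx hx'
    | ι_mul x m hx => exact hι (N.comap (T.flip y)) x (fun i => hl i _ hx) m
  refine eq_top_iff.2 fun v _ => ?_
  induction v using TensorProduct.induction_on with
  | zero => exact N.zero_mem
  | tmul x y => exact hxy x y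
  | add x y hx hy => exact N.add_mem (hx trivial) (hy trivial)

lemma annihilate_one {I : Type} (i : I) : annihilate i 1 = 0 := by
  rw [annihilate, CliffordAlgebra.contractLeft_one]

lemma majoranaMode_one {s : Sector} (χ : Chirality) {k : ℤ} (hk : 0 < k + s.shift) :
    majoranaMode s χ k 1 = 0 := by
  rcases s with _ | _
  · rcases k with j | j
    · exact annihilate_one _
    · simp only [Sector.shift] at hk
      omega
  · rcases k with (_ | j) | j
    · simp [Sector.shift] at hk
    · exact annihilate_one _
    · simp only [Sector.shift] at hk
      omega

lemma tensor_one_one_ne_zero {s : Sector} : tensor (1 : Majorana s) 1 ≠ 0 := by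
  -- The vacuum expectation value.
  let c : Majorana s →ₗ[ℂ] ℂ := (ExteriorAlgebra.algebraMapInv (R := ℂ)).toLinearMap
  have hc : c 1 = 1 := map_one (ExteriorAlgebra.algebraMapInv (R := ℂ) (M := CreationMode s →₀ ℂ))
  intro h
  have h1 : (TensorProduct.lid ℂ ℂ).toLinearMap (TensorProduct.map c c
    ((1 : Majorana s) ⊗ₜ[ℂ] (1 : Majorana s))) = 0 := by
    rw [show (1 : Majorana s) ⊗ₜ[ℂ] (1 : Majorana s) = 0 from h, map_zero, map_zero]
  rw [TensorProduct.map_tmul, hc] at h1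
  simp at h1

/-- The ground state of the sector `A` is the vacuum. -/
lemma isGround_A : IsGround .A (tensor 1 1) where
  ne_zero := tensor_one_one_ne_zero
  pos := by
    rintro ⟨χ, c⟩ k hk
    fin_cases c
    · change tensor (majoranaMode .A χ k 1) 1 = 0
      rw [majoranaMode_one χ hk]
      exact TensorProduct.zero_tmul _ _
    · change tensor (fermionParity 1) (majoranaMode .A χ k 1) = 0
      rw [majoranaMode_one χ hk]
      exact TensorProduct.tmul_zero _ _
  charged_eq_zero χ k hk := by
    have h : 0 < k + Sector.shift .A := by simp only [Sector.shift]; omega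
    have h0 : mode .A (χ, 0) k (tensor 1 1) = 0 := by
      change tensor (majoranaMode .A χ k 1) 1 = 0
      rw [majoranaMode_one χ h]
      exact TensorProduct.zero_tmul _ _
    have h1 : mode .A (χ, 1) k (tensor 1 1) = 0 := by
      change tensor (fermionParity 1) (majoranaMode .A χ k 1) = 0
      rw [majoranaMode_one χ h]
      exact TensorProduct.tmul_zero _ _
    rw [charged, LinearMap.add_apply, LinearMap.smul_apply, h0, h1, smul_zero, add_zero]
  even := by
    change tensor (fermionParity 1) (fermionParity 1) = tensor 1 1
    rw [parity_one]
  cyclic N hv hN := by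
    refine eq_top_of_create N hv ?_ ?_
    · rintro ⟨χ, j⟩ x hx
      exact hN (χ, 0) (Int.negSucc j) x hx
    · rintro ⟨χ, j⟩ x hx
      exact hN (χ, 1) (Int.negSucc j) x hx

/-- The state of the Majorana fermion in the sector `P` in which the zero mode is occupied. -/
def occupied : Majorana .P := ExteriorAlgebra.ι ℂ (Finsupp.single .zero 1)

lemma create_zero_one : create CreationMode.zero 1 = occupied :=
  mul_one (ExteriorAlgebra.ι ℂ (Finsupp.single CreationMode.zero (1 : ℂ)))

lemma create_zero_occupied : create CreationMode.zero occupied = 0 :=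
  ExteriorAlgebra.ι_sq_zero (Finsupp.single CreationMode.zero (1 : ℂ))

lemma annihilate_occupied (i : CreationMode .P) :
    annihilate i occupied = (Finsupp.single CreationMode.zero (1 : ℂ) i) • 1 := by
  rw [annihilate, occupied, Algebra.smul_def, mul_one]
  exact CliffordAlgebra.contractLeft_ι (Q := (0 : QuadraticForm ℂ (CreationMode .P →₀ ℂ)))
    (Finsupp.lapply i) (Finsupp.single CreationMode.zero (1 : ℂ))

lemma parity_occupied : fermionParity occupied = -occupied :=
  CliffordAlgebra.involute_ι (Q := (0 : QuadraticForm ℂ (CreationMode .P →₀ ℂ))) _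

/-- The ground state of the sector `P` is the combination of the two even states of the zero modes
which the zero modes of `b₁ + i b₂` and `b̄₁ - i b̄₂` kill. -/
def groundP : Dirac .P := tensor 1 1 + (-2 * Complex.I) • tensor occupied occupied

lemma majoranaMode_occupied (χ : Chirality) {k : ℤ} (hk : 0 < k) :
    majoranaMode .P χ k occupied = 0 := by
  rcases k with (_ | j) | j
  · simp at hk
  · refine (annihilate_occupied _).trans ?_
    rw [Finsupp.single_eq_of_ne (by simp), zero_smul]
  · omega

lemma tensor_smul_left {s : Sector} (c : ℂ) (x y : Majorana s) :
    tensor (c • x) y = c • tensor x y := (TensorProduct.smul_tmul' c x y).symm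

lemma tensor_smul_right {s : Sector} (c : ℂ) (x y : Majorana s) :
    tensor x (c • y) = c • tensor x y := TensorProduct.tmul_smul c x y

lemma tensor_zero {s : Sector} (x : Majorana s) : tensor x 0 = 0 := TensorProduct.tmul_zero _ _

lemma zero_tensor {s : Sector} (x : Majorana s) : tensor 0 x = 0 := TensorProduct.zero_tmul _ _

lemma neg_tensor {s : Sector} (x y : Majorana s) : tensor (-x) y = -tensor x y :=
  TensorProduct.neg_tmul _ _

lemma tensor_neg {s : Sector} (x y : Majorana s) : tensor x (-y) = -tensor x y :=
  TensorProduct.tmul_neg _ _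

lemma annihilate_zero_occupied : annihilate CreationMode.zero occupied = 1 := by
  rw [annihilate_occupied, Finsupp.single_eq_same, one_smul]

lemma groundP_pos (i : Chirality × Fin 2) {k : ℤ} (hk : 0 < k) : mode .P i k groundP = 0 := by
  have hk' : 0 < k + Sector.shift .P := by simpa [Sector.shift] using hk
  obtain ⟨χ, c⟩ := i
  rw [groundP, map_add, map_smul]
  fin_cases c
  · change tensor (majoranaMode .P χ k 1) 1 +
      _ • tensor (majoranaMode .P χ k occupied) occupied = 0
    rw [majoranaMode_one χ hk', majoranaMode_occupied χ hk, zero_tensor, zero_tensor, smul_zero,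
      add_zero]
  · change tensor (fermionParity 1) (majoranaMode .P χ k 1) +
      _ • tensor (fermionParity occupied) (majoranaMode .P χ k occupied) = 0
    rw [majoranaMode_one χ hk', majoranaMode_occupied χ hk, tensor_zero, tensor_zero, smul_zero,
      add_zero]

lemma charged_groundP (χ : Chirality) : charged .P 1 χ 0 groundP = 0 := by
  have h0 : mode .P (χ, 0) 0 = tmul (zeroMode χ) 1 := rfl
  have h1 : mode .P (χ, 1) 0 = tmul fermionParity (zeroMode χ) := rfl
  have hI : Complex.I * Complex.I = -1 := Complex.I_mul_I
  rw [charged, h0, h1, groundP]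
  rcases χ with _ | _ <;>
    simp only [zeroMode, Chirality.sign, LinearMap.add_apply, LinearMap.sub_apply,
      LinearMap.smul_apply, map_add, map_smul, tmul_tensor, create_zero_one, create_zero_occupied,
      annihilate_one, annihilate_zero_occupied, parity_one, parity_occupied, Module.End.one_apply,
      smul_zero, add_zero, zero_add, sub_zero, zero_sub, smul_neg, tensor_smul_left,
      tensor_smul_right, neg_tensor, tensor_neg, smul_smul]
  · match_scalars
    · linear_combination hI
    · ring
  · match_scalars
    · linear_combination Complex.I * hI
    · ring

lemma create_zero_eq : create CreationMode.zero =
    (1 / 2 : ℂ) • (zeroMode .left + (-Complex.I) • zeroMode .right) := by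
  rw [zeroMode, zeroMode, smul_smul, neg_mul, Complex.I_mul_I]
  module

lemma annihilate_zero_eq : annihilate CreationMode.zero =
    zeroMode .left + Complex.I • zeroMode .right := by
  rw [zeroMode, zeroMode, smul_smul, Complex.I_mul_I]
  module

lemma annihilate_annihilate_groundP :
    tmul (annihilate .zero) 1 (tmul fermionParity (annihilate .zero) groundP) =
      (2 * Complex.I) • tensor 1 1 := by
  rw [groundP]
  simp only [map_add, map_smul, tmul_tensor, annihilate_one, annihilate_zero_occupied,
    parity_occupied, parity_one, tensor_zero, zero_add, neg_tensor, map_neg]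
  rw [Module.End.one_apply]
  module

/-- The two zero modes of each of the two fermions generate the operators `create .zero` and
`annihilate .zero`, so that the ground state is cyclic. -/
lemma isGround_P : IsGround .P groundP where
  ne_zero h := by
    have h1 := annihilate_annihilate_groundP
    rw [h, map_zero, map_zero] at h1
    exact tensor_one_one_ne_zero ((smul_eq_zero.1 h1.symm).resolve_left (by simp))
  pos i k hk := groundP_pos i (by simpa [Sector.shift] using hk)
  charged_eq_zero χ k hk := by
    rcases hk.eq_or_lt with rfl | hk
    · exact charged_groundP χ
    · rw [charged, LinearMap.add_apply, LinearMap.smul_apply, groundP_pos _ hk, groundP_pos _ hk,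
        smul_zero, add_zero]
  even := by
    rw [groundP, parity, map_add, map_smul, tmul_tensor, tmul_tensor, parity_one, parity_occupied,
      neg_tensor, tensor_neg, neg_neg]
  cyclic N hv hN := by
    have hz : ∀ (a b : ℂ) (f : Module.End ℂ (Majorana .P)),
        f = a • (zeroMode .left + b • zeroMode .right) →
        (∀ x ∈ N, tmul f 1 x ∈ N) ∧ ∀ x ∈ N, tmul fermionParity f x ∈ N := by
      rintro a b f rfl
      have h1 : tmul (a • (zeroMode .left + b • zeroMode .right)) 1 =
          a • (mode .P (.left, 0) 0 + b • mode .P (.right, 0) 0) := by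
        refine (TensorProduct.map_smul_left _ _ _).trans ?_
        congr 1
        refine (TensorProduct.map_add_left _ _ _).trans ?_
        congr 1
        exact TensorProduct.map_smul_left _ _ _
      have h2 : tmul fermionParity (a • (zeroMode .left + b • zeroMode .right)) =
          a • (mode .P (.left, 1) 0 + b • mode .P (.right, 1) 0) := by
        refine (TensorProduct.map_smul_right _ _ _).trans ?_
        congr 1
        refine (TensorProduct.map_add_right _ _ _).trans ?_
        congr 1
        exact TensorProduct.map_smul_right _ _ _
      rw [h1, h2]
      exact ⟨fun x hx => N.smul_mem _ (N.add_mem (hN _ _ x hx) (N.smul_mem _ (hN _ _ x hx))),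
        fun x hx => N.smul_mem _ (N.add_mem (hN _ _ x hx) (N.smul_mem _ (hN _ _ x hx)))⟩
    have hc := hz _ _ _ create_zero_eq
    have ha := hz 1 _ _ (annihilate_zero_eq.trans (one_smul ℂ _).symm)
    refine eq_top_of_create N ?_ ?_ ?_
    · have h := ha.1 _ (ha.2 _ hv)
      rw [annihilate_annihilate_groundP] at h
      exact (Submodule.smul_mem_iff N (by simp)).1 h
    · rintro (⟨χ, j⟩ | _) x hx
      · exact hN (χ, 0) (Int.negSucc j) x hx
      · exact hc.1 x hx
    · rintro (⟨χ, j⟩ | _) x hx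
      · exact hN (χ, 1) (Int.negSucc j) x hx
      · exact hc.2 x hx

lemma exists_isGround (s : Sector) : ∃ v, IsGround s v := by
  rcases s with _ | _
  · exact ⟨_, isGround_A⟩
  · exact ⟨_, isGround_P⟩

end Dirac

namespace Dirac

variable {s : Sector}

/-! ### The even part of one sector -/

lemma lie_eq (x : Heis × Heis) (v : Dirac s) : ⁅x, v⁆ = heisAction (current s) x v := rfl

lemma lie_heisIncl (χ : Chirality) (x : Heis) (v : Dirac s) : ⁅heisIncl χ x, v⁆ =
    Finsupp.linearCombination ℂ (current s χ) x.coeff v + x.central • v := by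
  rcases χ with _ | _ <;> simp [lie_eq, heisAction, heisIncl]

lemma modes_dirac_apply (χ : Chirality) (n : ℤ) (v : Dirac s) :
    modes (Dirac s) χ n v = current s χ n v := by
  refine (lie_heisIncl χ (Heis.a n) v).trans ?_
  change Finsupp.linearCombination ℂ (current s χ) (Finsupp.single n 1) v + (0 : ℂ) • v = _
  simp

lemma modes_dirac : modes (Dirac s) = current s :=
  funext fun χ => funext fun n => LinearMap.ext fun v => modes_dirac_apply χ n v

lemma lie_K (χ : Chirality) (v : Dirac s) : ⁅heisIncl χ Heis.K, v⁆ = v := by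
  rw [lie_heisIncl]
  change Finsupp.linearCombination ℂ (current s χ) 0 v + (1 : ℂ) • v = v
  simp

lemma modes_even_coe (χ : Chirality) (n : ℤ) (x : even s) :
    (modes (even s) χ n x : Dirac s) = current s χ n x := modes_dirac_apply χ n (x : Dirac s)

lemma centralOne_even : CentralOne (even s) := fun χ v => Subtype.ext (lie_K χ (v : Dirac s))

lemma isSmooth_even : IsSmooth (modes (even s)) := by
  intro x
  obtain ⟨N, hN⟩ := isSmooth_current (x : Dirac s)
  exact ⟨N, fun χ k hk => Subtype.ext ((modes_even_coe χ k x).trans (hN χ k hk))⟩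

lemma virasoro_eq_sug (χ : Chirality) (n : ℤ) : virasoro s χ n = sug (current s) χ n := by
  obtain ⟨v, hv⟩ := exists_isGround s
  exact hv.virasoro_eq_sug χ n

lemma evenVirasoro_eq_sugawara (χ : Chirality) (n : ℤ) (x : even s) :
    evenVirasoro s χ n x = sugawara (even s) χ n x := by
  refine Subtype.ext ?_
  change virasoro s χ n x = (even s).toSubmodule.subtype (sug (modes (even s)) χ n x)
  rw [sug_intertwine isSmooth_even isSmooth_current (even s).toSubmodule.subtype modes_even_coe,
    virasoro_eq_sug]
  rfl

/-- The levels of the seas of even parity. -/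
def EvenLevel : Type := {t : Chirality → ℤ // Even (t .left - t .right)}

/-- A choice of ground state. -/
def ground (s : Sector) : Dirac s := (exists_isGround s).choose

lemma isGround_ground (s : Sector) : IsGround s (ground s) := (exists_isGround s).choose_spec

lemma parity_sea_ground (t : Chirality → ℤ) : parity s (sea (ground s) t) =
    (if Even (t .left - t .right) then (1 : ℂ) else -1) • sea (ground s) t := by
  rw [(isGround_ground s).parity_sea]
  congr 1
  by_cases h1 : Even (t .left) <;> by_cases h2 : Even (t .right) <;>
    simp only [levelSign, Int.even_sub, h1, h2] <;> norm_num

/-- The seas of even parity. -/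
def evenSea (s : Sector) (t : EvenLevel) : even s :=
  ⟨sea (ground s) t.1, by
    change parity s _ = _
    rw [parity_sea_ground, if_pos t.2, one_smul]⟩

lemma evenSea_ne_zero (t : EvenLevel) : evenSea s t ≠ 0 := fun h =>
  (isGround_ground s).sea_ne_zero t.1 (congrArg Subtype.val h)

lemma isVacuum_evenSea (t : EvenLevel) :
    IsVacuum (modes (even s)) (fun χ => (charge s (t.1 χ) : ℂ)) (evenSea s t) where
  pos χ n hn := Subtype.ext ((modes_even_coe χ n _).trans
    (((isGround_ground s).isVacuum_sea t.1).pos χ n hn))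
  zero χ := Subtype.ext ((modes_even_coe χ 0 _).trans
    (((isGround_ground s).isVacuum_sea t.1).zero χ))

/-- The even seas generate the even part: apply the projection `(1 + parity) / 2`, which commutes
with the currents. -/
lemma generates_evenSea : Generates (modes (even s)) (Set.range (evenSea s)) := by
  intro N hsea hN
  let E : Submodule ℂ (Dirac s) := N.map (even s).toSubmodule.subtype
  have hE : ∀ χ n, ∀ x ∈ E, current s χ n x ∈ E := by
    rintro χ n _ ⟨x, hx, rfl⟩
    exact ⟨_, hN χ n x hx, modes_even_coe χ n x⟩
  have htop : E.comap (1 + parity s) = ⊤ := by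
    refine (isGround_ground s).generates_sea _ ?_ fun χ n x hx => ?_
    · rintro _ ⟨t, rfl⟩
      change sea (ground s) t + parity s (sea (ground s) t) ∈ E
      rw [parity_sea_ground]
      split_ifs with ht
      · have h1 : sea (ground s) t ∈ E := ⟨evenSea s ⟨t, ht⟩, hsea ⟨_, rfl⟩, rfl⟩
        exact E.add_mem h1 (E.smul_mem _ h1)
      · rw [neg_one_smul, add_neg_cancel]
        exact E.zero_mem
    · have hc := ((Commute.one_left _).add_left (commute_parity_current s χ n)).eq
      rw [Submodule.mem_comap, ← Module.End.mul_apply, hc]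
      exact hE χ n _ hx
  refine eq_top_iff.2 fun x _ => ?_
  have hx : (x : Dirac s) ∈ E.comap (1 + parity s) := htop ▸ Submodule.mem_top
  rw [Submodule.mem_comap, LinearMap.add_apply, Module.End.one_apply,
    show parity s (x : Dirac s) = x from x.2, ← two_smul ℂ,
    Submodule.smul_mem_iff _ two_ne_zero] at hx
  obtain ⟨y, hy, hyx⟩ := hx
  rwa [← Subtype.ext hyx]

lemma charge_injective : Function.Injective (charge s) := fun t t' h => by
  simpa [charge] using h

lemma weight_injective {p q : ℝ × ℝ}
    (h : weight p.1 p.2 .left + Complex.I * weight p.1 p.2 .right =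
      weight q.1 q.2 .left + Complex.I * weight q.1 q.2 .right) : p = q := by
  have h1 := congrArg Complex.re h
  have h2 := congrArg Complex.im h
  simp [weight] at h1 h2
  exact Prod.ext h1 h2

/-- The decomposition of the even part of one sector. -/
theorem exists_equiv_even {Λ : Set (ℝ × ℝ)}
    (hΛ : ∀ p, p ∈ Λ ↔ ∃ t : EvenLevel, p = (charge s (t.1 .left), charge s (t.1 .right))) :
    ∃ Φ : even s ≃ₗ⁅ℂ, Heis × Heis⁆ VermaSum Λ,
      ∀ χ n v, Φ (evenVirasoro s χ n v) = sugawara (VermaSum Λ) χ n (Φ v) := by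
  choose τ hτ using fun p : Λ => (hΛ p.1).1 p.2
  have hw : ∀ p : Λ, weight p.1.1 p.1.2 = fun χ => (charge s ((τ p).1 χ) : ℂ) := fun p => by
    rw [hτ p]
    funext χ
    rcases χ with _ | _ <;> rfl
  obtain ⟨Φ, hΦ⟩ := exists_equiv_directSum (ι := Λ) (w := fun p => weight p.1.1 p.1.2)
    (centralOne_even (s := s)) isSmooth_even (fun p => evenSea s (τ p))
    (fun p => by
      rw [hw p]
      exact isVacuum_evenSea (τ p))
    (fun p => evenSea_ne_zero _) (fun p q h => Subtype.ext (weight_injective h))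
    (fun N hsea hN => generates_evenSea N (by
      rintro _ ⟨t, rfl⟩
      have hp := (hΛ _).2 ⟨t, rfl⟩
      refine hsea ⟨⟨_, hp⟩, ?_⟩
      have h1 := hτ ⟨_, hp⟩
      simp only [Prod.mk.injEq, charge_injective.eq_iff] at h1
      refine congrArg _ (Subtype.ext (funext fun χ => ?_))
      rcases χ with _ | _
      · exact h1.1.symm
      · exact h1.2.symm) hN)
  refine ⟨Φ, fun χ n v => ?_⟩
  rw [evenVirasoro_eq_sugawara]
  exact hΦ χ n v

end Dirac

/-! ### The even part of the Dirac fermion -/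

namespace DiracSpace

open Dirac (EvenLevel)

lemma modes_even_apply (χ : Chirality) (n : ℤ) (x : even) (s : Sector) :
    (modes even χ n x : DiracSpace) s = Dirac.current s χ n ((x : DiracSpace) s) :=
  (DirectSum.lie_module_bracket_apply _ _ s).trans (Dirac.modes_dirac_apply χ n _)

lemma centralOne_even : CentralOne even := fun χ _ => Subtype.ext (DFinsupp.ext fun s =>
  (DirectSum.lie_module_bracket_apply _ _ s).trans (Dirac.lie_K χ _))

lemma isSmooth_even : IsSmooth (modes even) := by
  intro x
  choose N hN using fun s => Dirac.isSmooth_current ((x : DiracSpace) s)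
  refine ⟨max (N .A) (N .P), fun χ k hk => Subtype.ext (DFinsupp.ext fun s => ?_)⟩
  refine (modes_even_apply χ k x s).trans (hN s χ k ?_)
  rcases s with _ | _
  · exact (le_max_left _ _).trans hk
  · exact (le_max_right _ _).trans hk

lemma evenVirasoro_eq_sugawara (χ : Chirality) (n : ℤ) (x : even) :
    evenVirasoro χ n x = sugawara even χ n x := by
  refine Subtype.ext (DFinsupp.ext fun s => ?_)
  let p : even →ₗ[ℂ] Dirac s :=
    DirectSum.component ℂ Sector (fun s => Dirac s) s ∘ₗ even.toSubmodule.subtype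
  have h := sug_intertwine isSmooth_even Dirac.isSmooth_current p
    (fun χ n x => modes_even_apply χ n x s) χ n x
  refine Eq.trans ?_ h.symm
  rw [← Dirac.virasoro_eq_sug]
  rfl

/-- The inclusion of the even part of one sector. -/
def incl (s : Sector) : Dirac.even s →ₗ[ℂ] even :=
  LinearMap.codRestrict even.toSubmodule
    (DirectSum.lof ℂ Sector (fun s => Dirac s) s ∘ₗ (Dirac.even s).toSubmodule.subtype)
    fun x => by
      change DirectSum.lmap Dirac.parity (DirectSum.lof ℂ Sector (fun s => Dirac s) s x) = _
      rw [DirectSum.lmap_lof, show Dirac.parity s (x : Dirac s) = x from x.2]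
      rfl

lemma incl_apply_same (s : Sector) (x : Dirac.even s) : (incl s x : DiracSpace) s = x :=
  DirectSum.of_eq_same (β := fun s => Dirac s) s (x : Dirac s)

lemma incl_apply_ne {s s' : Sector} (h : s' ≠ s) (x : Dirac.even s) :
    (incl s x : DiracSpace) s' = 0 :=
  DirectSum.of_eq_of_ne (β := fun s => Dirac s) s s' (x : Dirac s) h

lemma modes_incl (χ : Chirality) (n : ℤ) (s : Sector) (x : Dirac.even s) :
    incl s (modes (Dirac.even s) χ n x) = modes even χ n (incl s x) := by
  refine Subtype.ext (DFinsupp.ext fun s' => ?_)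
  refine Eq.trans ?_ (modes_even_apply χ n _ s').symm
  by_cases h : s' = s
  · subst h
    rw [incl_apply_same, incl_apply_same, Dirac.modes_even_coe]
  · rw [incl_apply_ne h, incl_apply_ne h, map_zero]

lemma generates_incl (S : ∀ s, Set (Dirac.even s))
    (hS : ∀ s, Generates (modes (Dirac.even s)) (S s)) :
    Generates (modes even) (⋃ s, incl s '' S s) := by
  intro N hN hstable
  have h1 : ∀ s, N.comap (incl s) = ⊤ := fun s => hS s _
    (fun x hx => hN (Set.mem_iUnion.2 ⟨s, x, hx, rfl⟩))
    (fun χ n x hx => by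
      rw [Submodule.mem_comap, modes_incl]
      exact hstable χ n _ hx)
  have h2 : ∀ s x, incl s x ∈ N := fun s x => by
    have : x ∈ N.comap (incl s) := h1 s ▸ Submodule.mem_top
    exact this
  refine eq_top_iff.2 fun x _ => ?_
  have hx : ∀ s, (x : DiracSpace) s ∈ Dirac.even s := fun s =>
    DFunLike.congr_fun (show parity (x : DiracSpace) = x from x.2) s
  have hsum : x = incl .A ⟨_, hx .A⟩ + incl .P ⟨_, hx .P⟩ := by
    refine Subtype.ext (DFinsupp.ext fun s => ?_)
    change _ = (incl .A ⟨_, hx .A⟩ : DiracSpace) s + (incl .P ⟨_, hx .P⟩ : DiracSpace) s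
    rcases s with _ | _
    · rw [incl_apply_same, incl_apply_ne (by simp), add_zero]
    · rw [incl_apply_same, incl_apply_ne (by simp), zero_add]
  rw [hsum]
  exact N.add_mem (h2 _ _) (h2 _ _)

/-- The weights of the seas in both sectors are the weights of the boson at radius `2`: the sector
is given by the parity of `e`. -/
lemma exists_level (em : ℤ × ℤ) : ∃ (s : Sector) (t : EvenLevel), ∀ χ,
    bosonWeight 2 em χ = (Dirac.charge s (t.1 χ) : ℂ) := by
  obtain ⟨e, m⟩ := em
  obtain ⟨k, rfl | rfl⟩ := Int.even_or_odd' e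
  · refine ⟨.A, ⟨fun | .left => -k - m | .right => -k + m, ⟨-m, by ring⟩⟩, fun χ => ?_⟩
    rcases χ with _ | _ <;> simp [bosonWeight, weight, Dirac.charge, Sector.shift] <;> ring
  · refine ⟨.P, ⟨fun | .left => -k - m | .right => -k + m, ⟨-m, by ring⟩⟩, fun χ => ?_⟩
    rcases χ with _ | _ <;> simp [bosonWeight, weight, Dirac.charge, Sector.shift] <;> ring

lemma exists_bosonWeight (s : Sector) (t : EvenLevel) : ∃ em : ℤ × ℤ, ∀ χ,
    bosonWeight 2 em χ = (Dirac.charge s (t.1 χ) : ℂ) := by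
  obtain ⟨t, ⟨k, hk⟩⟩ := t
  refine ⟨(1 - s.shift - t .left - t .right, -k), fun χ => ?_⟩
  have hk' : (t .left : ℂ) = t .right + 2 * k := by
    have : t .left = t .right + 2 * k := by omega
    rw [this]
    push_cast
    ring
  rcases χ with _ | _ <;> simp [bosonWeight, weight, Dirac.charge, hk'] <;> ring

lemma charge_eq_iff {s s' : Sector} {t t' : ℤ} (h : Dirac.charge s t = Dirac.charge s' t') :
    s = s' ∧ t = t' := by
  have h1 : ((1 - s.shift - 2 * t : ℤ) : ℝ) = ((1 - s'.shift - 2 * t' : ℤ) : ℝ) := by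
    simp only [Dirac.charge] at h
    push_cast
    linarith
  have h2 : 1 - s.shift - 2 * t = 1 - s'.shift - 2 * t' := by exact_mod_cast h1
  rcases s with _ | _ <;> rcases s' with _ | _ <;> simp only [Sector.shift] at h2
  · exact ⟨rfl, by omega⟩
  · omega
  · omega
  · exact ⟨rfl, by omega⟩

lemma bosonWeight_injective : Function.Injective fun em : ℤ × ℤ =>
    bosonWeight 2 em .left + Complex.I * bosonWeight 2 em .right := by
  rintro ⟨e, m⟩ ⟨e', m'⟩ h
  have h1 := Dirac.weight_injective (p := (_, _)) (q := (_, _)) h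
  simp only [Prod.mk.injEq] at h1
  have he : (e : ℝ) = e' := by linarith [h1.1, h1.2]
  have hm : (m : ℝ) = m' := by linarith [h1.1, h1.2]
  exact Prod.ext (by exact_mod_cast he) (by exact_mod_cast hm)

/-- The decomposition of the even part of the Dirac fermion. -/
theorem exists_equiv_even : ∃ Φ : even ≃ₗ⁅ℂ, Heis × Heis⁆ FreeBoson 2,
    ∀ χ n v, Φ (evenVirasoro χ n v) = sugawara (FreeBoson 2) χ n (Φ v) := by
  choose σ τ hτ using exists_level
  obtain ⟨Φ, hΦ⟩ := exists_equiv_directSum (ι := ℤ × ℤ) (w := bosonWeight 2)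
    centralOne_even isSmooth_even (fun em => incl (σ em) (Dirac.evenSea (σ em) (τ em)))
    (fun em => by
      have hv := Dirac.isVacuum_evenSea (s := σ em) (τ em)
      refine ⟨fun χ n hn => ?_, fun χ => ?_⟩
      · rw [← modes_incl, hv.pos χ n hn, map_zero]
      · rw [← modes_incl, hv.zero χ, map_smul, hτ])
    (fun em h => Dirac.evenSea_ne_zero (s := σ em) (τ em) (by
      refine Subtype.ext ?_
      rw [← incl_apply_same, h]
      rfl))
    bosonWeight_injective
    (fun N hsea hN => generates_incl (fun s => Set.range (Dirac.evenSea s))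
      (fun s => Dirac.generates_evenSea) N (by
        refine Set.iUnion_subset fun s => ?_
        rintro _ ⟨_, ⟨t, rfl⟩, rfl⟩
        obtain ⟨em, hem⟩ := exists_bosonWeight s t
        have h1 : ∀ χ, s = σ em ∧ t.1 χ = (τ em).1 χ := fun χ =>
          charge_eq_iff (by exact_mod_cast (hem χ).symm.trans (hτ em χ))
        have h2 : t = τ em := Subtype.ext (funext fun χ => (h1 χ).2)
        obtain ⟨hs, _⟩ := h1 .left
        rw [h2]
        subst hs
        exact hsea ⟨em, rfl⟩) hN)
  refine ⟨Φ, fun χ n v => ?_⟩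
  rw [evenVirasoro_eq_sugawara]
  exact hΦ χ n v

end DiracSpace

/-- The even seas of the sector `A` have the weights in `Λ₁`. -/
lemma mem_Λ₁_iff (p : ℝ × ℝ) : p ∈ Λ₁ ↔ ∃ t : Dirac.EvenLevel,
    p = (Dirac.charge .A (t.1 .left), Dirac.charge .A (t.1 .right)) := by
  constructor
  · rintro ⟨e, m, ⟨k, rfl⟩, rfl⟩
    refine ⟨⟨fun | .left => -k - m | .right => -k + m, ⟨-m, by ring⟩⟩, Prod.ext ?_ ?_⟩ <;>
      simp [Dirac.charge, Sector.shift] <;> ring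
  · rintro ⟨⟨t, k, hk⟩, rfl⟩
    have hk' : (t .left : ℝ) = t .right + 2 * k := by
      have : t .left = t .right + 2 * k := by omega
      exact_mod_cast this
    refine ⟨-t .left - t .right, -k, ⟨-t .right - k, by omega⟩, Prod.ext ?_ ?_⟩ <;>
      simp [Dirac.charge, Sector.shift, hk'] <;> ring

/-- The even seas of the sector `P` have the weights in `Λ₂`. -/
lemma mem_Λ₂_iff (p : ℝ × ℝ) : p ∈ Λ₂ ↔ ∃ t : Dirac.EvenLevel,
    p = (Dirac.charge .P (t.1 .left), Dirac.charge .P (t.1 .right)) := by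
  constructor
  · rintro ⟨e, m, ⟨k, rfl⟩, rfl⟩
    refine ⟨⟨fun | .left => -k - m | .right => -k + m, ⟨-m, by ring⟩⟩, Prod.ext ?_ ?_⟩ <;>
      simp [Dirac.charge, Sector.shift] <;> ring
  · rintro ⟨⟨t, k, hk⟩, rfl⟩
    have hk' : (t .left : ℝ) = t .right + 2 * k := by
      have : t .left = t .right + 2 * k := by omega
      exact_mod_cast this
    refine ⟨1 - t .left - t .right, -k, ⟨-t .right - k, by omega⟩, Prod.ext ?_ ?_⟩ <;>
      simp [Dirac.charge, Sector.shift, hk'] <;> ring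

end Bosonization

end

theorem mainTheorem2 :
    (∃ Φ : Bosonization.DiracSpace.even ≃ₗ⁅ℂ, Bosonization.Heis × Bosonization.Heis⁆
        Bosonization.FreeBoson 2,
      ∀ χ n v, Φ (Bosonization.DiracSpace.evenVirasoro χ n v) =
        Bosonization.sugawara (Bosonization.FreeBoson 2) χ n (Φ v)) ∧
    (∃ Φ : Bosonization.Dirac.even .A ≃ₗ⁅ℂ, Bosonization.Heis × Bosonization.Heis⁆
        Bosonization.VermaSum Bosonization.Λ₁,
      ∀ χ n v, Φ (Bosonization.Dirac.evenVirasoro .A χ n v) =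
        Bosonization.sugawara (Bosonization.VermaSum Bosonization.Λ₁) χ n (Φ v)) ∧
    (∃ Φ : Bosonization.Dirac.even .P ≃ₗ⁅ℂ, Bosonization.Heis × Bosonization.Heis⁆
        Bosonization.VermaSum Bosonization.Λ₂,
      ∀ χ n v, Φ (Bosonization.Dirac.evenVirasoro .P χ n v) =
        Bosonization.sugawara (Bosonization.VermaSum Bosonization.Λ₂) χ n (Φ v)) := by
  exact ⟨Bosonization.DiracSpace.exists_equiv_even,
    Bosonization.Dirac.exists_equiv_even Bosonization.mem_Λ₁_iff,
    Bosonization.Dirac.exists_equiv_even Bosonization.mem_Λ₂_iff⟩
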